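/- **Setting.** Let $d\ge 1$ and let $\mathcal S(\mathbf R^d)$ be the space of real-valued Schwartz functions; $\mathcal F v(\xi)=\int e^{-i2\pi\xi\cdot x}v(x)\,dx$. For $\sigma\in(0,2)$ let $\mathfrak A^\sigma$ be the class of nonnegative measures $\pi$ on $\mathbf R^d_0=\mathbf R^d\setminus\{0\}$ with $\int(|y|^2\wedge1)\,d\pi<\infty$ and $\sigma=\inf\{\alpha<2:\int_{|y|\le1}|y|^\alpha d\pi<\infty\}$, such that $\int_{|y|>1}|y|\,d\pi<\infty$ if $\sigma\in(1,2)$, and $\int_{R<|y|\le R'}y\,d\pi=0$ for all $0<R<R'<\infty$ if $\sigma=1$. Put $\mathfrak A=\bigcup_{\sigma\in(0,2)}\mathfrak A^\sigma$. Let $\chi_\sigma(y)=0$ if $\sigma<1$, $\chi_\sigma(y)=1_{\{|y|\le1\}}$ if $\sigma=1$, $\chi_\sigma(y)=1$ if $\sigma>1$. For $\pi\in\mathfrak A^\sigma$ and $\delta\in(0,1]$ let $$\psi^\pi(\xi)=\int\left[e^{i2\pi\xi\cdot y}-1-i2\pi\chi_\sigma(y)\,\xi\cdot y\right]\pi(dy),$$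 $\psi^{\pi;1}=\psi^\pi$, $\psi^{\pi;\delta}=-(-\operatorname{Re}\psi^\pi)^\delta$ if $\delta\in(0,1)$, and $L^{\pi;\delta}v=\mathcal F^{-1}[\psi^{\pi;\delta}\mathcal Fv]$ for $v\in\mathcal S(\mathbf R^d)$. A continuous $\kappa:(0,\infty)\to(0,\infty)$ is a *scaling function with scaling factor* $l$ if $\lim_{R\to0}\kappa(R)=0$, $\lim_{R\to\infty}\kappa(R)=\infty$, and $l$ is a nondecreasing continuous function on $(0,\infty)$ with $\lim_{\varepsilon\to0}l(\varepsilon)=0$ and $\kappa(\varepsilon r)\le l(\varepsilon)\kappa(r)$ for all $\varepsilon,r>0$. Put $\gamma(t)=\inf\{r>0:l(r)\ge t\}$, $t>0$, and for $R>0$ let $\tilde\pi_R(\Gamma)=\kappa(R)\int1_\Gamma(y/R)\,\pi(dy)$. **D**$(\kappa,l)$: there is $\mu^0\in\mathfrak A$, concentrated on $\{|y|\le1\}$, with $\tilde\pi_R\ge 1_{\{|y|\le1\}}\mu^0$ for every $R>0$, and there are constants $n_0$ and $c_1>0$ such that $$\int|y|^2\,d\mu^0+\int|\xi|^4[1+\lambda(\xi)]^{d+3}e^{-\psi_0(\xi)}\,d\xi\le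 n_0,\qquad \int_{|y|\le1}|\xi\cdot y|^2\,\mu^0(dy)\ge c_1\quad(|\xi|=1),$$ where $\psi_0(\xi)=\int_{|y|\le1}[1-\cos(2\pi\xi\cdot y)]\,\mu^0(dy)$ and $\lambda(\xi)=\int_{|y|\le1}\chi_\sigma(y)|y|[(|\xi||y|)\wedge1]\,\mu^0(dy)$; if $\sigma=1$, in addition $\int_{R<|y|\le R'}y\,d\mu^0=0$ for all $0<R<R'\le1$. **B**$(\kappa,l)$: there are $\alpha_1,\alpha_2$ and $N_0>0$ with $$\int_{|z|\le1}|z|^{\alpha_1}\tilde\pi_R(dz)+\int_{|z|>1}|z|^{\alpha_2}\tilde\pi_R(dz)\le N_0\quad\text{for all }R>0,$$ where $\alpha_1,\alpha_2\in(0,1]$ if $\sigma\in(0,1)$; $\alpha_1,\alpha_2\in(1,2]$ if $\sigma\in(1,2)$; $\alpha_1\in(1,2]$, $\alpha_2\in[0,1)$ if $\sigma=1$. **Proposition.** Let $\pi\in\mathfrak A^\sigma$ satisfy **D**$(\kappa,l)$ and **B**$(\kappa,l)$ for a scaling function $\kappa$ with scaling factor $l$. Let $\delta\in(0,1]$, $p\in(1,\infty)$,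 and assume $$\int_0^1t^{\delta-1}\gamma(t)^{-d/p}\,dt+\int_1^\infty t^{\delta-1}\gamma(t)^{-1-d/p}\,dt<\infty .$$ Then $L^{\pi;\delta}f\in L_p(\mathbf R^d)$ for every $f\in\mathcal S(\mathbf R^d)$, and there is a constant $C$ such that for all $f\in\mathcal S(\mathbf R^d)$ and all $z\ne0$ $$\sup_x|f(x+z)-f(x)|\le C\,\kappa(|z|)^{\delta}\,|z|^{-d/p}\,|L^{\pi;\delta}f|_{L_p(\mathbf R^d)} .$$ Moreover $\int_{|z|\le1}\kappa(|z|)^\delta|z|^{-d/p}dz<\infty$, and there is a constant $C$ such that for all $f\in\mathcal S(\mathbf R^d)$ $$\sup_x|f(x)|\le|f|_{L_p(\mathbf R^d)}+C\,|L^{\pi;\delta}f|_{L_p(\mathbf R^d)}\int_{|z|\le1}\kappa(|z|)^{\delta}|z|^{-d/p}\,dz .$$ -/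

import Mathlib

open MeasureTheory Set Filter Topology
open scoped NNReal ENNReal FourierTransform SchwartzMap

noncomputable section

namespace LevySmooth

/-- `ℝ^d` with its Euclidean norm. -/
abbrev Rd (d : ℕ) : Type := EuclideanSpace ℝ (Fin d)

/-- The annulus `{y : R < |y| ≤ R'}`. -/
def annulus (d : ℕ) (R R' : ℝ) : Set (Rd d) := {y | R < ‖y‖ ∧ ‖y‖ ≤ R'}

/-- The class of Lévy measures of order `σ ∈ (0,2)`. A measure on `ℝ^d ∖ {0}` is
represented by a measure on `ℝ^d` that does not charge the origin. -/
structure ClassA {d : ℕ} (σ : ℝ) (π : Measure (Rd d)) : Prop where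
  sigma_pos : 0 < σ
  sigma_lt : σ < 2
  zero_null : π {0} = 0
  levy : ∫⁻ y, ENNReal.ofReal (min (‖y‖ ^ 2) 1) ∂π < ∞
  order : IsGLB {α : ℝ | α < 2 ∧
    ∫⁻ y in Metric.closedBall 0 1, ENNReal.ofReal (‖y‖ ^ α) ∂π < ∞} σ
  moment : 1 < σ → ∫⁻ y in (Metric.closedBall 0 1)ᶜ, ENNReal.ofReal ‖y‖ ∂π < ∞
  centered : σ = 1 → ∀ R R' : ℝ, 0 < R → R < R' → ∫ y in annulus d R R', y ∂π = 0

/-- The cut-off `χ_σ`: `0` for `σ < 1`, the indicator of the closed unit ball for `σ = 1`,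
and `1` for `σ > 1`. -/
def chi {d : ℕ} (σ : ℝ) (y : Rd d) : ℝ :=
  if σ < 1 then 0 else if σ = 1 then (if ‖y‖ ≤ 1 then 1 else 0) else 1

/-- The symbol `ψ^π(ξ) = ∫ [e^{i2π ξ·y} - 1 - i2π χ_σ(y) ξ·y] π(dy)`. -/
def symbol {d : ℕ} (σ : ℝ) (π : Measure (Rd d)) (ξ : Rd d) : ℂ :=
  ∫ y, (Complex.exp (2 * (Real.pi : ℂ) * Complex.I * ((inner ℝ ξ y : ℝ) : ℂ)) - 1
    - 2 * (Real.pi : ℂ) * Complex.I * ((chi σ y * inner ℝ ξ y : ℝ) : ℂ)) ∂π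

/-- `ψ^{π;δ}`: equal to `ψ^π` for `δ = 1` and to `-(-Re ψ^π)^δ` otherwise. -/
def symbolPow {d : ℕ} (σ : ℝ) (π : Measure (Rd d)) (δ : ℝ) (ξ : Rd d) : ℂ :=
  if δ = 1 then symbol σ π ξ else ((-((-(symbol σ π ξ).re) ^ δ) : ℝ) : ℂ)

/-- `L^{π;δ} v = 𝓕⁻¹[ψ^{π;δ} 𝓕 v]`, with `𝓕 v(ξ) = ∫ e^{-i2π ξ·x} v(x) dx`. -/
def opL {d : ℕ} (σ : ℝ) (π : Measure (Rd d)) (δ : ℝ) (v : 𝓢(Rd d, ℝ)) : Rd d → ℂ :=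
  𝓕⁻ (fun ξ : Rd d => symbolPow σ π δ ξ * 𝓕 (fun x : Rd d => (v x : ℂ)) ξ)

/-- `κ : (0,∞) → (0,∞)` is a scaling function with scaling factor `l`
(only the values on `(0,∞)` matter). -/
structure IsScaling (κ l : ℝ → ℝ) : Prop where
  pos : ∀ r, 0 < r → 0 < κ r
  cont : ContinuousOn κ (Ioi 0)
  tendsto_zero : Tendsto κ (𝓝[>] 0) (𝓝 0)
  tendsto_atTop : Tendsto κ atTop atTop
  factor_mono : MonotoneOn l (Ioi 0)
  factor_cont : ContinuousOn l (Ioi 0)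
  factor_tendsto : Tendsto l (𝓝[>] 0) (𝓝 0)
  scaling : ∀ ε r, 0 < ε → 0 < r → κ (ε * r) ≤ l ε * κ r

/-- The generalized inverse `γ(t) = inf {r > 0 : l(r) ≥ t}`. -/
def gam (l : ℝ → ℝ) (t : ℝ) : ℝ := sInf {r : ℝ | 0 < r ∧ t ≤ l r}

/-- The rescaled measure `π̃_R(Γ) = κ(R) ∫ 1_Γ(y/R) π(dy)`. -/
def rescaled {d : ℕ} (κ : ℝ → ℝ) (π : Measure (Rd d)) (R : ℝ) : Measure (Rd d) :=
  ENNReal.ofReal (κ R) • π.map (fun y => R⁻¹ • y)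

/-- `ψ₀(ξ) = ∫_{|y| ≤ 1} [1 - cos(2π ξ·y)] μ⁰(dy)`. -/
def psi0 {d : ℕ} (μ0 : Measure (Rd d)) (ξ : Rd d) : ℝ :=
  ∫ y in Metric.closedBall 0 1, (1 - Real.cos (2 * Real.pi * inner ℝ ξ y)) ∂μ0

/-- `λ(ξ) = ∫_{|y| ≤ 1} χ_σ(y) |y| [(|ξ||y|) ∧ 1] μ⁰(dy)`. -/
def lam {d : ℕ} (σ : ℝ) (μ0 : Measure (Rd d)) (ξ : Rd d) : ℝ :=
  ∫ y in Metric.closedBall 0 1, chi σ y * ‖y‖ * min (‖ξ‖ * ‖y‖) 1 ∂μ0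

/-- Assumption `A₀(σ)` on the auxiliary measure `μ⁰`, with constants `n₀` and `c₁`. -/
structure AssumptionA0 {d : ℕ} (σ : ℝ) (n0 c1 : ℝ) (μ0 : Measure (Rd d)) : Prop where
  mem_class : ∃ σ' : ℝ, ClassA σ' μ0
  support : μ0.restrict (Metric.closedBall 0 1) = μ0
  bound : ∫⁻ y, ENNReal.ofReal (‖y‖ ^ 2) ∂μ0
    + ∫⁻ ξ : Rd d, ENNReal.ofReal
        (‖ξ‖ ^ 4 * (1 + lam σ μ0 ξ) ^ (d + 3) * Real.exp (-psi0 μ0 ξ))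
    ≤ ENNReal.ofReal n0
  c1_pos : 0 < c1
  nondegenerate : ∀ ξ : Rd d, ‖ξ‖ = 1 →
    ENNReal.ofReal c1 ≤
      ∫⁻ y in Metric.closedBall 0 1, ENNReal.ofReal (|inner ℝ ξ y| ^ 2) ∂μ0

/-- Assumption `D(κ,l)` for `π` (of order `σ`). -/
def AssumptionD {d : ℕ} (σ : ℝ) (κ : ℝ → ℝ) (π : Measure (Rd d)) : Prop :=
  ∃ (μ0 : Measure (Rd d)) (n0 c1 : ℝ), AssumptionA0 σ n0 c1 μ0 ∧
    (∀ R : ℝ, 0 < R → μ0.restrict (Metric.closedBall 0 1) ≤ rescaled κ π R) ∧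
    (σ = 1 → ∀ R R' : ℝ, 0 < R → R < R' → R' ≤ 1 → ∫ y in annulus d R R', y ∂μ0 = 0)

/-- The admissible ranges of the exponents `α₁, α₂` in assumption `B(κ,l)`. -/
def AdmissibleExponents (σ α₁ α₂ : ℝ) : Prop :=
  (σ < 1 → α₁ ∈ Ioc (0 : ℝ) 1 ∧ α₂ ∈ Ioc (0 : ℝ) 1) ∧
  (1 < σ → α₁ ∈ Ioc (1 : ℝ) 2 ∧ α₂ ∈ Ioc (1 : ℝ) 2) ∧
  (σ = 1 → α₁ ∈ Ioc (1 : ℝ) 2 ∧ α₂ ∈ Ico (0 : ℝ) 1)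

/-- Assumption `B(κ,l)` for `π` (of order `σ`). -/
def AssumptionB {d : ℕ} (σ : ℝ) (κ : ℝ → ℝ) (π : Measure (Rd d)) : Prop :=
  ∃ α₁ α₂ N0 : ℝ, AdmissibleExponents σ α₁ α₂ ∧ 0 < N0 ∧ ∀ R : ℝ, 0 < R →
    ∫⁻ z in Metric.closedBall 0 1, ENNReal.ofReal (‖z‖ ^ α₁) ∂(rescaled κ π R)
    + ∫⁻ z in (Metric.closedBall 0 1)ᶜ, ENNReal.ofReal (‖z‖ ^ α₂) ∂(rescaled κ π R)
    ≤ ENNReal.ofReal N0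

/-- The norm `|g|_{L_p(ℝ^d)}` of a complex-valued function (meaningful for `g ∈ L_p`). -/
def normLp {d : ℕ} (p : ℝ) (g : Rd d → ℂ) : ℝ :=
  (eLpNorm g (ENNReal.ofReal p) volume).toReal

end LevySmooth

end

open MeasureTheory Set Filter Topology
open scoped NNReal ENNReal FourierTransform SchwartzMap

set_option linter.unusedSectionVars false

noncomputable section

namespace LevySmooth

/-! Write `ψ` for the symbol and `T_t` for the operator with multiplier `exp(tψ)`. For `δ = 1`,
formally, `f(x+z) - f(x) = -∫_0^∞ [T_t Lf(x+z) - T_t Lf(x)] dt`. For `δ < 1` the same holds with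
weight `t^(δ-1)/Γ(δ)` and with `Re ψ` in place of `ψ`, because `∫ t^(δ-1) e^(-ta) dt = Γ(δ) a^(-δ)`.
Everything therefore rests on the increments of `T_t g` for `g` in `L_p`.

Choose `R` with `κ(R) = t`. Then `κ(R) ψ(R⁻¹ ·)` is the Lévy exponent of the rescaled measure, which
dominates `μ⁰` for every `R`. The exponential of the difference of the two exponents is, up to a
drift, the transform of an infinitely divisible probability law, so multiplying by it cannot
increase the `L¹` norm of a kernel (`lintegral_fourierInv_exp_symb_sub_mul_le`). All kernel bounds
are thus inherited, uniformly in `R`, from the single multiplier attached to `μ⁰`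
(`exists_kernelBound`); the weighted integral in assumption D gives that multiplier enough
integrable derivatives for its kernel and the gradient of its kernel to be in `L¹`
(`fourierInv_exp_symb_decay`).

The increment by `w` of a unit-scale kernel is then `O(min(1,|w|))` in `L¹` and in `L^∞`.
Interpolation, Hölder and dilation bound the increment of `T_t g` by `C min(1,|z|/R) R^(-d/p)
‖g‖_p`. Since `γ(t/κ(|z|)) ≤ R/|z|`, the substitution `t = κ(|z|) s` turns the time integral into
`κ(|z|)^δ |z|^(-d/p)` times the integral assumed finite (`exists_norm_increment_le`).

For `δ = 1` the use of Fubini needs `|ψ| ≤ B (-Re ψ)`, obtained by comparing assumptions B and D at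
the scale `R = 1/(2|ξ|)` (`exists_norm_symb_le_re`). Membership in `L_p` holds because the image of
a Schwartz function is bounded and lies in `L¹`: by Taylor expansion for the generator, then by
stable subordination for its fractional powers. The supremum bound follows from the increments over
an annulus of measure at least one and Chebyshev's inequality (`exists_norm_le_of_increment`). -/

variable {V : Type*} [NormedAddCommGroup V] [InnerProductSpace ℝ V] [FiniteDimensional ℝ V]
  [MeasurableSpace V] [BorelSpace V]

/-! ### Characters and the inverse Fourier transform. -/

/-- The character `e^{i2π ξ·y}`. -/
def expI (ξ y : V) : ℂ :=
  Complex.exp (2 * (Real.pi : ℂ) * Complex.I * ((inner ℝ ξ y : ℝ) : ℂ))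

lemma expI_eq (ξ y : V) :
    expI ξ y = Complex.exp (((2 * Real.pi * inner ℝ ξ y : ℝ) : ℂ) * Complex.I) := by
  unfold expI; congr 1; push_cast; ring

@[simp] lemma norm_expI (ξ y : V) : ‖expI ξ y‖ = 1 := by
  rw [expI_eq, Complex.norm_exp_ofReal_mul_I]

lemma expI_add (ξ y z : V) : expI ξ (y + z) = expI ξ y * expI ξ z := by
  unfold expI
  rw [← Complex.exp_add, inner_add_right]
  congr 1; push_cast; ring

lemma expI_smul_left (R : ℝ) (ξ y : V) : expI (R • ξ) y = expI ξ (R • y) := by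
  unfold expI; rw [real_inner_smul_left, real_inner_smul_right]

@[simp] lemma expI_zero_right (ξ : V) : expI ξ 0 = 1 := by simp [expI]

lemma expI_comm (ξ y : V) : expI ξ y = expI y ξ := by
  unfold expI; rw [real_inner_comm]

lemma expI_re (ξ y : V) : (expI ξ y).re = Real.cos (2 * Real.pi * inner ℝ ξ y) := by
  rw [expI_eq, Complex.exp_ofReal_mul_I_re]

lemma expI_neg_right (ξ y : V) : expI ξ (-y) = starRingEnd ℂ (expI ξ y) := by
  rw [expI_eq, expI_eq, ← Complex.exp_conj]
  congr 1
  rw [map_mul, Complex.conj_ofReal, Complex.conj_I, inner_neg_right]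
  push_cast; ring

@[fun_prop]
lemma continuous_expI : Continuous fun q : V × V => expI q.1 q.2 := by
  unfold expI; fun_prop

@[fun_prop]
lemma continuous_expI_comp {α : Type*} [TopologicalSpace α] {f g : α → V} (hf : Continuous f)
    (hg : Continuous g) : Continuous fun a => expI (f a) (g a) :=
  continuous_expI.comp (hf.prodMk hg)

@[fun_prop]
lemma measurable_expI_comp {α : Type*} [MeasurableSpace α] {f g : α → V} (hf : Measurable f)
    (hg : Measurable g) : Measurable fun a => expI (f a) (g a) :=
  (continuous_expI (V := V)).measurable.comp
    (f := fun a => ((f a, g a) : V × V)) (hf.prodMk hg)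

lemma norm_expI_sub_one_le (ξ y : V) : ‖expI ξ y - 1‖ ≤ 2 * Real.pi * (‖ξ‖ * ‖y‖) := by
  rw [expI_eq, mul_comm]
  refine (Real.norm_exp_I_mul_ofReal_sub_one_le).trans ?_
  rw [Real.norm_eq_abs, abs_mul, abs_of_pos Real.two_pi_pos]
  gcongr
  exact abs_real_inner_le_norm ξ y

lemma norm_expI_sub_one_le_two (ξ y : V) : ‖expI ξ y - 1‖ ≤ 2 := by
  refine (norm_sub_le _ _).trans ?_
  simp; norm_num

lemma fourierInv_eq_expI (h : V → ℂ) (x : V) : 𝓕⁻ h x = ∫ ξ, expI ξ x * h ξ := by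
  rw [Real.fourierInv_eq']
  refine integral_congr_ae (Eventually.of_forall fun ξ => ?_)
  simp only [expI, smul_eq_mul]
  congr 2; push_cast; ring

lemma fourier_eq_expI (h : V → ℂ) (x : V) : 𝓕 h x = ∫ ξ, expI ξ (-x) * h ξ := by
  rw [Real.fourier_eq']
  refine integral_congr_ae (Eventually.of_forall fun ξ => ?_)
  simp only [expI, smul_eq_mul, inner_neg_right]
  congr 2; push_cast; ring

lemma fourierInv_expI_mul (h : V → ℂ) (x y : V) :
    𝓕⁻ (fun ξ => expI ξ y * h ξ) x = 𝓕⁻ h (x + y) := by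
  rw [fourierInv_eq_expI, fourierInv_eq_expI]
  refine integral_congr_ae (Eventually.of_forall fun ξ => ?_)
  simp only [expI_add]; ring

lemma norm_fourierInv_le (h : V → ℂ) (x : V) : ‖𝓕⁻ h x‖ ≤ ∫ ξ, ‖h ξ‖ := by
  rw [fourierInv_eq_expI]
  refine (norm_integral_le_integral_norm _).trans_eq ?_
  simp

lemma integrable_expI_mul {h : V → ℂ} (hh : Integrable h) (x : V) :
    Integrable fun ξ => expI ξ x * h ξ := by
  refine hh.bdd_mul (c := 1) (by fun_prop) (Eventually.of_forall fun ξ => by simp)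

lemma continuous_fourierInv {h : V → ℂ} (hh : Integrable h) : Continuous (𝓕⁻ h) := by
  have : 𝓕⁻ h = fun x => ∫ ξ, expI ξ x * h ξ := funext fun x => fourierInv_eq_expI h x
  rw [this]
  refine continuous_of_dominated (bound := fun ξ => ‖h ξ‖) ?_ ?_ hh.norm ?_
  · exact fun x => (integrable_expI_mul hh x).aestronglyMeasurable
  · exact fun x => Eventually.of_forall fun ξ => by simp
  · exact Eventually.of_forall fun ξ => by fun_prop

/-! ### Averages and limits of multipliers. -/

section Minkowski

variable {α : Type*} [MeasurableSpace α] {μ : Measure α} [SFinite μ] {h : α → V → ℂ}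

lemma fourierInv_integral (hi : Integrable (Function.uncurry h) (μ.prod volume)) (x : V) :
    𝓕⁻ (fun ξ => ∫ a, h a ξ ∂μ) x = ∫ a, 𝓕⁻ (h a) x ∂μ := by
  simp_rw [fourierInv_eq_expI]
  simp_rw [← integral_const_mul]
  rw [integral_integral_swap]
  have : Integrable (fun q : α × V => expI q.2 x * Function.uncurry h q) (μ.prod volume) := by
    refine hi.bdd_mul (c := 1) ?_ (Eventually.of_forall fun ξ => by simp)
    exact (measurable_expI_comp measurable_snd measurable_const).aestronglyMeasurable
  exact this.swap

/-- Minkowski's inequality in `L¹`. It serves for every multiplier given as an average of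
multipliers with known kernels: over translations, over jumps `y`, and over the time of a
subordinator. -/
lemma lintegral_fourierInv_integral_le (hm : StronglyMeasurable (Function.uncurry h))
    (hi : Integrable (Function.uncurry h) (μ.prod volume)) :
    ∫⁻ x, ‖𝓕⁻ (fun ξ => ∫ a, h a ξ ∂μ) x‖ₑ ≤ ∫⁻ a, (∫⁻ x, ‖𝓕⁻ (h a) x‖ₑ) ∂μ := by
  have hmeas : StronglyMeasurable fun q : V × α => 𝓕⁻ (h q.2) q.1 := by
    simp_rw [fourierInv_eq_expI]
    refine StronglyMeasurable.integral_prod_right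
      (f := fun (q : V × α) (ξ : V) => expI ξ q.1 * h q.2 ξ) ?_
    refine StronglyMeasurable.mul ?_ ?_
    · exact (measurable_expI_comp measurable_snd (measurable_fst.comp measurable_fst)).stronglyMeasurable
    · exact hm.comp_measurable ((measurable_snd.comp measurable_fst).prodMk measurable_snd)
  calc ∫⁻ x, ‖𝓕⁻ (fun ξ => ∫ a, h a ξ ∂μ) x‖ₑ
      ≤ ∫⁻ x, ∫⁻ a, ‖𝓕⁻ (h a) x‖ₑ ∂μ := by
        refine lintegral_mono fun x => ?_
        rw [fourierInv_integral hi]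
        exact enorm_integral_le_lintegral_enorm _
    _ = ∫⁻ a, (∫⁻ x, ‖𝓕⁻ (h a) x‖ₑ) ∂μ := by
        refine lintegral_lintegral_swap ?_
        exact hmeas.measurable.enorm.aemeasurable

end Minkowski

/-- Domination by `h0` makes the kernels converge pointwise, and Fatou then transfers `L¹` bounds
from approximations to the limit. -/
lemma lintegral_fourierInv_le_liminf {h : ℕ → V → ℂ} {h' h0 : V → ℂ}
    (hm : ∀ n, AEStronglyMeasurable (h n)) (h0i : Integrable h0)
    (hb : ∀ n ξ, ‖h n ξ‖ ≤ ‖h0 ξ‖) (hlim : ∀ ξ, Tendsto (fun n => h n ξ) atTop (𝓝 (h' ξ))) :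
    ∫⁻ x, ‖𝓕⁻ h' x‖ₑ ≤ liminf (fun n => ∫⁻ x, ‖𝓕⁻ (h n) x‖ₑ) atTop := by
  have hi : ∀ n, Integrable (h n) := fun n => h0i.mono (hm n) (Eventually.of_forall (hb n))
  have hpt : ∀ x, Tendsto (fun n => 𝓕⁻ (h n) x) atTop (𝓝 (𝓕⁻ h' x)) := by
    intro x
    simp_rw [fourierInv_eq_expI]
    refine tendsto_integral_of_dominated_convergence (fun ξ => ‖h0 ξ‖)
      (fun n => (integrable_expI_mul (hi n) x).aestronglyMeasurable) h0i.norm ?_ ?_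
    · exact fun n => Eventually.of_forall fun ξ => by simpa using hb n ξ
    · exact Eventually.of_forall fun ξ => (hlim ξ).const_mul _
  calc ∫⁻ x, ‖𝓕⁻ h' x‖ₑ = ∫⁻ x, liminf (fun n => ‖𝓕⁻ (h n) x‖ₑ) atTop := by
        refine lintegral_congr fun x => ?_
        exact ((hpt x).enorm.liminf_eq).symm
    _ ≤ _ := lintegral_liminf_le fun n => (continuous_fourierInv (hi n)).measurable.enorm

/-! ### Compound Poisson multipliers are contractions. -/

/-- The (unnormalized) characteristic function `∫ e^{i2π ξ·y} ρ(dy)`. -/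
def charInt (ρ : Measure V) (ξ : V) : ℂ := ∫ y, expI ξ y ∂ρ

lemma stronglyMeasurable_charInt (ρ : Measure V) [SFinite ρ] :
    StronglyMeasurable (charInt ρ) := by
  refine StronglyMeasurable.integral_prod_right (f := fun ξ y : V => expI ξ y) ?_
  exact continuous_expI.measurable.stronglyMeasurable

lemma norm_charInt_le (ρ : Measure V) [IsFiniteMeasure ρ] (ξ : V) :
    ‖charInt ρ ξ‖ ≤ ρ.real univ := by
  refine (norm_integral_le_of_norm_le_const (C := 1) ?_).trans (by simp)
  exact Eventually.of_forall fun y => by simp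

/-- On the kernel side this multiplier averages translates, and translation preserves the `L¹` norm.
-/
lemma lintegral_fourierInv_charInt_mul_le (ρ : Measure V) [IsFiniteMeasure ρ]
    {h : V → ℂ} (hm : StronglyMeasurable h) (hh : Integrable h) :
    ∫⁻ x, ‖𝓕⁻ (fun ξ => charInt ρ ξ * h ξ) x‖ₑ ≤ ρ univ * ∫⁻ x, ‖𝓕⁻ h x‖ₑ := by
  have hsm : StronglyMeasurable (Function.uncurry fun y ξ : V => expI ξ y * h ξ) := by
    refine StronglyMeasurable.mul ?_ (hm.comp_measurable measurable_snd)
    exact (measurable_expI_comp measurable_snd measurable_fst).stronglyMeasurable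
  have hint : Integrable (Function.uncurry fun y ξ : V => expI ξ y * h ξ) (ρ.prod volume) := by
    have := (integrable_const (1 : ℂ) (μ := ρ)).mul_prod hh
    refine this.mono hsm.aestronglyMeasurable (Eventually.of_forall fun q => ?_)
    simp [Function.uncurry]
  have := lintegral_fourierInv_integral_le hsm hint
  simp_rw [integral_mul_const, fourierInv_expI_mul] at this
  refine this.trans_eq ?_
  simp_rw [lintegral_add_right_eq_self (fun x => ‖𝓕⁻ h x‖ₑ)]
  rw [lintegral_const, mul_comm]

lemma lintegral_fourierInv_charInt_pow_mul_le (ρ : Measure V) [IsFiniteMeasure ρ]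
    (hρ : ρ univ ≤ 1) {h : V → ℂ} (hm : StronglyMeasurable h) (hh : Integrable h) (n : ℕ) :
    ∫⁻ x, ‖𝓕⁻ (fun ξ => charInt ρ ξ ^ n * h ξ) x‖ₑ ≤ ∫⁻ x, ‖𝓕⁻ h x‖ₑ := by
  induction n with
  | zero => simp
  | succ n ih =>
    have hm' : StronglyMeasurable fun ξ => charInt ρ ξ ^ n * h ξ :=
      ((stronglyMeasurable_charInt ρ).pow n).mul hm
    have hle : ∀ ξ, ‖charInt ρ ξ‖ ≤ 1 := fun ξ =>
      (norm_charInt_le ρ ξ).trans (ENNReal.toReal_le_of_le_ofReal zero_le_one (by simpa using hρ))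
    have hi' : Integrable fun ξ => charInt ρ ξ ^ n * h ξ := by
      refine hh.bdd_mul (c := 1) ((stronglyMeasurable_charInt ρ).pow n).aestronglyMeasurable
        (Eventually.of_forall fun ξ => ?_)
      rw [norm_pow]
      exact pow_le_one₀ (norm_nonneg _) (hle ξ)
    have h1 := lintegral_fourierInv_charInt_mul_le ρ hm' hi'
    have h2 : (fun ξ => charInt ρ ξ ^ (n + 1) * h ξ)
        = fun ξ => charInt ρ ξ * (charInt ρ ξ ^ n * h ξ) := by
      funext ξ; ring
    rw [h2]
    refine h1.trans ?_
    calc ρ univ * _ ≤ 1 * _ := by gcongr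
      _ ≤ _ := by rw [one_mul]; exact ih

lemma charInt_sub_re_nonpos (ν : Measure V) [IsFiniteMeasure ν] (ξ : V) :
    (charInt ν ξ - (ν.real univ : ℂ)).re ≤ 0 := by
  have := (Complex.re_le_norm _).trans (norm_charInt_le ν ξ)
  simpa using this

/-- With `m` the mass of `ν`, `exp(charInt ν - m)` is the limit of `(1 + (charInt ν - m)/n)^n`, and
for `n ≥ m` the base is the characteristic function of the probability measure `(1 - m/n) δ_0 +
ν/n`. -/
lemma lintegral_fourierInv_exp_charInt_mul_le (ν : Measure V) [IsFiniteMeasure ν]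
    {h : V → ℂ} (hm : StronglyMeasurable h) (hh : Integrable h) :
    ∫⁻ x, ‖𝓕⁻ (fun ξ => Complex.exp (charInt ν ξ - (ν.real univ : ℂ)) * h ξ) x‖ₑ
      ≤ ∫⁻ x, ‖𝓕⁻ h x‖ₑ := by
  -- Indexing by `n + N` with `N` above the mass keeps the weight of the Dirac part nonnegative for
  -- every `n`.
  obtain ⟨N, hN⟩ := exists_nat_gt (ν.real univ)
  set m := ν.real univ with hmdef
  have hm0 : 0 ≤ m := measureReal_nonneg
  let a : ℕ → ℝ≥0 := fun n => Real.toNNReal (1 - m / (n + N : ℝ))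
  let b : ℕ → ℝ≥0 := fun n => Real.toNNReal (1 / (n + N : ℝ))
  let ρ : ℕ → Measure V := fun n => a n • Measure.dirac 0 + b n • ν
  have hNpos : (0 : ℝ) < N := hm0.trans_lt hN
  have hpos : ∀ n : ℕ, (0 : ℝ) < n + N := fun n => by positivity
  have ha : ∀ n, (a n : ℝ) = 1 - m / (n + N : ℝ) := fun n => by
    refine Real.coe_toNNReal _ ?_
    rw [sub_nonneg, div_le_one (hpos n)]
    have : (0 : ℝ) ≤ n := by positivity
    linarith
  have hb : ∀ n, (b n : ℝ) = 1 / (n + N : ℝ) := fun n =>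
    Real.coe_toNNReal _ (div_nonneg zero_le_one (hpos n).le)
  have hmass : ∀ n, ρ n univ ≤ 1 := by
    intro n
    have h1 : (ρ n univ).toReal = 1 := by
      simp only [ρ, Measure.add_apply, Measure.smul_apply]
      rw [ENNReal.toReal_add (by simp [ENNReal.smul_def])
        (by simp [ENNReal.smul_def, ENNReal.mul_eq_top])]
      have : (ν univ).toReal = m := rfl
      simp [ENNReal.smul_def, this, ha, hb]
      ring
    rw [← ENNReal.ofReal_toReal (measure_ne_top (ρ n) univ), h1]
    simp
  have hchar : ∀ n ξ, charInt (ρ n) ξ = 1 + (charInt ν ξ - m) / ((n + N : ℕ) : ℂ) := by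
    intro n ξ
    have hie : ∀ (η : Measure V) [IsFiniteMeasure η], Integrable (fun y => expI ξ y) η := by
      intro η _
      refine (integrable_const (1 : ℂ)).mono (by fun_prop) (Eventually.of_forall fun y => by simp)
    simp only [ρ, charInt]
    rw [integral_add_measure (hie _) (hie _), integral_smul_nnreal_measure,
      integral_smul_nnreal_measure, integral_dirac]
    simp only [NNReal.smul_def, ha, hb, expI_zero_right, Complex.real_smul]
    push_cast
    ring
  have hpow : ∀ n : ℕ, ∫⁻ x, ‖𝓕⁻ (fun ξ =>
      (1 + (charInt ν ξ - m) / ((n + N : ℕ) : ℂ)) ^ (n + N) * h ξ) x‖ₑ ≤ ∫⁻ x, ‖𝓕⁻ h x‖ₑ := by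
    intro n
    have := lintegral_fourierInv_charInt_pow_mul_le (ρ n) (hmass n) hm hh (n + N)
    simpa only [hchar] using this
  refine (lintegral_fourierInv_le_liminf (h0 := h) (h := fun n ξ =>
      (1 + (charInt ν ξ - m) / ((n + N : ℕ) : ℂ)) ^ (n + N) * h ξ) ?_ hh ?_ ?_).trans ?_
  · intro n
    refine StronglyMeasurable.aestronglyMeasurable ?_
    refine StronglyMeasurable.mul ?_ hm
    have := (stronglyMeasurable_charInt (ρ n)).pow (n + N)
    simpa only [Pi.pow_def, hchar] using this
  · intro n ξ
    rw [norm_mul, norm_pow, ← hchar]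
    refine mul_le_of_le_one_left (norm_nonneg _) (pow_le_one₀ (norm_nonneg _) ?_)
    exact (norm_charInt_le _ ξ).trans
      (ENNReal.toReal_le_of_le_ofReal zero_le_one (by simpa using hmass n))
  · intro ξ
    refine Tendsto.mul_const _ ?_
    have := Complex.tendsto_one_add_div_pow_exp (charInt ν ξ - m)
    exact this.comp (tendsto_add_atTop_nat N)
  · exact (liminf_le_liminf (Eventually.of_forall hpow)).trans_eq (liminf_const _)

/-! ### Lévy exponents and truncation of small jumps. -/

/-- The compensated Lévy integrand `e^{i2π ξ·y} - 1 - i2π c(y) ξ·y`. -/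
def levyKer (c : V → ℝ) (ξ y : V) : ℂ :=
  expI ξ y - 1 - 2 * (Real.pi : ℂ) * Complex.I * ((c y * inner ℝ ξ y : ℝ) : ℂ)

/-- The Lévy exponent of `μ` with cut-off `c`. -/
def symb (c : V → ℝ) (μ : Measure V) (ξ : V) : ℂ := ∫ y, levyKer c ξ y ∂μ

lemma measurable_levyKer {c : V → ℝ} (hc : Measurable c) (ξ : V) :
    Measurable (levyKer c ξ) := by
  unfold levyKer
  have : Measurable fun y : V => expI ξ y := measurable_expI_comp measurable_const measurable_id
  fun_prop

lemma levyKer_re (c : V → ℝ) (ξ y : V) :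
    (levyKer c ξ y).re = -(1 - Real.cos (2 * Real.pi * inner ℝ ξ y)) := by
  simp [levyKer, expI_re, -Complex.ofReal_mul, Complex.mul_re, Complex.mul_im]

lemma integrable_expI (ξ : V) (η : Measure V) [IsFiniteMeasure η] :
    Integrable (fun y => expI ξ y) η :=
  (integrable_const (1 : ℂ)).mono (by fun_prop) (Eventually.of_forall fun y => by simp)

/-- On a finite measure the character is integrable, so the imaginary part isolates `c y * ⟪ξ, y⟫`;
testing on an orthonormal basis recovers the vector. -/
lemma integrable_smul_of_levyKer {c : V → ℝ} {η : Measure V}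
    [IsFiniteMeasure η] (h : ∀ ξ, Integrable (levyKer c ξ) η) :
    Integrable (fun y => c y • y) η := by
  have hc : ∀ ξ : V, Integrable (fun y => c y * inner ℝ ξ y) η := by
    intro ξ
    refine (((integrable_expI ξ η).im.sub (h ξ).im).const_mul (2 * Real.pi)⁻¹).congr
      (Eventually.of_forall fun y => ?_)
    have := Real.pi_pos.ne'
    simp [levyKer, -Complex.ofReal_mul, Complex.mul_re, Complex.mul_im]
    field_simp
  let b := stdOrthonormalBasis ℝ V
  refine (integrable_finsetSum Finset.univ fun i _ => (hc (b i)).smul_const (b i)).congr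
    (Eventually.of_forall fun y => ?_)
  simp only [mul_smul, ← Finset.smul_sum]
  rw [b.sum_repr' y]

/-- For a finite measure the compensator is a genuine drift, and the exponential of a drift is a
character, which acts by translation. -/
lemma symb_eq_of_finite {c : V → ℝ} {η : Measure V}
    [IsFiniteMeasure η] (h : ∀ ξ, Integrable (levyKer c ξ) η) (ξ : V) :
    symb c η ξ = charInt η ξ - (η.real univ : ℂ)
      - 2 * (Real.pi : ℂ) * Complex.I * ((inner ℝ ξ (∫ y, c y • y ∂η) : ℝ) : ℂ) := by
  have hi := integrable_smul_of_levyKer h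
  have h1 : Integrable (fun y => ((c y * inner ℝ ξ y : ℝ) : ℂ)) η := by
    have := hi.const_inner (𝕜 := ℝ) ξ
    simp only [real_inner_smul_right] at this
    exact this.ofReal
  have h2 : (inner ℝ ξ (∫ y, c y • y ∂η) : ℝ) = ∫ y, c y * inner ℝ ξ y ∂η := by
    rw [← integral_inner hi ξ]
    simp only [real_inner_smul_right]
  have h3 : Integrable (fun y => expI ξ y - 1) η := (integrable_expI ξ η).sub (integrable_const _)
  unfold symb levyKer
  rw [integral_sub h3 (h1.const_mul _),
    integral_sub (integrable_expI ξ η) (integrable_const _), integral_const_mul, h2,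
    integral_complex_ofReal]
  simp [charInt]

lemma tendsto_setIntegral_norm_gt {π : Measure V} (h0 : π {0} = 0) {F : V → ℂ}
    (hF : Integrable F π) :
    Tendsto (fun n : ℕ => ∫ y in {y : V | 1 / ((n : ℝ) + 1) < ‖y‖}, F y ∂π) atTop
      (𝓝 (∫ y, F y ∂π)) := by
  have hU : (⋃ n : ℕ, {y : V | 1 / ((n : ℝ) + 1) < ‖y‖}) = {0}ᶜ := by
    ext y
    simp only [mem_iUnion, mem_ofPred_eq, mem_compl_iff, mem_singleton_iff]
    constructor
    · rintro ⟨n, hn⟩ rfl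
      rw [norm_zero] at hn
      exact absurd hn (not_lt.2 (by positivity))
    · exact fun hy => exists_nat_one_div_lt (norm_pos_iff.2 hy)
  have h := tendsto_setIntegral_of_monotone (μ := π) (f := F)
    (s := fun n : ℕ => {y : V | 1 / ((n : ℝ) + 1) < ‖y‖})
    (fun n => measurableSet_lt measurable_const measurable_norm)
    (by
      intro m n hmn y hy
      simp only [mem_ofPred_eq] at hy ⊢
      refine lt_of_le_of_lt ?_ hy
      have : (m : ℝ) ≤ n := by exact_mod_cast hmn
      gcongr) hF.integrableOn
  rw [hU] at h
  have hr : π.restrict {0}ᶜ = π := by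
    rw [Measure.restrict_eq_self_of_ae_mem]
    exact compl_mem_ae_iff.2 h0
  rwa [hr] at h

/-- Multiplying by the exponential of a difference of Lévy exponents of ordered measures does not
increase the `L¹` norm of the inverse Fourier transform, whatever the cut-offs. -/
lemma lintegral_fourierInv_exp_symb_sub_mul_le {π μ : Measure V} (hle : μ ≤ π)
    (h0 : π {0} = 0) (hfin : ∀ ε : ℝ, 0 < ε → π {y | ε < ‖y‖} < ∞) {c' c : V → ℝ}
    (h1 : ∀ ξ, Integrable (levyKer c' ξ) π) (h2 : ∀ ξ, Integrable (levyKer c ξ) μ)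
    {h : V → ℂ} (hm : StronglyMeasurable h) (hh : Integrable h) :
    ∫⁻ x, ‖𝓕⁻ (fun ξ => Complex.exp (symb c' π ξ - symb c μ ξ) * h ξ) x‖ₑ
      ≤ ∫⁻ x, ‖𝓕⁻ h x‖ₑ := by
  -- Away from the origin both measures are finite, so their difference is a finite positive measure
  -- and the compound Poisson contraction applies to it.
  set A : ℕ → Set (V) := fun n => {y : V | 1 / ((n : ℝ) + 1) < ‖y‖} with hA
  have hfπ : ∀ n, IsFiniteMeasure (π.restrict (A n)) := fun n =>
    ⟨by rw [Measure.restrict_apply_univ]; exact hfin _ (by positivity)⟩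
  have hlen : ∀ n, μ.restrict (A n) ≤ π.restrict (A n) := fun n => Measure.restrict_mono le_rfl hle
  have hfμ : ∀ n, IsFiniteMeasure (μ.restrict (A n)) := fun n =>
    isFiniteMeasure_of_le _ (hlen n)
  have h0μ : μ {0} = 0 := le_antisymm ((hle _).trans_eq h0) zero_le
  set ν : ℕ → Measure V := fun n => π.restrict (A n) - μ.restrict (A n) with hν
  have hadd : ∀ n, ν n + μ.restrict (A n) = π.restrict (A n) := fun n =>
    Measure.sub_add_cancel_of_le (hlen n)
  have hfν : ∀ n, IsFiniteMeasure (ν n) := fun n => isFiniteMeasure_of_le _ Measure.sub_le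
  -- Net drift left by the two cut-offs. It only translates the kernel, so no control of `b n` as
  -- `n` grows is needed.
  set b : ℕ → V := fun n =>
    (∫ y, c y • y ∂(μ.restrict (A n))) - ∫ y, c' y • y ∂(π.restrict (A n)) with hb
  have hsymb : ∀ n ξ, symb c' (π.restrict (A n)) ξ - symb c (μ.restrict (A n)) ξ
      = (charInt (ν n) ξ - ((ν n).real univ : ℂ))
        + 2 * (Real.pi : ℂ) * Complex.I * ((inner ℝ ξ (b n) : ℝ) : ℂ) := by
    intro n ξ
    rw [symb_eq_of_finite (fun ξ => (h1 ξ).restrict), symb_eq_of_finite (fun ξ => (h2 ξ).restrict)]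
    have e1 : charInt (π.restrict (A n)) ξ = charInt (ν n) ξ + charInt (μ.restrict (A n)) ξ := by
      unfold charInt
      rw [← integral_add_measure (integrable_expI ξ _) (integrable_expI ξ _), hadd]
    have e2 : (π.restrict (A n)).real univ = (ν n).real univ + (μ.restrict (A n)).real univ := by
      rw [← hadd n, measureReal_add_apply]
    rw [e1, e2, hb, inner_sub_right]
    push_cast; ring
  have hexp : ∀ n ξ, Complex.exp (symb c' (π.restrict (A n)) ξ - symb c (μ.restrict (A n)) ξ) * h ξ
      = Complex.exp (charInt (ν n) ξ - ((ν n).real univ : ℂ)) * (expI ξ (b n) * h ξ) := by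
    intro n ξ
    rw [hsymb, Complex.exp_add, mul_assoc]; rfl
  have hsm : ∀ n, StronglyMeasurable fun ξ => expI ξ (b n) * h ξ := fun n =>
    (measurable_expI_comp measurable_id measurable_const).stronglyMeasurable.mul hm
  have hn : ∀ n, ∫⁻ x, ‖𝓕⁻ (fun ξ => Complex.exp (symb c' (π.restrict (A n)) ξ
      - symb c (μ.restrict (A n)) ξ) * h ξ) x‖ₑ ≤ ∫⁻ x, ‖𝓕⁻ h x‖ₑ := by
    intro n
    simp_rw [hexp]
    refine (lintegral_fourierInv_exp_charInt_mul_le (ν n) (hsm n)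
      (integrable_expI_mul hh _)).trans_eq ?_
    simp_rw [fourierInv_expI_mul]
    exact lintegral_add_right_eq_self (fun x => ‖𝓕⁻ h x‖ₑ) (b n)
  refine (lintegral_fourierInv_le_liminf (h0 := h) (h := fun n ξ =>
    Complex.exp (symb c' (π.restrict (A n)) ξ - symb c (μ.restrict (A n)) ξ) * h ξ)
    ?_ hh ?_ ?_).trans ?_
  · intro n
    simp_rw [hexp]
    refine (StronglyMeasurable.mul ?_ (hsm n)).aestronglyMeasurable
    exact Complex.continuous_exp.comp_stronglyMeasurable
      ((stronglyMeasurable_charInt (ν n)).sub stronglyMeasurable_const)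
  -- Domination by `h`: the drift has modulus one and the compound Poisson exponent has nonpositive
  -- real part.
  · intro n ξ
    simp only [hexp]
    rw [norm_mul, norm_mul, norm_expI, one_mul, Complex.norm_exp]
    exact mul_le_of_le_one_left (norm_nonneg _)
      (Real.exp_le_one_iff.2 (charInt_sub_re_nonpos (ν n) ξ))
  · intro ξ
    refine Tendsto.mul_const _ ((Complex.continuous_exp.tendsto _).comp ?_)
    exact (tendsto_setIntegral_norm_gt h0 (h1 ξ)).sub (tendsto_setIntegral_norm_gt h0μ (h2 ξ))
  · exact (liminf_le_liminf (Eventually.of_forall hn)).trans_eq (liminf_const _)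

/-! ### Derivatives of the Lévy integrand in the frequency variable. -/

/-- The real-linear form `⟪y, ·⟫` with complex values. -/
def innerC (y : V) : V →L[ℝ] ℂ := Complex.ofRealCLM ∘L innerSL ℝ y

lemma innerC_apply (y ξ : V) : innerC y ξ = ((inner ℝ ξ y : ℝ) : ℂ) := by
  simp [innerC, real_inner_comm]

lemma norm_innerC_le (y : V) : ‖innerC y‖ ≤ ‖y‖ := by
  refine ContinuousLinearMap.opNorm_le_bound _ (norm_nonneg _) fun ξ => ?_
  rw [innerC_apply, Complex.norm_real, Real.norm_eq_abs, mul_comm]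
  exact abs_real_inner_le_norm ξ y

lemma continuous_innerC : Continuous (innerC (V := V)) := by
  unfold innerC; fun_prop

lemma hasFDerivAt_expI (y ξ : V) :
    HasFDerivAt (fun ξ => expI ξ y) ((2 * (Real.pi : ℂ) * Complex.I * expI ξ y) • innerC y) ξ := by
  have h1 : HasFDerivAt (fun ξ => 2 * (Real.pi : ℂ) * Complex.I * ((inner ℝ ξ y : ℝ) : ℂ))
      ((2 * (Real.pi : ℂ) * Complex.I) • innerC y) ξ := by
    have := ((innerC y).hasFDerivAt (x := ξ)).const_smul (2 * (Real.pi : ℂ) * Complex.I)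
    refine this.congr_of_eventuallyEq (Eventually.of_forall fun η => ?_)
    simp [innerC_apply]
  refine h1.cexp.congr_fderiv ?_
  rw [smul_smul, mul_comm]; rfl

/-- The integrand of the gradient of the fully compensated Lévy exponent. -/
def gradKer (ξ y : V) : V →L[ℝ] ℂ :=
  (2 * (Real.pi : ℂ) * Complex.I * (expI ξ y - 1)) • innerC y

/-- The integrand of the derivative of the fully compensated Lévy exponent in direction `v`. -/
def dirKer (v ξ y : V) : ℂ :=
  2 * (Real.pi : ℂ) * Complex.I * ((inner ℝ v y : ℝ) : ℂ) * (expI ξ y - 1)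

/-- The polynomial factor of the second derivatives of the Lévy integrand. -/
def hessKer (v y : V) : V →L[ℝ] ℂ :=
  ((2 * (Real.pi : ℂ) * Complex.I) ^ 2 * ((inner ℝ v y : ℝ) : ℂ)) • innerC y

lemma norm_two_pi_I : ‖2 * (Real.pi : ℂ) * Complex.I‖ = 2 * Real.pi := by
  simp [abs_of_pos Real.pi_pos]

lemma hasFDerivAt_levyKer_one (y ξ : V) :
    HasFDerivAt (fun ξ => levyKer (fun _ => 1) ξ y) (gradKer ξ y) ξ := by
  have h1 := ((innerC y).hasFDerivAt (x := ξ)).const_smul (2 * (Real.pi : ℂ) * Complex.I)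
  have h2 := ((hasFDerivAt_expI y ξ).sub_const 1).sub h1
  refine (h2.congr_fderiv (g' := gradKer ξ y) ?_).congr_of_eventuallyEq
    (Eventually.of_forall fun η => ?_)
  · rw [gradKer, ← sub_smul]; congr 1; ring
  · simp [levyKer, innerC_apply]

lemma gradKer_apply (v ξ y : V) : gradKer ξ y v = dirKer v ξ y := by
  simp [gradKer, dirKer, innerC_apply]; ring

lemma hasFDerivAt_dirKer (v y ξ : V) :
    HasFDerivAt (fun ξ => dirKer v ξ y) (expI ξ y • hessKer v y) ξ := by
  have h2 := ((hasFDerivAt_expI y ξ).sub_const 1).const_mul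
    (2 * (Real.pi : ℂ) * Complex.I * ((inner ℝ v y : ℝ) : ℂ))
  refine h2.congr_fderiv ?_
  rw [hessKer, smul_smul, smul_smul]
  congr 1; ring

lemma norm_gradKer_le (ξ y : V) : ‖gradKer ξ y‖ ≤ 2 * Real.pi * (‖y‖ * ‖expI ξ y - 1‖) := by
  rw [gradKer, norm_smul, norm_mul, norm_two_pi_I]
  have := norm_innerC_le y
  have h0 : 0 ≤ 2 * Real.pi * ‖expI ξ y - 1‖ := by positivity
  nlinarith [mul_le_mul_of_nonneg_left this h0]

lemma norm_gradKer_le_sq (ξ y : V) : ‖gradKer ξ y‖ ≤ (2 * Real.pi) ^ 2 * ‖ξ‖ * ‖y‖ ^ 2 := by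
  refine (norm_gradKer_le ξ y).trans ?_
  have := norm_expI_sub_one_le ξ y
  calc 2 * Real.pi * (‖y‖ * ‖expI ξ y - 1‖)
      ≤ 2 * Real.pi * (‖y‖ * (2 * Real.pi * (‖ξ‖ * ‖y‖))) := by gcongr
    _ = _ := by ring

lemma norm_dirKer_le (v ξ y : V) :
    ‖dirKer v ξ y‖ ≤ (2 * Real.pi) ^ 2 * ‖ξ‖ * ‖v‖ * ‖y‖ ^ 2 := by
  rw [← gradKer_apply]
  refine (ContinuousLinearMap.le_opNorm _ _).trans ?_
  calc ‖gradKer ξ y‖ * ‖v‖ ≤ (2 * Real.pi) ^ 2 * ‖ξ‖ * ‖y‖ ^ 2 * ‖v‖ := by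
        gcongr; exact norm_gradKer_le_sq ξ y
    _ = _ := by ring

lemma norm_hessKer_le (v y : V) : ‖hessKer v y‖ ≤ (2 * Real.pi) ^ 2 * ‖v‖ * ‖y‖ ^ 2 := by
  rw [hessKer, norm_smul, norm_mul, norm_pow, norm_two_pi_I, Complex.norm_real, Real.norm_eq_abs]
  have h1 := norm_innerC_le y
  have h2 := abs_real_inner_le_norm v y
  calc (2 * Real.pi) ^ 2 * |inner ℝ v y| * ‖innerC y‖
      ≤ (2 * Real.pi) ^ 2 * (‖v‖ * ‖y‖) * ‖y‖ := by gcongr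
    _ = _ := by ring

lemma continuous_hessKer (v : V) : Continuous (hessKer v) := by
  unfold hessKer
  have := continuous_innerC (V := V)
  fun_prop

lemma norm_levyKer_one_le (ξ y : V) :
    ‖levyKer (fun _ => 1) ξ y‖ ≤ (2 * Real.pi) ^ 2 * ‖ξ‖ ^ 2 * ‖y‖ ^ 2 := by
  have h := Convex.norm_image_sub_le_of_norm_hasFDerivWithin_le
    (f := fun ξ => levyKer (fun _ => 1) ξ y) (f' := fun ξ => gradKer ξ y)
    (s := Metric.closedBall 0 ‖ξ‖) (x := 0) (y := ξ) (C := (2 * Real.pi) ^ 2 * ‖ξ‖ * ‖y‖ ^ 2)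
    (fun η _ => (hasFDerivAt_levyKer_one y η).hasFDerivWithinAt)
    (fun η hη => (norm_gradKer_le_sq η y).trans (by
      rw [mem_closedBall_zero_iff] at hη
      gcongr))
    (convex_closedBall _ _) (by simp) (by simp)
  have h0 : levyKer (fun _ => 1) 0 y = 0 := by simp [levyKer, expI]
  simp only [h0, sub_zero] at h
  refine h.trans_eq (by ring)

/-! ### Smoothness of the fully compensated exponent. -/

section Smooth

variable {μ : Measure V}

lemma hasFDerivAt_symb_one (h2 : Integrable (fun y => ‖y‖ ^ 2) μ) (ξ : V) :
    HasFDerivAt (symb (fun _ => 1) μ) (∫ y, gradKer ξ y ∂μ) ξ := by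
  refine hasFDerivAt_integral_of_dominated_of_fderiv_le (s := Metric.ball ξ 1)
    (bound := fun y => (2 * Real.pi) ^ 2 * (‖ξ‖ + 1) * ‖y‖ ^ 2)
    (Metric.ball_mem_nhds _ one_pos) ?_ ?_ ?_ ?_ (h2.const_mul _) ?_
  · exact Eventually.of_forall fun η =>
      (measurable_levyKer measurable_const η).aestronglyMeasurable
  · refine (h2.const_mul ((2 * Real.pi) ^ 2 * ‖ξ‖ ^ 2)).mono'
      (measurable_levyKer measurable_const ξ).aestronglyMeasurable
      (Eventually.of_forall fun y => norm_levyKer_one_le ξ y)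
  · refine Continuous.aestronglyMeasurable ?_
    unfold gradKer
    have := continuous_innerC (V := V)
    fun_prop
  · refine Eventually.of_forall fun y η hη => (norm_gradKer_le_sq η y).trans ?_
    have : ‖η‖ ≤ ‖ξ‖ + 1 := by
      have h1 := norm_sub_norm_le η ξ
      rw [mem_ball_iff_norm] at hη
      linarith
    gcongr
  · exact Eventually.of_forall fun y η _ => hasFDerivAt_levyKer_one y η

lemma integrable_gradKer (h2 : Integrable (fun y => ‖y‖ ^ 2) μ) (ξ : V) :
    Integrable (gradKer ξ) μ := by
  refine (h2.const_mul ((2 * Real.pi) ^ 2 * ‖ξ‖)).mono' ?_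
    (Eventually.of_forall fun y => norm_gradKer_le_sq ξ y)
  refine Continuous.aestronglyMeasurable ?_
  unfold gradKer
  have := continuous_innerC (V := V)
  fun_prop

lemma hasFDerivAt_integral_dirKer (h2 : Integrable (fun y => ‖y‖ ^ 2) μ) (v ξ : V) :
    HasFDerivAt (fun ξ => ∫ y, dirKer v ξ y ∂μ) (∫ y, expI ξ y • hessKer v y ∂μ) ξ := by
  have hmeas : ∀ η : V, AEStronglyMeasurable (dirKer v η) μ := fun η => by
    refine Continuous.aestronglyMeasurable ?_
    unfold dirKer
    fun_prop
  have hc := continuous_hessKer v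
  refine hasFDerivAt_integral_of_dominated_of_fderiv_le (s := Metric.ball ξ 1)
    (F' := fun ξ y => expI ξ y • hessKer v y)
    (bound := fun y => (2 * Real.pi) ^ 2 * ‖v‖ * ‖y‖ ^ 2)
    (Metric.ball_mem_nhds _ one_pos) (Eventually.of_forall hmeas) ?_ ?_ ?_ (h2.const_mul _) ?_
  · exact (h2.const_mul ((2 * Real.pi) ^ 2 * ‖ξ‖ * ‖v‖)).mono' (hmeas ξ)
      (Eventually.of_forall fun y => norm_dirKer_le v ξ y)
  · exact Continuous.aestronglyMeasurable (by fun_prop)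
  · refine Eventually.of_forall fun y η hη => ?_
    rw [norm_smul, norm_expI, one_mul]
    exact norm_hessKer_le v y
  · exact Eventually.of_forall fun y η _ => hasFDerivAt_dirKer v y η

/-- After two derivatives the exponent is an ordinary Fourier integral against `μ`, so the general
theory of such integrals supplies all the higher ones. The minus sign in the form cancels the one
built into `VectorFourier.fourierIntegral`. -/
lemma integral_expI_smul_hessKer (v : V) :
    (fun ξ => ∫ y, expI ξ y • hessKer v y ∂μ) = VectorFourier.fourierIntegral Real.fourierChar μ
      (-innerSL ℝ : V →L[ℝ] V →L[ℝ] ℝ).toLinearMap₁₂ (hessKer v) := by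
  funext ξ
  refine integral_congr_ae (Eventually.of_forall fun y => ?_)
  have : (Real.fourierChar (-((-innerSL ℝ : V →L[ℝ] V →L[ℝ] ℝ) y ξ)) : ℂ) = expI ξ y := by
    rw [Real.fourierChar_apply, expI_eq]
    simp [real_inner_comm]
  simp only [Circle.smul_def]
  exact congrArg (· • hessKer v y) this.symm

lemma integrable_pow_mul_hessKer (hs : ∀ᵐ y ∂μ, ‖y‖ ≤ 1) (h2 : Integrable (fun y => ‖y‖ ^ 2) μ)
    (v : V) (n : ℕ) : Integrable (fun y => ‖y‖ ^ n * ‖hessKer v y‖) μ := by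
  have hc := continuous_hessKer v
  refine (h2.const_mul ((2 * Real.pi) ^ 2 * ‖v‖)).mono' ?_ ?_
  · exact Continuous.aestronglyMeasurable (by fun_prop)
  · filter_upwards [hs] with y hy
    rw [Real.norm_of_nonneg (by positivity)]
    calc ‖y‖ ^ n * ‖hessKer v y‖ ≤ 1 * ((2 * Real.pi) ^ 2 * ‖v‖ * ‖y‖ ^ 2) := by
          gcongr
          · exact pow_le_one₀ (norm_nonneg _) hy
          · exact norm_hessKer_le v y
      _ = _ := one_mul _

lemma fderiv_integral_dirKer (h2 : Integrable (fun y => ‖y‖ ^ 2) μ) (v : V) :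
    fderiv ℝ (fun ξ => ∫ y, dirKer v ξ y ∂μ) = fun ξ => ∫ y, expI ξ y • hessKer v y ∂μ :=
  funext fun ξ => (hasFDerivAt_integral_dirKer h2 v ξ).fderiv

lemma contDiff_integral_dirKer (hs : ∀ᵐ y ∂μ, ‖y‖ ≤ 1) (h2 : Integrable (fun y => ‖y‖ ^ 2) μ)
    (v : V) (n : ℕ) : ContDiff ℝ (n + 1) (fun ξ => ∫ y, dirKer v ξ y ∂μ) := by
  rw [contDiff_succ_iff_fderiv]
  refine ⟨fun ξ => (hasFDerivAt_integral_dirKer h2 v ξ).differentiableAt, by simp, ?_⟩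
  rw [fderiv_integral_dirKer h2, integral_expI_smul_hessKer]
  exact VectorFourier.contDiff_fourierIntegral (N := n) _
    (fun m _ => integrable_pow_mul_hessKer hs h2 v m)

/-- Each further derivative brings down a factor `2π‖y‖`, at most `2π` on the unit ball; hence the
second moment alone controls every order. -/
lemma norm_iteratedFDeriv_integral_dirKer_le (hs : ∀ᵐ y ∂μ, ‖y‖ ≤ 1)
    (h2 : Integrable (fun y => ‖y‖ ^ 2) μ) (v : V) (n : ℕ) (ξ : V) :
    ‖iteratedFDeriv ℝ (n + 1) (fun ξ => ∫ y, dirKer v ξ y ∂μ) ξ‖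
      ≤ (2 * Real.pi) ^ (n + 2) * ‖v‖ * ∫ y, ‖y‖ ^ 2 ∂μ := by
  rw [← norm_iteratedFDeriv_fderiv, fderiv_integral_dirKer h2, integral_expI_smul_hessKer,
    VectorFourier.iteratedFDeriv_fourierIntegral (N := n) _
      (fun m _ => integrable_pow_mul_hessKer hs h2 v m)
      (continuous_hessKer v).aestronglyMeasurable le_rfl]
  refine (VectorFourier.norm_fourierIntegral_le_integral_norm _ _ _ _ _).trans ?_
  rw [← integral_const_mul]
  refine integral_mono_of_nonneg (Eventually.of_forall fun y => norm_nonneg _)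
    (h2.const_mul _) ?_
  filter_upwards [hs] with y hy
  refine (VectorFourier.norm_fourierPowSMulRight_le _ _ _ _).trans ?_
  have hL : ‖(-innerSL ℝ : V →L[ℝ] V →L[ℝ] ℝ)‖ ≤ 1 :=
    (norm_neg (innerSL ℝ : V →L[ℝ] V →L[ℝ] ℝ)).trans_le (norm_innerSL_le _)
  calc (2 * Real.pi * ‖(-innerSL ℝ : V →L[ℝ] V →L[ℝ] ℝ)‖) ^ n * ‖y‖ ^ n * ‖hessKer v y‖
      ≤ (2 * Real.pi * 1) ^ n * 1 * ((2 * Real.pi) ^ 2 * ‖v‖ * ‖y‖ ^ 2) := by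
        gcongr
        · exact pow_le_one₀ (norm_nonneg _) hy
        · exact norm_hessKer_le v y
    _ = _ := by ring

/-- Expanding the gradient in an orthonormal basis reduces its regularity to that of the scalar
integrals of `dirKer`. -/
lemma fderiv_symb_one (h2 : Integrable (fun y => ‖y‖ ^ 2) μ) :
    fderiv ℝ (symb (fun _ => 1) μ) = fun ξ => ∑ i, (∫ y, dirKer (stdOrthonormalBasis ℝ V i) ξ y ∂μ)
      • innerC (stdOrthonormalBasis ℝ V i) := by
  funext ξ
  rw [(hasFDerivAt_symb_one h2 ξ).fderiv]
  ext v
  rw [ContinuousLinearMap.integral_apply (integrable_gradKer h2 ξ)]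
  conv_lhs => rw [← (stdOrthonormalBasis ℝ V).sum_repr' v]
  simp only [map_sum, map_smul, sum_apply, smul_apply,
    innerC_apply, gradKer_apply]
  rw [integral_finsetSum]
  · refine Finset.sum_congr rfl fun i _ => ?_
    rw [integral_smul, real_inner_comm, Complex.real_smul, smul_eq_mul, mul_comm]
  · intro i _
    have := ((integrable_gradKer h2 ξ).apply_continuousLinearMap (stdOrthonormalBasis ℝ V i)).smul
      (inner ℝ (stdOrthonormalBasis ℝ V i) v)
    simp only [gradKer_apply] at this
    exact this

lemma contDiff_symb_one (hs : ∀ᵐ y ∂μ, ‖y‖ ≤ 1) (h2 : Integrable (fun y => ‖y‖ ^ 2) μ) (n : ℕ) :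
    ContDiff ℝ n (symb (fun _ => 1) μ) := by
  have hS : ContDiff ℝ (n + 1) (symb (fun _ => 1) μ) := by
    rw [contDiff_succ_iff_fderiv]
    refine ⟨fun ξ => (hasFDerivAt_symb_one h2 ξ).differentiableAt, by simp, ?_⟩
    rw [fderiv_symb_one h2]
    refine ContDiff.sum fun i _ => ContDiff.fun_smul ?_ contDiff_const
    exact (contDiff_integral_dirKer hs h2 _ n).of_le le_self_add
  exact hS.of_le le_self_add

lemma norm_iteratedFDeriv_symb_one_le (hs : ∀ᵐ y ∂μ, ‖y‖ ≤ 1)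
    (h2 : Integrable (fun y => ‖y‖ ^ 2) μ) (n : ℕ) (ξ : V) :
    ‖iteratedFDeriv ℝ (n + 2) (symb (fun _ => 1) μ) ξ‖
      ≤ Module.finrank ℝ V * ((2 * Real.pi) ^ (n + 2) * ∫ y, ‖y‖ ^ 2 ∂μ) := by
  rw [← norm_iteratedFDeriv_fderiv, fderiv_symb_one h2]
  have hcd : ∀ v : V, ContDiff ℝ (n + 1) (fun ξ => ∫ y, dirKer v ξ y ∂μ) := fun v =>
    contDiff_integral_dirKer hs h2 v n
  have hcd' : ∀ v : V, ContDiff ℝ ((n + 1 : ℕ)) (fun ξ => (∫ y, dirKer v ξ y ∂μ) • innerC v) :=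
    fun v => by
      have := (hcd v).fun_smul (contDiff_const (c := innerC v))
      exact_mod_cast this
  rw [iteratedFDeriv_fun_sum_apply fun i _ => (hcd' _).contDiffAt]
  refine (norm_sum_le _ _).trans ?_
  refine (Finset.sum_le_card_nsmul _ _ ((2 * Real.pi) ^ (n + 2) * ∫ y, ‖y‖ ^ 2 ∂μ)
    fun i _ => ?_).trans_eq (by simp)
  set v := stdOrthonormalBasis ℝ V i with hv
  have hvn : ‖v‖ = 1 := (stdOrthonormalBasis ℝ V).orthonormal.1 i
  have := ((ContinuousLinearMap.id ℝ ℂ).smulRight (innerC v)).norm_iteratedFDeriv_comp_left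
    ((hcd v).contDiffAt (x := ξ)) le_rfl
  refine this.trans ?_
  have hn : ‖(ContinuousLinearMap.id ℝ ℂ).smulRight (innerC v)‖ ≤ 1 := by
    refine ContinuousLinearMap.opNorm_le_bound _ zero_le_one fun a => ?_
    have h1 : ‖a • innerC v‖ ≤ ‖a‖ * 1 := by
      rw [norm_smul]
      gcongr
      exact (norm_innerC_le v).trans hvn.le
    simpa using h1
  calc _ ≤ 1 * ((2 * Real.pi) ^ (n + 2) * ‖v‖ * ∫ y, ‖y‖ ^ 2 ∂μ) :=
        mul_le_mul hn (norm_iteratedFDeriv_integral_dirKer_le hs h2 v n ξ) (norm_nonneg _)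
          zero_le_one
    _ = _ := by rw [hvn]; ring

end Smooth

/-! ### Derivatives of the exponential of the exponent, and decay of its kernel. -/

lemma norm_iteratedFDeriv_cexp_le (n : ℕ) (z : ℂ) :
    ‖iteratedFDeriv ℝ n Complex.exp z‖ ≤ Real.exp z.re := by
  induction n with
  | zero => rw [norm_iteratedFDeriv_zero, Complex.norm_exp]
  | succ n ih =>
    have hf : fderiv ℝ Complex.exp
        = ((ContinuousLinearMap.id ℝ ℂ).smulRight (ContinuousLinearMap.id ℝ ℂ)) ∘ Complex.exp := by
      funext w
      rw [((Complex.hasDerivAt_exp w).hasFDerivAt.restrictScalars ℝ).fderiv]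
      ext v
      simp [mul_comm]
    rw [← norm_iteratedFDeriv_fderiv, hf]
    refine (ContinuousLinearMap.norm_iteratedFDeriv_comp_left _
      ((Complex.contDiff_exp (𝕜 := ℝ) (n := n)).contDiffAt) le_rfl).trans ?_
    refine (mul_le_of_le_one_left (norm_nonneg _) ?_).trans ih
    refine ContinuousLinearMap.opNorm_le_bound _ zero_le_one fun a => ?_
    have h1 : ‖a • ContinuousLinearMap.id ℝ ℂ‖ ≤ ‖a‖ * 1 := by
      rw [norm_smul]
      gcongr
      exact ContinuousLinearMap.norm_id_le
    simpa using h1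

lemma integrable_of_pow_mul_norm_le {F : Type*} [NormedAddCommGroup F] {g : V → F} {C₁ C₂ : ℝ}
    (hm : AEStronglyMeasurable g) (h0 : ∀ x, ‖g x‖ ≤ C₁)
    (h1 : ∀ x, ‖x‖ ^ (Module.finrank ℝ V + 1) * ‖g x‖ ≤ C₂) : Integrable g := by
  set m := Module.finrank ℝ V
  have hi : Integrable fun x : V => (1 + ‖x‖) ^ (-((m + 1 : ℕ) : ℝ)) :=
    integrable_one_add_norm (by push_cast; linarith)
  refine (hi.const_mul (2 ^ m * (C₁ + C₂))).mono' hm (Eventually.of_forall fun x => ?_)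
  rw [Real.rpow_neg (by positivity), Real.rpow_natCast, ← div_eq_mul_inv,
    le_div_iff₀ (by positivity)]
  have hc := add_pow_le zero_le_one (norm_nonneg x) (m + 1)
  rw [one_pow, Nat.add_sub_cancel] at hc
  calc ‖g x‖ * (1 + ‖x‖) ^ (m + 1) ≤ ‖g x‖ * (2 ^ m * (1 + ‖x‖ ^ (m + 1))) := by gcongr
    _ = 2 ^ m * (‖g x‖ + ‖x‖ ^ (m + 1) * ‖g x‖) := by ring
    _ ≤ 2 ^ m * (C₁ + C₂) := by gcongr; exacts [h0 x, h1 x]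

section Decay

variable {μ : Measure V} {Λ : V → ℝ} {A : ℝ}

/-- Faà di Bruno: if the `i`-th derivative of the exponent is at most `D ^ i` for `1 ≤ i ≤ n`, the
`n`-th derivative of its exponential is at most `n! D ^ n` times the modulus of the exponential.
Only the first derivative can grow with `ξ`, and `A (1 + Λ)` controls it. -/
lemma exists_norm_iteratedFDeriv_exp_symb_le (hs : ∀ᵐ y ∂μ, ‖y‖ ≤ 1)
    (h2 : Integrable (fun y => ‖y‖ ^ 2) μ) (hΛ : ∀ ξ, 0 ≤ Λ ξ) (hA0 : 0 ≤ A)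
    (hA : ∀ ξ, ∫ y, ‖y‖ * ‖expI ξ y - 1‖ ∂μ ≤ A * (1 + Λ ξ)) (n : ℕ) :
    ∃ B : ℝ, 0 ≤ B ∧ ∀ ξ, ‖iteratedFDeriv ℝ n (fun ξ => Complex.exp (symb (fun _ => 1) μ ξ)) ξ‖
      ≤ B * ((1 + Λ ξ) ^ n * Real.exp (symb (fun _ => 1) μ ξ).re) := by
  set m : ℝ := (Module.finrank ℝ V : ℝ) with hm
  set M := ∫ y, ‖y‖ ^ 2 ∂μ with hM
  have hM0 : 0 ≤ M := integral_nonneg fun y => by positivity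
  have hm0 : 0 ≤ m := Nat.cast_nonneg _
  -- `Q * (1 + Λ ξ)` plays the role of `D`: the summand `A` covers the gradient, `m * M` the orders
  -- at least two, and `1` makes powers of the bracket increase.
  set Q := 2 * Real.pi * (1 + A + m * M) with hQ
  have hmM : 0 ≤ m * M := by positivity
  have hQ0 : 0 ≤ Q := by have := Real.pi_pos; positivity
  refine ⟨n.factorial * Q ^ n, by positivity, fun ξ => ?_⟩
  have hΛξ := hΛ ξ
  have hD : ∀ i, 1 ≤ i → i ≤ n →
      ‖iteratedFDeriv ℝ i (symb (fun _ => 1) μ) ξ‖ ≤ (Q * (1 + Λ ξ)) ^ i := by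
    intro i hi _
    obtain rfl | ⟨j, rfl⟩ : i = 1 ∨ ∃ j, i = j + 2 := by
      rcases i with _ | _ | j
      · omega
      · exact Or.inl rfl
      · exact Or.inr ⟨j, rfl⟩
    · rw [norm_iteratedFDeriv_one, (hasFDerivAt_symb_one h2 ξ).fderiv, pow_one]
      have hint : Integrable (fun y => ‖y‖ * ‖expI ξ y - 1‖) μ := by
        refine (h2.const_mul (2 * Real.pi * ‖ξ‖)).mono'
          (Continuous.aestronglyMeasurable (by fun_prop)) (Eventually.of_forall fun y => ?_)
        rw [Real.norm_of_nonneg (by positivity)]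
        calc ‖y‖ * ‖expI ξ y - 1‖ ≤ ‖y‖ * (2 * Real.pi * (‖ξ‖ * ‖y‖)) := by
              gcongr; exact norm_expI_sub_one_le ξ y
          _ = _ := by ring
      refine (norm_integral_le_of_norm_le (hint.const_mul (2 * Real.pi))
        (Eventually.of_forall fun y => norm_gradKer_le ξ y)).trans ?_
      rw [integral_const_mul, hQ, mul_assoc (2 * Real.pi) (1 + A + m * M)]
      refine mul_le_mul_of_nonneg_left ((hA ξ).trans ?_) Real.two_pi_pos.le
      gcongr
      linarith
    · refine (norm_iteratedFDeriv_symb_one_le hs h2 j ξ).trans ?_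
      have h1 : m * M ≤ (1 + A + m * M) ^ (j + 2) :=
        le_trans (by linarith) (le_self_pow₀ (by linarith) (by omega))
      have h3 : (1 : ℝ) ≤ (1 + Λ ξ) ^ (j + 2) := one_le_pow₀ (by linarith)
      calc m * ((2 * Real.pi) ^ (j + 2) * M) = (2 * Real.pi) ^ (j + 2) * (m * M) * 1 := by ring
        _ ≤ (2 * Real.pi) ^ (j + 2) * (1 + A + m * M) ^ (j + 2) * (1 + Λ ξ) ^ (j + 2) := by
            gcongr
        _ = _ := by rw [hQ, ← mul_pow, ← mul_pow]
  have hC : ∀ i, i ≤ n → ‖iteratedFDeriv ℝ i Complex.exp (symb (fun _ => 1) μ ξ)‖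
      ≤ Real.exp (symb (fun _ => 1) μ ξ).re := fun i _ => norm_iteratedFDeriv_cexp_le i _
  have := norm_iteratedFDeriv_comp_le (n := n) (N := n) (Complex.contDiff_exp (𝕜 := ℝ))
    (contDiff_symb_one hs h2 n) le_rfl ξ hC hD
  refine this.trans_eq ?_
  rw [mul_pow]; ring

/-- The weight `‖ξ‖ ^ 4` in the hypothesis degenerates at the origin, so the unit ball is handled by
continuity; outside it every power `k ≤ 4` is dominated. -/
lemma integrable_pow_mul_iteratedFDeriv_exp_symb (hs : ∀ᵐ y ∂μ, ‖y‖ ≤ 1)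
    (h2 : Integrable (fun y => ‖y‖ ^ 2) μ) (hΛ : ∀ ξ, 0 ≤ Λ ξ) (hA0 : 0 ≤ A)
    (hA : ∀ ξ, ∫ y, ‖y‖ * ‖expI ξ y - 1‖ ∂μ ≤ A * (1 + Λ ξ)) {N : ℕ}
    (hfin : ∫⁻ ξ : V, ENNReal.ofReal (‖ξ‖ ^ 4 * (1 + Λ ξ) ^ N
      * Real.exp (symb (fun _ => 1) μ ξ).re) < ∞) {k n : ℕ} (hk : k ≤ 4) (hn : n ≤ N) :
    Integrable fun ξ => ‖ξ‖ ^ k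
      * ‖iteratedFDeriv ℝ n (fun ξ => Complex.exp (symb (fun _ => 1) μ ξ)) ξ‖ := by
  obtain ⟨B, hB0, hB⟩ := exists_norm_iteratedFDeriv_exp_symb_le hs h2 hΛ hA0 hA n
  have hcont : Continuous fun ξ : V => ‖ξ‖ ^ k
      * ‖iteratedFDeriv ℝ n (fun ξ => Complex.exp (symb (fun _ => 1) μ ξ)) ξ‖ := by
    have hc : ContDiff ℝ n (fun ξ => Complex.exp (symb (fun _ => 1) μ ξ)) :=
      (contDiff_symb_one hs h2 n).cexp
    exact (continuous_norm.pow k).mul (hc.continuous_iteratedFDeriv le_rfl).norm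
  rw [← integrableOn_univ, ← union_compl_self (Metric.closedBall (0 : V) 1)]
  refine IntegrableOn.union
    (hcont.continuousOn.integrableOn_compact (isCompact_closedBall _ _)) ?_
  refine ⟨hcont.aestronglyMeasurable, ?_⟩
  rw [hasFiniteIntegral_iff_ofReal (Eventually.of_forall fun ξ => by positivity)]
  calc ∫⁻ ξ in (Metric.closedBall (0 : V) 1)ᶜ, ENNReal.ofReal (‖ξ‖ ^ k
        * ‖iteratedFDeriv ℝ n (fun ξ => Complex.exp (symb (fun _ => 1) μ ξ)) ξ‖)
      ≤ ∫⁻ ξ in (Metric.closedBall (0 : V) 1)ᶜ, ENNReal.ofReal B * ENNReal.ofReal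
          (‖ξ‖ ^ 4 * (1 + Λ ξ) ^ N * Real.exp (symb (fun _ => 1) μ ξ).re) := by
        refine setLIntegral_mono' Metric.isClosed_closedBall.measurableSet.compl fun ξ hξ => ?_
        rw [← ENNReal.ofReal_mul hB0]
        refine ENNReal.ofReal_le_ofReal ?_
        have h1 : 1 ≤ ‖ξ‖ := by
          rw [mem_compl_iff, mem_closedBall_zero_iff, not_le] at hξ
          exact hξ.le
        have h3 : 1 ≤ 1 + Λ ξ := by linarith [hΛ ξ]
        calc _ ≤ ‖ξ‖ ^ 4 * (B * ((1 + Λ ξ) ^ N * Real.exp (symb (fun _ => 1) μ ξ).re)) := by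
              refine mul_le_mul (pow_le_pow_right₀ h1 hk) ((hB ξ).trans ?_) (norm_nonneg _)
                (by positivity)
              gcongr
          _ = _ := by ring
    _ ≤ ENNReal.ofReal B * ∫⁻ ξ : V, ENNReal.ofReal
          (‖ξ‖ ^ 4 * (1 + Λ ξ) ^ N * Real.exp (symb (fun _ => 1) μ ξ).re) := by
        rw [lintegral_const_mul' _ _ ENNReal.ofReal_ne_top]
        gcongr
        exact Measure.restrict_le_self
    _ < ∞ := ENNReal.mul_lt_top ENNReal.ofReal_lt_top hfin

/-- With `m` the dimension, integrability of the derivatives of `E` up to order `m + 1`, weighted by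
`‖ξ‖ ^ k` with `k ≤ 1`, makes the transform and its gradient decay like `‖x‖ ^ (-(m + 1))`, one
power more than `L¹` requires. -/
lemma fourierInv_exp_symb_decay (hs : ∀ᵐ y ∂μ, ‖y‖ ≤ 1)
    (h2 : Integrable (fun y => ‖y‖ ^ 2) μ) (hΛ : ∀ ξ, 0 ≤ Λ ξ) (hA0 : 0 ≤ A)
    (hA : ∀ ξ, ∫ y, ‖y‖ * ‖expI ξ y - 1‖ ∂μ ≤ A * (1 + Λ ξ))
    (hfin : ∫⁻ ξ : V, ENNReal.ofReal (‖ξ‖ ^ 4 * (1 + Λ ξ) ^ (Module.finrank ℝ V + 3)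
      * Real.exp (symb (fun _ => 1) μ ξ).re) < ∞) :
    let E : V → ℂ := fun ξ => Complex.exp (symb (fun _ => 1) μ ξ)
    Integrable (fun ξ => ‖ξ‖ * ‖E ξ‖) ∧ Integrable E ∧
      Integrable (𝓕⁻ E) ∧ ContDiff ℝ 1 (𝓕⁻ E) ∧ Integrable (fderiv ℝ (𝓕⁻ E)) := by
  intro E
  set m := Module.finrank ℝ V
  have hI : ∀ k n : ℕ, k ≤ 4 → n ≤ m + 3 →
      Integrable fun ξ => ‖ξ‖ ^ k * ‖iteratedFDeriv ℝ n E ξ‖ := fun k n hk hn =>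
    integrable_pow_mul_iteratedFDeriv_exp_symb hs h2 hΛ hA0 hA hfin hk hn
  have hcE : Continuous E := (contDiff_symb_one hs h2 0).continuous.cexp
  have hE1 : Integrable (fun ξ => ‖ξ‖ * ‖E ξ‖) := by
    simpa using hI 1 0 (by norm_num) (by omega)
  have hE0 : Integrable E := by
    refine (integrable_norm_iff hcE.aestronglyMeasurable).1 ?_
    simpa using hI 0 0 (by norm_num) (by omega)
  have hcd : ContDiff ℝ ((m + 1 : ℕ) : ℕ∞) E := by
    exact_mod_cast (contDiff_symb_one hs h2 (m + 1)).cexp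
  have hF : ContDiff ℝ ((1 : ℕ) : ℕ∞) (𝓕 E) := by
    refine Real.contDiff_fourier fun n hn => ?_
    have hn' : n ≤ 1 := by exact_mod_cast hn
    simpa using hI n 0 (by omega) (by omega)
  have hF1 : ContDiff ℝ 1 (𝓕 E) := by exact_mod_cast hF
  have hb : ∀ k n : ℕ, k ≤ 1 → n ≤ m + 1 → ∃ C : ℝ, ∀ w : V,
      ‖w‖ ^ n * ‖iteratedFDeriv ℝ k (𝓕 E) w‖ ≤ C := fun k n hk hn =>
    ⟨_, fun w => Real.pow_mul_norm_iteratedFDeriv_fourier_le (K := (1 : ℕ)) (N := ((m + 1 : ℕ) : ℕ∞))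
      hcd (fun k n hk hn => hI k n (by have : k ≤ 1 := by exact_mod_cast hk
                                       omega)
        (by have : n ≤ m + 1 := by exact_mod_cast hn
            omega))
      (by exact_mod_cast hk) (by exact_mod_cast hn) w⟩
  have hg : Integrable (𝓕 E) := by
    obtain ⟨C₁, hC₁⟩ := hb 0 0 (by omega) (by omega)
    obtain ⟨C₂, hC₂⟩ := hb 0 (m + 1) (by omega) le_rfl
    exact integrable_of_pow_mul_norm_le hF1.continuous.aestronglyMeasurable
      (fun x => by simpa using hC₁ x) (fun x => by simpa using hC₂ x)
  have hg' : Integrable (fderiv ℝ (𝓕 E)) := by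
    obtain ⟨C₁, hC₁⟩ := hb 1 0 (by omega) (by omega)
    obtain ⟨C₂, hC₂⟩ := hb 1 (m + 1) (by omega) le_rfl
    refine integrable_of_pow_mul_norm_le (C₁ := C₁) (C₂ := C₂)
      (hF1.continuous_fderiv one_ne_zero).aestronglyMeasurable
      (fun x => ?_) (fun x => ?_)
    · have := hC₁ x
      rwa [pow_zero, one_mul, norm_iteratedFDeriv_one] at this
    · have := hC₂ x
      rwa [norm_iteratedFDeriv_one] at this
  have heq : 𝓕⁻ E = fun x => 𝓕 E (-x) := funext fun x => Real.fourierInv_eq_fourier_neg E x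
  refine ⟨hE1, hE0, ?_, ?_, ?_⟩
  · rw [heq]; exact hg.comp_neg
  · rw [heq]; exact hF1.comp contDiff_neg
  · have : fderiv ℝ (𝓕⁻ E) = fun x => -(fderiv ℝ (𝓕 E) (-x)) := by
      funext x
      rw [heq]
      have h1 := (hF1.differentiable one_ne_zero (-x)).hasFDerivAt.comp x ((hasFDerivAt_id x).neg)
      refine h1.fderiv.trans ?_
      ext v
      simp
    rw [this]
    exact hg'.comp_neg.neg

end Decay

/-! ### Kernel bounds uniform over all measures dominating a fixed one. -/

lemma lintegral_translate_sub_le {F : Type*} [NormedAddCommGroup F] [NormedSpace ℝ F]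
    [CompleteSpace F] {g : V → F} (hg : ContDiff ℝ 1 g) (w : V) :
    ∫⁻ x, ‖g (x + w) - g x‖ₑ ≤ ‖w‖ₑ * ∫⁻ x, ‖fderiv ℝ g x‖ₑ := by
  have hc : Continuous (fderiv ℝ g) := hg.continuous_fderiv one_ne_zero
  have hpt : ∀ x, g (x + w) - g x = ∫ s in (0 : ℝ)..1, fderiv ℝ g (x + s • w) w := by
    intro x
    have hd : ∀ s ∈ uIcc (0 : ℝ) 1, HasDerivAt (fun s : ℝ => g (x + s • w))
        (fderiv ℝ g (x + s • w) w) s := by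
      intro s _
      have h1 : HasDerivAt (fun s : ℝ => x + s • w) w s := by
        simpa using ((hasDerivAt_id s).smul_const w).const_add x
      exact ((hg.differentiable one_ne_zero _).hasFDerivAt).comp_hasDerivAt s h1
    rw [intervalIntegral.integral_eq_sub_of_hasDerivAt hd
      (Continuous.intervalIntegrable (by fun_prop) _ _)]
    simp
  calc ∫⁻ x, ‖g (x + w) - g x‖ₑ
      ≤ ∫⁻ x, (∫⁻ s in Ioc (0 : ℝ) 1, ‖fderiv ℝ g (x + s • w)‖ₑ * ‖w‖ₑ) := by
        refine lintegral_mono fun x => ?_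
        rw [hpt, intervalIntegral.integral_of_le zero_le_one]
        refine (enorm_integral_le_lintegral_enorm _).trans (lintegral_mono fun s => ?_)
        exact ContinuousLinearMap.le_opENorm _ _
    _ = ∫⁻ s in Ioc (0 : ℝ) 1, (∫⁻ x, ‖fderiv ℝ g (x + s • w)‖ₑ * ‖w‖ₑ) := by
        refine lintegral_lintegral_swap ?_
        refine Continuous.aemeasurable ?_
        have h1 : Continuous fun q : V × ℝ => ‖fderiv ℝ g (q.1 + q.2 • w)‖ₑ := by fun_prop
        exact ENNReal.continuous_mul_const enorm_ne_top |>.comp h1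
    _ = ∫⁻ _ in Ioc (0 : ℝ) 1, (∫⁻ x, ‖fderiv ℝ g x‖ₑ * ‖w‖ₑ) := by
        refine lintegral_congr fun s => ?_
        exact lintegral_add_right_eq_self (fun x => ‖fderiv ℝ g x‖ₑ * ‖w‖ₑ) (s • w)
    _ = ‖w‖ₑ * ∫⁻ x, ‖fderiv ℝ g x‖ₑ := by
        rw [lintegral_const, lintegral_mul_const' _ _ enorm_ne_top]
        simp [mul_comm]

lemma symb_re {c : V → ℝ} {π : Measure V} {ξ : V} (h : Integrable (levyKer c ξ) π) :
    (symb c π ξ).re = -∫ y, (1 - Real.cos (2 * Real.pi * inner ℝ ξ y)) ∂π := by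
  rw [symb, ← integral_neg]
  simp_rw [← levyKer_re c]
  exact (integral_re h).symm

lemma integrable_one_sub_cos {c : V → ℝ} {π : Measure V} {ξ : V}
    (h : Integrable (levyKer c ξ) π) :
    Integrable (fun y => 1 - Real.cos (2 * Real.pi * inner ℝ ξ y)) π := by
  refine h.re.neg.congr (Eventually.of_forall fun y => ?_)
  have := levyKer_re c ξ y
  simp [this]

/-- The real part does not see the cut-off, and `1 - cos` is nonnegative, so enlarging the measure
lowers the real part. -/
lemma symb_re_le {c c' : V → ℝ} {π μ : Measure V} {ξ : V} (hle : μ ≤ π)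
    (h : Integrable (levyKer c ξ) π) (h' : Integrable (levyKer c' ξ) μ) :
    (symb c π ξ).re ≤ (symb c' μ ξ).re := by
  rw [symb_re h, symb_re h', neg_le_neg_iff]
  refine integral_mono_measure hle (Eventually.of_forall fun y => ?_) (integrable_one_sub_cos h)
  simpa using Real.cos_le_one _

lemma integrable_levyKer_one {μ : Measure V} (h2 : Integrable (fun y => ‖y‖ ^ 2) μ) (ξ : V) :
    Integrable (levyKer (fun _ => 1) ξ) μ :=
  (h2.const_mul ((2 * Real.pi) ^ 2 * ‖ξ‖ ^ 2)).mono'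
    (measurable_levyKer measurable_const ξ).aestronglyMeasurable
    (Eventually.of_forall fun y => norm_levyKer_one_le ξ y)

/-- A Lévy measure together with a cut-off for which the Lévy exponent is well defined and
continuous. -/
structure LevyPair (c : V → ℝ) (π : Measure V) : Prop where
  zero_null : π {0} = 0
  finite_off_zero : ∀ ε : ℝ, 0 < ε → π {y | ε < ‖y‖} < ∞
  integrable : ∀ ξ, Integrable (levyKer c ξ) π
  continuous_symb : Continuous (symb c π)

/-- Bounds for the convolution kernel `𝓕⁻ G` of a multiplier `G` and for its increments. -/
structure KernelBound (C : ℝ) (G : V → ℂ) : Prop where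
  integrable_symbol : Integrable G
  integrable : Integrable (𝓕⁻ G)
  fourier_eq : 𝓕 (𝓕⁻ G) = G
  lintegral_le : ∫⁻ x, ‖𝓕⁻ G x‖ₑ ≤ ENNReal.ofReal C
  lintegral_sub_le : ∀ w : V, ∫⁻ x, ‖𝓕⁻ G (x + w) - 𝓕⁻ G x‖ₑ ≤ ENNReal.ofReal (C * min 1 ‖w‖)
  norm_sub_le : ∀ w x : V, ‖𝓕⁻ G (x + w) - 𝓕⁻ G x‖ ≤ C * min 1 ‖w‖

lemma fourierInv_translate_sub {h : V → ℂ} (hh : Integrable h) (x w : V) :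
    𝓕⁻ (fun ξ => (expI ξ w - 1) * h ξ) x = 𝓕⁻ h (x + w) - 𝓕⁻ h x := by
  rw [← fourierInv_expI_mul, fourierInv_eq_expI, fourierInv_eq_expI, fourierInv_eq_expI,
    ← integral_sub (integrable_expI_mul (integrable_expI_mul hh w) x) (integrable_expI_mul hh x)]
  refine integral_congr_ae (Eventually.of_forall fun ξ => ?_)
  simp only; ring

/-- Uniform kernel bounds for all Lévy exponents whose measure dominates `μ`. -/
lemma exists_kernelBound {μ : Measure V} (h2 : Integrable (fun y => ‖y‖ ^ 2) μ)
    (hE1 : Integrable fun ξ => ‖ξ‖ * ‖Complex.exp (symb (fun _ => 1) μ ξ)‖)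
    (hE0 : Integrable fun ξ => Complex.exp (symb (fun _ => 1) μ ξ))
    (hcE : Continuous (symb (fun _ => 1) μ))
    (hg : Integrable (𝓕⁻ fun ξ => Complex.exp (symb (fun _ => 1) μ ξ)))
    (hcd : ContDiff ℝ 1 (𝓕⁻ fun ξ => Complex.exp (symb (fun _ => 1) μ ξ)))
    (hg' : Integrable (fderiv ℝ (𝓕⁻ fun ξ => Complex.exp (symb (fun _ => 1) μ ξ)))) :
    ∃ C : ℝ, 0 < C ∧ ∀ (c : V → ℝ) (π : Measure V), LevyPair c π → μ ≤ π →
      KernelBound C fun ξ => Complex.exp (symb c π ξ) := by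
  set E : V → ℂ := fun ξ => Complex.exp (symb (fun _ => 1) μ ξ) with hE
  set I₀ := ∫ x, ‖𝓕⁻ E x‖ with hI₀
  set I₁ := ∫ x, ‖fderiv ℝ (𝓕⁻ E) x‖ with hI₁
  set J₀ := ∫ ξ, ‖E ξ‖ with hJ₀
  set J₁ := ∫ ξ, ‖ξ‖ * ‖E ξ‖ with hJ₁
  have hI₀0 : 0 ≤ I₀ := integral_nonneg fun _ => norm_nonneg _
  have hI₁0 : 0 ≤ I₁ := integral_nonneg fun _ => norm_nonneg _
  have hJ₀0 : 0 ≤ J₀ := integral_nonneg fun _ => norm_nonneg _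
  have hJ₁0 : 0 ≤ J₁ := integral_nonneg fun _ => by positivity
  have hpi := Real.pi_pos
  -- `2 * I₀` and `I₁` bound the `L¹` increments for large and small shifts, `2 * J₀` and `2π J₁`
  -- the uniform ones; their sum serves all cases, and `1` makes it positive.
  set C := 1 + 2 * I₀ + I₁ + 2 * J₀ + 2 * Real.pi * J₁ with hC
  have hpJ : 0 ≤ 2 * Real.pi * J₁ := by positivity
  have hCle : ∀ {a b w : ℝ}, 0 ≤ w → a ≤ C → b ≤ C → min a (b * w) ≤ C * min 1 w := by
    intro a b w hw ha hb
    rcases le_total 1 w with h | h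
    · rw [min_eq_left h, mul_one]; exact (min_le_left _ _).trans ha
    · rw [min_eq_right h]; exact (min_le_right _ _).trans (by gcongr)
  have hl0 : ∫⁻ x, ‖𝓕⁻ E x‖ₑ = ENNReal.ofReal I₀ := (ofReal_integral_norm_eq_lintegral_enorm hg).symm
  have hl1 : ∫⁻ x, ‖fderiv ℝ (𝓕⁻ E) x‖ₑ = ENNReal.ofReal I₁ :=
    (ofReal_integral_norm_eq_lintegral_enorm hg').symm
  refine ⟨C, by positivity, fun c π hP hle => ?_⟩
  set G : V → ℂ := fun ξ => Complex.exp (symb c π ξ) with hG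
  have hGc : Continuous G := hP.continuous_symb.cexp
  have hGE : ∀ ξ, ‖G ξ‖ ≤ ‖E ξ‖ := by
    intro ξ
    rw [hG, hE, Complex.norm_exp, Complex.norm_exp, Real.exp_le_exp]
    exact symb_re_le hle (hP.integrable ξ) (integrable_levyKer_one h2 ξ)
  have hGi : Integrable G := hE0.mono hGc.aestronglyMeasurable (Eventually.of_forall hGE)
  -- `G` is `E` times the exponential of the difference of exponents, so the contraction compares
  -- the two kernels. It is used with `h = 1` for the kernel and `h = expI · w - 1` for its
  -- increments.
  have hcontr : ∀ {h : V → ℂ}, StronglyMeasurable h → Integrable (fun ξ => h ξ * E ξ) →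
      ∫⁻ x, ‖𝓕⁻ (fun ξ => h ξ * G ξ) x‖ₑ ≤ ∫⁻ x, ‖𝓕⁻ (fun ξ => h ξ * E ξ) x‖ₑ := by
    intro h hm hi
    have := lintegral_fourierInv_exp_symb_sub_mul_le hle hP.zero_null hP.finite_off_zero
      hP.integrable (integrable_levyKer_one h2)
      (hm.mul hcE.cexp.stronglyMeasurable) hi
    refine le_trans (le_of_eq ?_) this
    congr 1; funext x
    congr 1
    refine congrArg (fun u : V → ℂ => 𝓕⁻ u x) (funext fun ξ => ?_)
    simp only [hG, Complex.exp_sub, Pi.mul_apply]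
    have := Complex.exp_ne_zero (symb (fun _ => 1) μ ξ)
    field_simp
  have hk0 : ∫⁻ x, ‖𝓕⁻ G x‖ₑ ≤ ENNReal.ofReal I₀ := by
    have := hcontr (h := fun _ => 1) stronglyMeasurable_const (by simpa using hE0)
    simp only [one_mul] at this
    exact this.trans_eq hl0
  have hki : Integrable (𝓕⁻ G) := by
    refine ⟨(continuous_fourierInv hGi).aestronglyMeasurable, hk0.trans_lt ENNReal.ofReal_lt_top⟩
  have hkF : Integrable (𝓕 G) := by
    have : 𝓕 G = fun x => 𝓕⁻ G (-x) := funext fun x => by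
      rw [Real.fourierInv_eq_fourier_neg, neg_neg]
    rw [this]
    exact hki.comp_neg
  refine ⟨hGi, hki, hGc.fourier_fourierInv_eq hGi hkF, hk0.trans ?_, fun w => ?_, fun w x => ?_⟩
  · exact ENNReal.ofReal_le_ofReal (by linarith)
  · have hm : StronglyMeasurable fun ξ : V => expI ξ w - 1 :=
      Continuous.stronglyMeasurable (by fun_prop)
    have h1 := hcontr hm (hE0.bdd_mul (c := 2) hm.aestronglyMeasurable
      (Eventually.of_forall fun ξ => norm_expI_sub_one_le_two ξ w))
    simp_rw [fourierInv_translate_sub hGi, fourierInv_translate_sub hE0] at h1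
    have h3 : ∫⁻ x, ‖𝓕⁻ E (x + w) - 𝓕⁻ E x‖ₑ ≤ ENNReal.ofReal (I₁ * ‖w‖) := by
      refine (lintegral_translate_sub_le hcd w).trans_eq ?_
      rw [hl1, ENNReal.ofReal_mul hI₁0, mul_comm, ofReal_norm]
    have h4 : ∫⁻ x, ‖𝓕⁻ E (x + w) - 𝓕⁻ E x‖ₑ ≤ ENNReal.ofReal (2 * I₀) := by
      calc ∫⁻ x, ‖𝓕⁻ E (x + w) - 𝓕⁻ E x‖ₑ ≤ ∫⁻ x, (‖𝓕⁻ E (x + w)‖ₑ + ‖𝓕⁻ E x‖ₑ) :=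
            lintegral_mono fun x => enorm_sub_le
        _ = ENNReal.ofReal I₀ + ENNReal.ofReal I₀ := by
            rw [lintegral_add_right _ (continuous_fourierInv hE0).measurable.enorm,
              lintegral_add_right_eq_self (fun x => ‖𝓕⁻ E x‖ₑ) w, hl0]
        _ = _ := by rw [two_mul, ENNReal.ofReal_add hI₀0 hI₀0]
    refine h1.trans ((le_min h4 h3).trans ?_)
    rw [← ENNReal.ofReal_min]
    exact ENNReal.ofReal_le_ofReal (hCle (norm_nonneg w) (by linarith) (by linarith))
  -- The uniform bound needs no contraction: `|G| ≤ |E|` on the frequency side suffices.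
  · rw [← fourierInv_translate_sub hGi]
    have hi2 : Integrable fun ξ => ‖expI ξ w - 1‖ * ‖E ξ‖ := by
      refine hE0.norm.bdd_mul (c := 2) (Continuous.aestronglyMeasurable (by fun_prop))
        (Eventually.of_forall fun ξ => ?_)
      rw [norm_norm]; exact norm_expI_sub_one_le_two ξ w
    have h1 : ‖𝓕⁻ (fun ξ => (expI ξ w - 1) * G ξ) x‖ ≤ ∫ ξ, ‖expI ξ w - 1‖ * ‖E ξ‖ := by
      refine (norm_fourierInv_le _ x).trans ?_
      refine integral_mono_of_nonneg (Eventually.of_forall fun _ => norm_nonneg _) hi2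
        (Eventually.of_forall fun ξ => ?_)
      simp only [norm_mul]
      gcongr
      exact hGE ξ
    have h3 : ∫ ξ, ‖expI ξ w - 1‖ * ‖E ξ‖ ≤ 2 * J₀ := by
      rw [hJ₀, ← integral_const_mul]
      refine integral_mono hi2 (hE0.norm.const_mul 2) fun ξ => ?_
      exact mul_le_mul_of_nonneg_right (norm_expI_sub_one_le_two ξ w) (norm_nonneg _)
    have h4 : ∫ ξ, ‖expI ξ w - 1‖ * ‖E ξ‖ ≤ 2 * Real.pi * J₁ * ‖w‖ := by
      have : 2 * Real.pi * J₁ * ‖w‖ = ∫ ξ, (2 * Real.pi * ‖w‖) * (‖ξ‖ * ‖E ξ‖) := by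
        rw [integral_const_mul]; ring
      rw [this]
      refine integral_mono hi2 (hE1.const_mul _) fun ξ => ?_
      calc ‖expI ξ w - 1‖ * ‖E ξ‖ ≤ 2 * Real.pi * (‖ξ‖ * ‖w‖) * ‖E ξ‖ := by
            gcongr; exact norm_expI_sub_one_le ξ w
        _ = _ := by ring
    exact h1.trans ((le_min h3 h4).trans (hCle (norm_nonneg w) (by linarith) (by linarith)))

/-! ### Dilated convolutions and Hölder's inequality. -/

lemma fourierInv_const_mul (a : ℂ) (h : V → ℂ) (x : V) :
    𝓕⁻ (fun ξ => a * h ξ) x = a * 𝓕⁻ h x := by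
  rw [fourierInv_eq_expI, fourierInv_eq_expI, ← integral_const_mul]
  refine integral_congr_ae (Eventually.of_forall fun ξ => ?_)
  simp only; ring

lemma fourier_translate (k : V → ℂ) (w η : V) :
    𝓕 (fun u => k (u + w)) η = expI η w * 𝓕 k η := by
  rw [fourier_eq_expI, fourier_eq_expI, ← integral_const_mul,
    ← integral_add_right_eq_self (fun u => expI η w * (expI u (-η) * k u)) w]
  refine integral_congr_ae (Eventually.of_forall fun u => ?_)
  have h1 : expI (u + w) (-η) = expI u (-η) * expI w (-η) := by
    rw [expI_comm, expI_add, expI_comm, expI_comm (-η) w]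
  have h2 : expI η w * expI w (-η) = 1 := by
    rw [expI_comm, ← expI_add]; simp
  simp only [h1]
  linear_combination (-(expI u (-η) * k (u + w))) * h2

section Convolution

variable {k h : V → ℂ}

lemma integrable_convKer (hk : Integrable k) (hh : Integrable h) (R : ℝ) :
    Integrable (Function.uncurry fun u ξ : V => k u * (expI ξ (-(R • u)) * h ξ))
      (volume.prod volume) := by
  have h1 := hk.mul_prod hh
  have h2 : Integrable (fun q : V × V => expI q.2 (-(R • q.1)) * (k q.1 * h q.2))
      (volume.prod volume) := by
    refine h1.bdd_mul (c := 1) ?_ (Eventually.of_forall fun q => by simp)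
    exact Continuous.aestronglyMeasurable (by fun_prop)
  refine h2.congr (Eventually.of_forall fun q => ?_)
  simp only [Function.uncurry]; ring

lemma integral_convKer (R : ℝ) (ξ : V) :
    ∫ u, k u * (expI ξ (-(R • u)) * h ξ) = 𝓕 k (R • ξ) * h ξ := by
  rw [fourier_eq_expI, ← integral_mul_const]
  refine integral_congr_ae (Eventually.of_forall fun u => ?_)
  have : expI u (-(R • ξ)) = expI ξ (-(R • u)) := by
    rw [expI_comm, ← neg_smul, ← neg_smul, expI_smul_left]
  simp only [this]; ring

lemma fourierInv_convKer (R : ℝ) (u x : V) :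
    𝓕⁻ (fun ξ => k u * (expI ξ (-(R • u)) * h ξ)) x = k u * 𝓕⁻ h (x - R • u) := by
  rw [fourierInv_const_mul, fourierInv_expI_mul, sub_eq_add_neg]

/-- Dilating the multiplier by `R` makes the convolution kernel act at length scale `R`; this is how
unit-scale kernels describe the semigroup at every time. -/
lemma fourierInv_fourier_smul_mul (hk : Integrable k) (hh : Integrable h) (R : ℝ) (x : V) :
    𝓕⁻ (fun ξ => 𝓕 k (R • ξ) * h ξ) x = ∫ u, k u * 𝓕⁻ h (x - R • u) := by
  have := fourierInv_integral (integrable_convKer hk hh R) x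
  simpa only [integral_convKer, fourierInv_convKer] using this

lemma lintegral_fourierInv_fourier_smul_mul_le (hkm : StronglyMeasurable k)
    (hhm : StronglyMeasurable h) (hk : Integrable k) (hh : Integrable h) (R : ℝ) :
    ∫⁻ x, ‖𝓕⁻ (fun ξ => 𝓕 k (R • ξ) * h ξ) x‖ₑ ≤ (∫⁻ u, ‖k u‖ₑ) * ∫⁻ x, ‖𝓕⁻ h x‖ₑ := by
  have hsm : StronglyMeasurable
      (Function.uncurry fun u ξ : V => k u * (expI ξ (-(R • u)) * h ξ)) := by
    refine (hkm.comp_measurable measurable_fst).mul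
      (StronglyMeasurable.mul ?_ (hhm.comp_measurable measurable_snd))
    exact Continuous.stronglyMeasurable (by fun_prop)
  have := lintegral_fourierInv_integral_le hsm (integrable_convKer hk hh R)
  simp only [integral_convKer, fourierInv_convKer, enorm_mul] at this
  refine this.trans_eq ?_
  have h1 : ∀ u : V, ∫⁻ x, ‖k u‖ₑ * ‖𝓕⁻ h (x - R • u)‖ₑ = ‖k u‖ₑ * ∫⁻ x, ‖𝓕⁻ h x‖ₑ := by
    intro u
    rw [lintegral_const_mul' _ _ enorm_ne_top,
      lintegral_sub_right_eq_self (fun x => ‖𝓕⁻ h x‖ₑ) (R • u)]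
  simp_rw [h1]
  rw [lintegral_mul_const _ hkm.measurable.enorm]

end Convolution

lemma lintegral_comp_sub_smul {F : V → ℝ≥0∞} (hF : Measurable F) (x : V) {R : ℝ} (hR : 0 < R) :
    ∫⁻ u, F (x - R • u) = ENNReal.ofReal ((R ^ Module.finrank ℝ V)⁻¹) * ∫⁻ v, F v := by
  have h1 : ∫⁻ u, F (x - R • u) = ∫⁻ v, F (x - v) ∂(Measure.map (fun u : V => R • u) volume) := by
    rw [lintegral_map (by fun_prop) (by fun_prop)]
  rw [h1]
  have h2 := Measure.map_addHaar_smul (volume : Measure V) hR.ne'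
  rw [h2, lintegral_smul_measure, lintegral_sub_left_eq_self, abs_of_pos (by positivity),
    smul_eq_mul]

/-- Since `a` bounds `k` both in `L¹` and uniformly, it bounds the norm of `k` in the conjugate
exponent. Hölder concludes, and the power of `R` is the Jacobian of `u ↦ x - R • u`. -/
lemma enorm_integral_mul_comp_sub_smul_le {k H : V → ℂ} {a p R : ℝ} (hp : 1 < p) (hR : 0 < R)
    (hkm : AEMeasurable k) (hHm : Measurable H)
    (hk1 : ∫⁻ u, ‖k u‖ₑ ≤ ENNReal.ofReal a) (hk : ∀ u, ‖k u‖ ≤ a) (x : V) :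
    ‖∫ u, k u * H (x - R • u)‖ₑ ≤ ENNReal.ofReal a
      * (ENNReal.ofReal (R ^ (-(Module.finrank ℝ V : ℝ) / p)) * eLpNorm H (ENNReal.ofReal p)) := by
  set m := Module.finrank ℝ V
  set q := p.conjExponent with hq
  have hpq : q.HolderConjugate p := (Real.HolderConjugate.conjExponent hp).symm
  have hq0 : 0 < q := hpq.pos
  have hp0 : 0 < p := by linarith
  have h1 : ‖∫ u, k u * H (x - R • u)‖ₑ ≤ ∫⁻ u, ‖k u‖ₑ * ‖H (x - R • u)‖ₑ := by
    refine (enorm_integral_le_lintegral_enorm _).trans_eq ?_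
    simp_rw [enorm_mul]
  have hHx : Measurable fun u => H (x - R • u) := hHm.comp (by fun_prop)
  have h2 := ENNReal.lintegral_mul_le_Lp_mul_Lq volume hpq hkm.enorm hHx.enorm.aemeasurable
  have h3 : (∫⁻ u, ‖k u‖ₑ ^ q) ^ (1 / q) ≤ ENNReal.ofReal a := by
    have : ∫⁻ u, ‖k u‖ₑ ^ q ≤ ENNReal.ofReal a ^ q := by
      calc ∫⁻ u, ‖k u‖ₑ ^ q = ∫⁻ u, ‖k u‖ₑ ^ (q - 1) * ‖k u‖ₑ := by
            refine lintegral_congr fun u => ?_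
            conv_lhs => rw [show q = (q - 1) + 1 by ring]
            rw [ENNReal.rpow_add_of_nonneg _ _ (by linarith [hpq.lt]) zero_le_one,
              ENNReal.rpow_one]
        _ ≤ ∫⁻ u, ENNReal.ofReal a ^ (q - 1) * ‖k u‖ₑ := by
            refine lintegral_mono fun u => ?_
            refine mul_le_mul_left (ENNReal.rpow_le_rpow ?_ (by linarith [hpq.lt])) _
            rw [← ofReal_norm]
            exact ENNReal.ofReal_le_ofReal (hk u)
        _ ≤ ENNReal.ofReal a ^ (q - 1) * ENNReal.ofReal a := by
            rw [lintegral_const_mul' _ _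
              (ENNReal.rpow_ne_top_of_nonneg (by linarith [hpq.lt]) ENNReal.ofReal_ne_top)]
            gcongr
        _ = ENNReal.ofReal a ^ q := by
            conv_rhs => rw [show q = (q - 1) + 1 by ring]
            rw [ENNReal.rpow_add_of_nonneg _ _ (by linarith [hpq.lt]) zero_le_one,
              ENNReal.rpow_one]
    calc (∫⁻ u, ‖k u‖ₑ ^ q) ^ (1 / q) ≤ (ENNReal.ofReal a ^ q) ^ (1 / q) :=
          ENNReal.rpow_le_rpow this (by positivity)
      _ = ENNReal.ofReal a := by
          rw [← ENNReal.rpow_mul, mul_one_div_cancel hq0.ne', ENNReal.rpow_one]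
  have h4 : (∫⁻ u, ‖H (x - R • u)‖ₑ ^ p) ^ (1 / p)
      = ENNReal.ofReal (R ^ (-(m : ℝ) / p)) * eLpNorm H (ENNReal.ofReal p) := by
    rw [lintegral_comp_sub_smul (F := fun v => ‖H v‖ₑ ^ p) (hHm.enorm.pow_const p) x hR,
      ENNReal.mul_rpow_of_nonneg _ _ (by positivity),
      eLpNorm_eq_lintegral_rpow_enorm_toReal (by simpa using hp0) ENNReal.ofReal_ne_top,
      ENNReal.toReal_ofReal hp0.le]
    congr 1
    rw [ENNReal.ofReal_rpow_of_pos (by positivity)]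
    congr 1
    rw [← Real.rpow_natCast, ← Real.rpow_neg hR.le, ← Real.rpow_mul hR.le]
    congr 1; ring
  refine h1.trans (h2.trans ?_)
  rw [← h4]
  exact mul_le_mul_left h3 _

/-! ### Increments as time integrals of the semigroup. -/

/-- The increments of a function are controlled by the time integral of the increments of the
semigroup applied to `𝓕⁻ (M F)`. -/
lemma norm_increment_le_of_semigroup {ψ M F : V → ℂ} (hψ : Measurable ψ) (hM : Measurable M)
    (hFm : Measurable F) (hF : Integrable F) {δ B : ℝ} {c : ℂ} (hc : c ≠ 0)
    (hM1 : ∀ᵐ ξ, ∫ t in Ioi (0 : ℝ), ((t ^ (δ - 1) : ℝ) : ℂ) * Complex.exp (t * ψ ξ) * M ξ = c)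
    (hMi : ∀ᵐ ξ, IntegrableOn
      (fun t : ℝ => t ^ (δ - 1) * Real.exp (t * (ψ ξ).re) * ‖M ξ‖) (Ioi 0))
    (hM2 : ∀ᵐ ξ, ∫ t in Ioi (0 : ℝ), t ^ (δ - 1) * Real.exp (t * (ψ ξ).re) * ‖M ξ‖ ≤ B)
    {Jb : ℝ → ℝ} {x z : V}
    (hJ : ∀ t : ℝ, 0 < t →
      ‖𝓕⁻ (fun ξ => Complex.exp (t * ψ ξ) * ((expI ξ z - 1) * (M ξ * F ξ))) x‖ ≤ Jb t)
    (hJi : IntegrableOn (fun t => t ^ (δ - 1) * Jb t) (Ioi 0)) :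
    ‖𝓕⁻ F (x + z) - 𝓕⁻ F x‖ ≤ ‖c‖⁻¹ * ∫ t in Ioi (0 : ℝ), t ^ (δ - 1) * Jb t := by
  set H : ℝ → V → ℂ := fun t ξ => ((t ^ (δ - 1) : ℝ) : ℂ) *
    (Complex.exp (t * ψ ξ) * ((expI ξ z - 1) * (M ξ * F ξ))) with hH
  have hexpI : Measurable fun ξ : V => expI ξ z := measurable_expI_comp measurable_id measurable_const
  have hHm : Measurable (Function.uncurry H) := by
    simp only [hH, Function.uncurry_def]
    fun_prop
  have hHn : ∀ t : ℝ, 0 < t → ∀ ξ, ‖H t ξ‖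
      = t ^ (δ - 1) * Real.exp (t * (ψ ξ).re) * ‖M ξ‖ * (‖expI ξ z - 1‖ * ‖F ξ‖) := by
    intro t ht ξ
    have h1 : ‖((t ^ (δ - 1) : ℝ) : ℂ)‖ = t ^ (δ - 1) := by
      rw [Complex.norm_real, Real.norm_of_nonneg (by positivity)]
    have h2 : ‖Complex.exp (t * ψ ξ)‖ = Real.exp (t * (ψ ξ).re) := by
      rw [Complex.norm_exp, Complex.re_ofReal_mul]
    simp only [hH, norm_mul, h1, h2]
    ring
  have hint : Integrable (Function.uncurry H) ((volume.restrict (Ioi (0 : ℝ))).prod volume) := by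
    rw [integrable_prod_iff' hHm.aestronglyMeasurable]
    constructor
    · filter_upwards [hMi] with ξ hξ
      refine (hξ.mul_const (‖expI ξ z - 1‖ * ‖F ξ‖)).mono'
        (hHm.comp (measurable_id.prodMk measurable_const)).aestronglyMeasurable ?_
      filter_upwards [ae_restrict_mem measurableSet_Ioi] with t ht
      exact (hHn t ht ξ).le
    -- The bound `B` on the time integral is uniform in `ξ`, so integrability in `ξ` comes from `F`
    -- alone.
    · refine (hF.norm.const_mul (2 * B)).mono' ?_ ?_
      · exact (hHm.norm.stronglyMeasurable.integral_prod_left'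
          (f := fun q : ℝ × V => ‖Function.uncurry H q‖)).aestronglyMeasurable
      · filter_upwards [hM2] with ξ hξ
        have h1 : ∫ t in Ioi (0 : ℝ), ‖Function.uncurry H (t, ξ)‖
            = (∫ t in Ioi (0 : ℝ), t ^ (δ - 1) * Real.exp (t * (ψ ξ).re) * ‖M ξ‖)
              * (‖expI ξ z - 1‖ * ‖F ξ‖) := by
          rw [← integral_mul_const]
          exact setIntegral_congr_fun measurableSet_Ioi fun t ht => hHn t ht ξ
        have h0 : 0 ≤ ∫ t in Ioi (0 : ℝ), t ^ (δ - 1) * Real.exp (t * (ψ ξ).re) * ‖M ξ‖ :=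
          setIntegral_nonneg measurableSet_Ioi fun t ht => by
            have : (0 : ℝ) < t := ht
            positivity
        rw [Real.norm_of_nonneg (integral_nonneg fun _ => norm_nonneg _), h1]
        calc _ ≤ B * (2 * ‖F ξ‖) := by
              gcongr
              · exact h0.trans hξ
              · exact norm_expI_sub_one_le_two ξ z
          _ = _ := by ring
  -- Fubini read in both orders: integrating in `t` first yields `c` by `hM1`, integrating in `ξ`
  -- first yields the increments of the semigroup.
  have hkey : c * (𝓕⁻ F (x + z) - 𝓕⁻ F x) = ∫ t in Ioi (0 : ℝ), 𝓕⁻ (H t) x := by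
    rw [← fourierInv_translate_sub hF, ← fourierInv_const_mul, ← fourierInv_integral hint x]
    refine Real.fourierInv_congr_ae ?_ x
    filter_upwards [hM1] with ξ hξ
    rw [← hξ, ← integral_mul_const]
    refine integral_congr_ae (Eventually.of_forall fun t => ?_)
    simp only [hH]; ring
  have hle : ‖∫ t in Ioi (0 : ℝ), 𝓕⁻ (H t) x‖ ≤ ∫ t in Ioi (0 : ℝ), t ^ (δ - 1) * Jb t := by
    refine norm_integral_le_of_norm_le hJi ?_
    filter_upwards [ae_restrict_mem measurableSet_Ioi] with t ht
    have ht' : (0 : ℝ) < t := ht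
    simp only [hH]
    rw [fourierInv_const_mul, norm_mul, Complex.norm_real, Real.norm_of_nonneg (by positivity)]
    gcongr
    exact hJ t ht
  rw [← hkey, norm_mul] at hle
  rwa [inv_mul_eq_div, le_div_iff₀' (norm_pos_iff.2 hc)]

/-! ### Scaling functions and the time integral. -/

namespace IsScaling

variable {κ l : ℝ → ℝ}

/-- Intermediate value theorem. `κ` need not be monotone, so `R` is just one solution; any choice
works in what follows. -/
lemma exists_eq (hκ : IsScaling κ l) {t : ℝ} (ht : 0 < t) : ∃ R, 0 < R ∧ κ R = t := by
  obtain ⟨a, hat, ha0⟩ := ((hκ.tendsto_zero.eventually_lt_const ht).and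
    (self_mem_nhdsWithin)).exists
  obtain ⟨b, hbt, hb0⟩ := ((hκ.tendsto_atTop.eventually_gt_atTop t).and
    (eventually_gt_atTop (0 : ℝ))).exists
  have ha0' : (0 : ℝ) < a := ha0
  have hsub : uIcc a b ⊆ Ioi 0 := fun r hr => lt_of_lt_of_le (lt_min ha0' hb0) hr.1
  obtain ⟨R, hR, hRt⟩ := intermediate_value_uIcc (hκ.cont.mono hsub)
    (show t ∈ uIcc (κ a) (κ b) from ⟨(min_le_left _ _).trans hat.le, hbt.le.trans (le_max_right _ _)⟩)
  exact ⟨R, hsub hR, hRt⟩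

/-- The ratio `R / r` competes in the infimum by the scaling inequality. This converts ratios of
times `κ R / κ r` into ratios of lengths. -/
lemma gam_le (hκ : IsScaling κ l) {R r : ℝ} (hR : 0 < R) (hr : 0 < r) :
    gam l (κ R / κ r) ≤ R / r := by
  refine csInf_le ⟨0, fun s hs => hs.1.le⟩ ⟨by positivity, ?_⟩
  have := hκ.scaling (R / r) r (by positivity) hr
  rw [div_mul_cancel₀ _ hr.ne'] at this
  rwa [div_le_iff₀ (hκ.pos r hr)]

/-- Since `l` is monotone and vanishes at `0`, admissible radii stay away from `0`. Nonemptiness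
must be checked too, as `sInf ∅ = 0` on the reals; it holds because `l r ≥ κ r / κ 1` is unbounded.
-/
lemma gam_pos (hκ : IsScaling κ l) {s : ℝ} (hs : 0 < s) : 0 < gam l s := by
  have hev : ∀ᶠ r in 𝓝[>] (0 : ℝ), l r < s := hκ.factor_tendsto.eventually_lt_const hs
  obtain ⟨r0, hr0s, hr0⟩ := (hev.and self_mem_nhdsWithin).exists
  have hr0' : (0 : ℝ) < r0 := hr0
  obtain ⟨R, hR, hRs⟩ := hκ.exists_eq (t := s * κ 1) (mul_pos hs (hκ.pos 1 one_pos))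
  have hne : {r : ℝ | 0 < r ∧ s ≤ l r}.Nonempty := by
    refine ⟨R, hR, ?_⟩
    have := hκ.scaling R 1 hR one_pos
    rw [mul_one, hRs] at this
    exact le_of_mul_le_mul_right this (hκ.pos 1 one_pos)
  refine lt_of_lt_of_le hr0' (le_csInf hne fun r hr => ?_)
  by_contra h
  exact absurd (hκ.factor_mono (show r ∈ Ioi (0 : ℝ) from hr.1) hr0 (not_le.1 h).le)
    (not_le.2 (hr0s.trans_le hr.2))

end IsScaling

/-- The weight that governs the increments at time `s` in units of `κ(|z|)`. -/
def gamWeight (l : ℝ → ℝ) (e s : ℝ) : ℝ := if s ≤ 1 then gam l s ^ (-e) else gam l s ^ (-1 - e)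

lemma integrableOn_gamWeight {l : ℝ → ℝ} {δ e : ℝ}
    (h0 : IntegrableOn (fun t : ℝ => t ^ (δ - 1) * gam l t ^ (-e)) (Ioc 0 1))
    (h1 : IntegrableOn (fun t : ℝ => t ^ (δ - 1) * gam l t ^ (-1 - e)) (Ioi 1)) :
    IntegrableOn (fun s : ℝ => s ^ (δ - 1) * gamWeight l e s) (Ioi 0) := by
  rw [← Ioc_union_Ioi_eq_Ioi (zero_le_one (α := ℝ))]
  refine IntegrableOn.union ?_ ?_
  · refine h0.congr_fun (fun s hs => ?_) measurableSet_Ioc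
    simp [gamWeight, hs.2]
  · refine h1.congr_fun (fun s hs => ?_) measurableSet_Ioi
    simp [gamWeight, not_le.2 (show (1 : ℝ) < s from hs)]

/-- The left side is nonincreasing in `ρ`, which stands for `R / ‖z‖`, so `ρ` may be lowered to `gam
l s`. The bound `1` is kept for `s ≤ 1` and `ρ⁻¹` for `s > 1`, matching the two integrals assumed
finite. -/
lemma min_mul_rpow_le_gamWeight {l : ℝ → ℝ} {e s ρ : ℝ} (he : 0 ≤ e) (hg : 0 < gam l s)
    (hρ : gam l s ≤ ρ) : min 1 ρ⁻¹ * ρ ^ (-e) ≤ gamWeight l e s := by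
  have hρ0 : 0 < ρ := hg.trans_le hρ
  unfold gamWeight
  split_ifs
  · calc min 1 ρ⁻¹ * ρ ^ (-e) ≤ 1 * ρ ^ (-e) := by gcongr; exact min_le_left _ _
      _ ≤ _ := by rw [one_mul]; exact Real.rpow_le_rpow_of_nonpos hg hρ (by linarith)
  · calc min 1 ρ⁻¹ * ρ ^ (-e) ≤ ρ⁻¹ * ρ ^ (-e) := by gcongr; exact min_le_right _ _
      _ = ρ ^ (-1 - e) := by
          rw [← Real.rpow_neg_one, ← Real.rpow_add hρ0]; congr 1
      _ ≤ _ := Real.rpow_le_rpow_of_nonpos hg hρ (by linarith)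

/-- The substitution `t = A s`; with `A = κ ‖z‖` it produces the factor `κ ‖z‖ ^ δ`. -/
lemma integral_rpow_mul_comp_div {w : ℝ → ℝ} {δ A : ℝ} (hA : 0 < A)
    (hw : IntegrableOn (fun s : ℝ => s ^ (δ - 1) * w s) (Ioi 0)) :
    IntegrableOn (fun t : ℝ => t ^ (δ - 1) * w (t / A)) (Ioi 0) ∧
      ∫ t in Ioi (0 : ℝ), t ^ (δ - 1) * w (t / A) = A ^ δ * ∫ s in Ioi (0 : ℝ), s ^ (δ - 1) * w s := by
  have heq : EqOn (fun t : ℝ => A ^ (δ - 1) * ((A⁻¹ * t) ^ (δ - 1) * w (A⁻¹ * t)))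
      (fun t : ℝ => t ^ (δ - 1) * w (t / A)) (Ioi 0) := by
    intro t ht
    have ht' : (0 : ℝ) < t := ht
    simp only
    rw [Real.mul_rpow (by positivity) ht'.le, Real.inv_rpow hA.le, ← div_eq_inv_mul]
    have : A ^ (δ - 1) ≠ 0 := (Real.rpow_pos_of_pos hA _).ne'
    field_simp
  constructor
  · refine IntegrableOn.congr_fun ?_ heq measurableSet_Ioi
    refine Integrable.const_mul ?_ _
    have := (integrableOn_Ioi_comp_mul_left_iff (fun s : ℝ => s ^ (δ - 1) * w s) 0
      (inv_pos.2 hA)).2 (by simpa using hw)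
    exact this
  · rw [← setIntegral_congr_fun measurableSet_Ioi heq, integral_const_mul,
      integral_comp_mul_left_Ioi (fun s : ℝ => s ^ (δ - 1) * w s) 0 (inv_pos.2 hA)]
    rw [mul_zero, inv_inv, smul_eq_mul, ← mul_assoc, Real.rpow_sub_one hA.ne',
      div_mul_cancel₀ _ hA.ne']

/-- At scale `R` the shift by `z` becomes the shift by `w = R⁻¹ • z` of the unit-scale kernel, so
the increment bound for that kernel gives `min 1 (‖z‖ / R)` and Hölder gives the power of `R`. -/
lemma norm_fourierInv_kernel_le {ψ h : V → ℂ} {C p R t : ℝ} (hp : 1 < p) (hR : 0 < R)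
    (hC : 0 < C)
    (hK : KernelBound C fun η : V => Complex.exp (t * ψ (R⁻¹ • η)))
    (hh : Integrable h) (hL : MemLp (𝓕⁻ h) (ENNReal.ofReal p)) (x z : V) :
    ‖𝓕⁻ (fun ξ => Complex.exp (t * ψ ξ) * ((expI ξ z - 1) * h ξ)) x‖
      ≤ C * min 1 (‖z‖ / R) * R ^ (-(Module.finrank ℝ V : ℝ) / p)
        * (eLpNorm (𝓕⁻ h) (ENNReal.ofReal p)).toReal := by
  set G : V → ℂ := fun η : V => Complex.exp (t * ψ (R⁻¹ • η)) with hG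
  set w : V := R⁻¹ • z with hw
  set k : V → ℂ := fun u => 𝓕⁻ G (u + w) - 𝓕⁻ G u with hk
  have hki : Integrable k := (hK.integrable.comp_add_right w).sub hK.integrable
  have hnw : ‖w‖ = ‖z‖ / R := by
    rw [hw, norm_smul, Real.norm_of_nonneg (inv_nonneg.2 hR.le), div_eq_inv_mul]
  have hFk : ∀ η, 𝓕 k η = (expI η w - 1) * G η := by
    intro η
    have h1 : 𝓕 k η = 𝓕 (fun u => 𝓕⁻ G (u + w)) η - 𝓕 (𝓕⁻ G) η := by
      rw [fourier_eq_expI, fourier_eq_expI, fourier_eq_expI, ← integral_sub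
        (integrable_expI_mul (hK.integrable.comp_add_right w) _)
        (integrable_expI_mul hK.integrable _)]
      simp only [hk, mul_sub]
    rw [h1, fourier_translate, hK.fourier_eq]; ring
  have heq : (fun ξ => Complex.exp (t * ψ ξ) * ((expI ξ z - 1) * h ξ))
      = fun ξ => 𝓕 k (R • ξ) * h ξ := by
    funext ξ
    rw [hFk, expI_smul_left, hw, smul_inv_smul₀ hR.ne']
    simp only [hG, inv_smul_smul₀ hR.ne']
    ring
  rw [heq, fourierInv_fourier_smul_mul hki hh]
  have ha : 0 ≤ C * min 1 (‖z‖ / R) := by positivity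
  have hle := enorm_integral_mul_comp_sub_smul_le (k := k) (H := 𝓕⁻ h) (a := C * min 1 (‖z‖ / R))
    hp hR hki.aestronglyMeasurable.aemeasurable
    (continuous_fourierInv hh).measurable (by rw [← hnw]; exact hK.lintegral_sub_le w)
    (fun u => by rw [← hnw]; exact hK.norm_sub_le w u) x
  rw [← ENNReal.ofReal_toReal hL.eLpNorm_ne_top, ← ENNReal.ofReal_mul (by positivity),
    ← ENNReal.ofReal_mul ha, ← ofReal_norm,
    ENNReal.ofReal_le_ofReal_iff (by positivity)] at hle
  refine hle.trans_eq (by ring)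

/-- Abstract form of the increment estimate, for any multiplier `M` whose time integral against the
semigroup is a nonzero constant `c`. It is applied once with the symbol and once with its real part.
-/
theorem exists_norm_increment_le {κ l : ℝ → ℝ} (hκ : IsScaling κ l) {ψ M : V → ℂ}
    (hψ : Measurable ψ) (hM : Measurable M) {C : ℝ} (hC : 0 < C)
    (hK : ∀ R : ℝ, 0 < R → KernelBound C fun η : V => Complex.exp (κ R * ψ (R⁻¹ • η)))
    {δ B p : ℝ} (hp : 1 < p) {c : ℂ} (hc : c ≠ 0)
    (hM1 : ∀ᵐ ξ, ∫ t in Ioi (0 : ℝ), ((t ^ (δ - 1) : ℝ) : ℂ) * Complex.exp (t * ψ ξ) * M ξ = c)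
    (hMi : ∀ᵐ ξ, IntegrableOn
      (fun t : ℝ => t ^ (δ - 1) * Real.exp (t * (ψ ξ).re) * ‖M ξ‖) (Ioi 0))
    (hM2 : ∀ᵐ ξ, ∫ t in Ioi (0 : ℝ), t ^ (δ - 1) * Real.exp (t * (ψ ξ).re) * ‖M ξ‖ ≤ B)
    (hγ0 : IntegrableOn
      (fun t : ℝ => t ^ (δ - 1) * gam l t ^ (-(Module.finrank ℝ V : ℝ) / p)) (Ioc 0 1))
    (hγ1 : IntegrableOn
      (fun t : ℝ => t ^ (δ - 1) * gam l t ^ (-1 - (Module.finrank ℝ V : ℝ) / p)) (Ioi 1)) :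
    ∃ C' : ℝ, 0 ≤ C' ∧ ∀ F : V → ℂ, Measurable F → Integrable F → Integrable (fun ξ => M ξ * F ξ) →
      MemLp (𝓕⁻ fun ξ => M ξ * F ξ) (ENNReal.ofReal p) → ∀ z : V, z ≠ 0 → ∀ x : V,
        ‖𝓕⁻ F (x + z) - 𝓕⁻ F x‖ ≤ C' * κ ‖z‖ ^ δ * ‖z‖ ^ (-(Module.finrank ℝ V : ℝ) / p)
          * (eLpNorm (𝓕⁻ fun ξ => M ξ * F ξ) (ENNReal.ofReal p)).toReal := by
  set e : ℝ := (Module.finrank ℝ V : ℝ) / p with he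
  have he0 : 0 ≤ e := by positivity
  rw [neg_div] at hγ0 ⊢
  have hW := integrableOn_gamWeight hγ0 hγ1
  set W := ∫ s in Ioi (0 : ℝ), s ^ (δ - 1) * gamWeight l e s with hWdef
  have hW0 : 0 ≤ W := by
    refine setIntegral_nonneg measurableSet_Ioi fun s hs => ?_
    have hs' : (0 : ℝ) < s := hs
    have hg := hκ.gam_pos hs'
    have : 0 ≤ gamWeight l e s := by unfold gamWeight; split_ifs <;> positivity
    positivity
  refine ⟨‖c‖⁻¹ * C * W, by positivity, fun F hFm hF hMF hL z hz x => ?_⟩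
  have hz0 : 0 < ‖z‖ := norm_pos_iff.2 hz
  set A := κ ‖z‖ with hA
  have hA0 : 0 < A := hκ.pos _ hz0
  set N := (eLpNorm (𝓕⁻ fun ξ => M ξ * F ξ) (ENNReal.ofReal p)).toReal with hN
  obtain ⟨hWi, hWeq⟩ := integral_rpow_mul_comp_div hA0 hW
  have hJ : ∀ t : ℝ, 0 < t →
      ‖𝓕⁻ (fun ξ => Complex.exp (t * ψ ξ) * ((expI ξ z - 1) * (M ξ * F ξ))) x‖
        ≤ C * ‖z‖ ^ (-e) * N * gamWeight l e (t / A) := by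
    intro t ht
    -- The length `R` attached to the time `t = κ R`.
    obtain ⟨R, hR, rfl⟩ := hκ.exists_eq ht
    have h1 := norm_fourierInv_kernel_le hp hR hC (hK R hR) hMF hL x z
    refine h1.trans ?_
    have h2 := min_mul_rpow_le_gamWeight (l := l) (e := e) he0 (hκ.gam_pos (div_pos ht hA0))
      (hκ.gam_le hR hz0)
    rw [inv_div] at h2
    have h3 : R ^ (-e) = ‖z‖ ^ (-e) * (R / ‖z‖) ^ (-e) := by
      rw [← Real.mul_rpow hz0.le (by positivity), mul_div_cancel₀ _ hz0.ne']
    rw [neg_div, ← he, h3]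
    calc C * min 1 (‖z‖ / R) * (‖z‖ ^ (-e) * (R / ‖z‖) ^ (-e)) * N
        = C * ‖z‖ ^ (-e) * N * (min 1 (‖z‖ / R) * (R / ‖z‖) ^ (-e)) := by ring
      _ ≤ _ := mul_le_mul_of_nonneg_left h2 (by positivity)
  have hJi : IntegrableOn (fun t : ℝ => t ^ (δ - 1)
      * (C * ‖z‖ ^ (-e) * N * gamWeight l e (t / A))) (Ioi 0) := by
    refine (hWi.const_mul (C * ‖z‖ ^ (-e) * N)).congr (Eventually.of_forall fun t => ?_)
    simp only; ring
  refine (norm_increment_le_of_semigroup hψ hM hFm hF hc hM1 hMi hM2 hJ hJi).trans_eq ?_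
  have : ∫ t in Ioi (0 : ℝ), t ^ (δ - 1) * (C * ‖z‖ ^ (-e) * N * gamWeight l e (t / A))
      = C * ‖z‖ ^ (-e) * N * (A ^ δ * W) := by
    rw [← hWeq, ← integral_const_mul]
    refine integral_congr_ae (Eventually.of_forall fun t => ?_)
    simp only; ring
  rw [this]; ring

/-! ### Integrability and continuity of general Lévy exponents. -/

/-- A majorant, up to factors depending on `ξ`, of the Lévy integrand with cut-off `c`. -/
def levyMaj (c : V → ℝ) (y : V) : ℝ :=
  min (‖y‖ ^ 2) 1 + |(if ‖y‖ ≤ 1 then 1 else 0) - c y| * ‖y‖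

lemma levyMaj_nonneg (c : V → ℝ) (y : V) : 0 ≤ levyMaj c y := by
  unfold levyMaj; positivity

/-- For `‖y‖ ≤ 1`, comparison with the fully compensated integrand, which is quadratic; for larger
`y`, the character difference is at most `2`. What remains is the mismatch between `c` and the
unit-ball cut-off. -/
lemma norm_levyKer_le (c : V → ℝ) (ξ y : V) :
    ‖levyKer c ξ y‖ ≤ (2 * Real.pi) ^ 2 * (1 + ‖ξ‖) ^ 2 * levyMaj c y := by
  have hpi := Real.pi_gt_three
  have hξ := norm_nonneg ξ
  have h1 : (1 : ℝ) ≤ 1 + ‖ξ‖ := by linarith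
  have h2π : (2 : ℝ) ≤ 2 * Real.pi := by linarith
  have hin : |inner ℝ ξ y| ≤ ‖ξ‖ * ‖y‖ := abs_real_inner_le_norm ξ y
  have hsecond : ∀ a : ℝ, ‖2 * (Real.pi : ℂ) * Complex.I * ((a * inner ℝ ξ y : ℝ) : ℂ)‖
      ≤ (2 * Real.pi) ^ 2 * (1 + ‖ξ‖) ^ 2 * (|a| * ‖y‖) := by
    intro a
    rw [norm_mul, norm_two_pi_I, Complex.norm_real, Real.norm_eq_abs, abs_mul]
    calc 2 * Real.pi * (|a| * |inner ℝ ξ y|) ≤ 2 * Real.pi * (|a| * (‖ξ‖ * ‖y‖)) := by gcongr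
      _ = 2 * Real.pi * ‖ξ‖ * (|a| * ‖y‖) := by ring
      _ ≤ (2 * Real.pi) ^ 2 * (1 + ‖ξ‖) ^ 2 * (|a| * ‖y‖) := by
        gcongr
        · nlinarith
        · nlinarith
  unfold levyMaj
  rw [mul_add]
  by_cases hy : ‖y‖ ≤ 1
  · have hdec : levyKer c ξ y = levyKer (fun _ => 1) ξ y
        + 2 * (Real.pi : ℂ) * Complex.I * (((1 - c y) * inner ℝ ξ y : ℝ) : ℂ) := by
      unfold levyKer; push_cast; ring
    rw [hdec, if_pos hy, min_eq_left (by nlinarith [norm_nonneg y])]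
    refine (norm_add_le _ _).trans (add_le_add ((norm_levyKer_one_le ξ y).trans ?_) (hsecond _))
    gcongr
    linarith
  · rw [if_neg hy, min_eq_right (by nlinarith), zero_sub, abs_neg]
    unfold levyKer
    refine (norm_sub_le _ _).trans (add_le_add ((norm_expI_sub_one_le_two ξ y).trans ?_)
      (hsecond _))
    nlinarith [mul_le_mul h2π h1 (by norm_num) (by linarith)]

lemma levyPair_of_integrable {c : V → ℝ} (hc : Measurable c) {π : Measure V} (h0 : π {0} = 0)
    (hi : Integrable (levyMaj c) π) : LevyPair c π where
  zero_null := h0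
  finite_off_zero := by
    intro ε hε
    -- Markov's inequality; halving the level makes the inequality strict.
    refine lt_of_le_of_lt (measure_mono fun y hy => ?_)
      (hi.measure_norm_gt_lt_top (ε := min (ε ^ 2) 1 / 2) (by positivity))
    have hy' : ε < ‖y‖ := hy
    simp only [mem_ofPred_eq]
    rw [Real.norm_of_nonneg (levyMaj_nonneg c y)]
    have h2 : min (ε ^ 2) 1 ≤ min (‖y‖ ^ 2) 1 := by gcongr
    have h3 : 0 < min (ε ^ 2) 1 := by positivity
    have h4 : 0 ≤ |(if ‖y‖ ≤ 1 then 1 else 0) - c y| * ‖y‖ := by positivity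
    unfold levyMaj
    linarith
  integrable := fun ξ => (hi.const_mul ((2 * Real.pi) ^ 2 * (1 + ‖ξ‖) ^ 2)).mono'
    (measurable_levyKer hc ξ).aestronglyMeasurable
    (Eventually.of_forall fun y => norm_levyKer_le c ξ y)
  continuous_symb := by
    refine continuous_iff_continuousAt.2 fun ξ => ?_
    refine continuousAt_of_dominated
      (bound := fun y => (2 * Real.pi) ^ 2 * (2 + ‖ξ‖) ^ 2 * levyMaj c y) ?_ ?_
      (hi.const_mul _) ?_
    · exact Eventually.of_forall fun η => (measurable_levyKer hc η).aestronglyMeasurable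
    · filter_upwards [Metric.ball_mem_nhds ξ one_pos] with η hη
      refine Eventually.of_forall fun y => (norm_levyKer_le c η y).trans ?_
      have h1 : ‖η‖ ≤ ‖ξ‖ + 1 := by
        have := norm_le_norm_add_norm_sub' η ξ
        rw [Metric.mem_ball, dist_eq_norm] at hη
        linarith
      have h2 : (1 + ‖η‖) ^ 2 ≤ (2 + ‖ξ‖) ^ 2 :=
        pow_le_pow_left₀ (by positivity) (by linarith) 2
      have := levyMaj_nonneg c y
      gcongr
    · refine Eventually.of_forall fun y => Continuous.continuousAt ?_
      unfold levyKer
      fun_prop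

lemma LevyPair.sigmaFinite {c : V → ℝ} {π : Measure V} (h : LevyPair c π) : SigmaFinite π := by
  refine ⟨⟨⟨fun n : ℕ => {0} ∪ {y | 1 / ((n : ℝ) + 1) < ‖y‖}, fun _ => trivial, fun n => ?_, ?_⟩⟩⟩
  · refine (measure_union_le _ _).trans_lt ?_
    rw [h.zero_null, zero_add]
    exact h.finite_off_zero _ (by positivity)
  · refine eq_univ_of_forall fun y => ?_
    rw [mem_iUnion]
    by_cases hy : y = 0
    · exact ⟨0, Or.inl hy⟩
    · obtain ⟨n, hn⟩ := exists_nat_one_div_lt (norm_pos_iff.2 hy)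
      exact ⟨n, Or.inr hn⟩

/-! ### The generator maps Schwartz functions into `L¹`. -/

section Schwartz

variable (φ : 𝓢(V, ℂ))

lemma lintegral_translate_sub_fderiv_le (y : V) :
    ∫⁻ x, ‖φ (x + y) - φ x - fderiv ℝ φ x y‖ₑ
      ≤ ‖y‖ₑ ^ 2 * ∫⁻ x, ‖fderiv ℝ (fderiv ℝ φ) x‖ₑ := by
  have hcd : ContDiff ℝ 2 φ := φ.smooth 2
  have hc' : ContDiff ℝ 1 (fderiv ℝ φ) := hcd.fderiv_right (by norm_num)
  have hc : Continuous (fderiv ℝ φ) := hc'.continuous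
  have hpt : ∀ x, φ (x + y) - φ x - fderiv ℝ φ x y
      = ∫ s in (0 : ℝ)..1, (fderiv ℝ φ (x + s • y) y - fderiv ℝ φ x y) := by
    intro x
    have hd : ∀ s ∈ uIcc (0 : ℝ) 1, HasDerivAt (fun s : ℝ => φ (x + s • y))
        (fderiv ℝ φ (x + s • y) y) s := by
      intro s _
      have h1 : HasDerivAt (fun s : ℝ => x + s • y) y s := by
        simpa using ((hasDerivAt_id s).smul_const y).const_add x
      exact ((hcd.differentiable two_ne_zero _).hasFDerivAt).comp_hasDerivAt s h1
    rw [intervalIntegral.integral_sub (Continuous.intervalIntegrable (by fun_prop) _ _) (by simp),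
      intervalIntegral.integral_eq_sub_of_hasDerivAt hd
        (Continuous.intervalIntegrable (by fun_prop) _ _)]
    simp
  calc ∫⁻ x, ‖φ (x + y) - φ x - fderiv ℝ φ x y‖ₑ
      ≤ ∫⁻ x, (∫⁻ s in Ioc (0 : ℝ) 1, ‖fderiv ℝ φ (x + s • y) y - fderiv ℝ φ x y‖ₑ) := by
        refine lintegral_mono fun x => ?_
        rw [hpt, intervalIntegral.integral_of_le zero_le_one]
        exact enorm_integral_le_lintegral_enorm _
    _ = ∫⁻ s in Ioc (0 : ℝ) 1, (∫⁻ x, ‖fderiv ℝ φ (x + s • y) y - fderiv ℝ φ x y‖ₑ) := by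
        rw [lintegral_lintegral_swap]
        have : Continuous fun q : V × ℝ => fderiv ℝ φ (q.1 + q.2 • y) y - fderiv ℝ φ q.1 y := by
          fun_prop
        exact this.measurable.enorm.aemeasurable
    _ ≤ ∫⁻ s in Ioc (0 : ℝ) 1, ‖y‖ₑ ^ 2 * ∫⁻ x, ‖fderiv ℝ (fderiv ℝ φ) x‖ₑ := by
        refine setLIntegral_mono measurable_const fun s hs => ?_
        calc ∫⁻ x, ‖fderiv ℝ φ (x + s • y) y - fderiv ℝ φ x y‖ₑ
            ≤ ∫⁻ x, ‖fderiv ℝ φ (x + s • y) - fderiv ℝ φ x‖ₑ * ‖y‖ₑ :=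
              lintegral_mono fun x =>
                (fderiv ℝ φ (x + s • y) - fderiv ℝ φ x).le_opENorm y
          _ = (∫⁻ x, ‖fderiv ℝ φ (x + s • y) - fderiv ℝ φ x‖ₑ) * ‖y‖ₑ :=
              lintegral_mul_const' _ _ enorm_ne_top
          _ ≤ (‖s • y‖ₑ * ∫⁻ x, ‖fderiv ℝ (fderiv ℝ φ) x‖ₑ) * ‖y‖ₑ := by
              gcongr
              exact lintegral_translate_sub_le hc' (s • y)
          _ ≤ (‖y‖ₑ * ∫⁻ x, ‖fderiv ℝ (fderiv ℝ φ) x‖ₑ) * ‖y‖ₑ := by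
              gcongr
              rw [enorm_smul]
              refine mul_le_of_le_one_left' ?_
              rw [Real.enorm_of_nonneg hs.1.le]
              exact ENNReal.ofReal_le_one.2 hs.2
          _ = _ := by ring
    _ = _ := by simp

lemma lintegral_fderiv_lt_top : ∫⁻ x, ‖fderiv ℝ φ x‖ₑ < ∞ :=
  (SchwartzMap.fderivCLM ℝ V ℂ φ).integrable (μ := volume).2

lemma lintegral_fderiv_fderiv_lt_top : ∫⁻ x, ‖fderiv ℝ (fderiv ℝ φ) x‖ₑ < ∞ :=
  (SchwartzMap.fderivCLM ℝ V _ (SchwartzMap.fderivCLM ℝ V ℂ φ)).integrable (μ := volume).2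

end Schwartz

section Schwartz

variable (φ : 𝓢(V, ℂ))

open scoped LineDeriv

lemma fourierInv_inner_mul_fourier (x y : V) :
    𝓕⁻ (fun ξ => 2 * (Real.pi : ℂ) * Complex.I * ((inner ℝ ξ y : ℝ) : ℂ) * 𝓕 (φ : V → ℂ) ξ) x
      = fderiv ℝ φ x y := by
  have hg : (fun ξ : V => inner ℝ ξ y).HasTemperateGrowth := by fun_prop
  have h1 : (fun ξ => 2 * (Real.pi : ℂ) * Complex.I * ((inner ℝ ξ y : ℝ) : ℂ) * 𝓕 (φ : V → ℂ) ξ)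
      = (𝓕 (∂_{y} φ) : 𝓢(V, ℂ)) := by
    funext ξ
    rw [SchwartzMap.fourier_lineDerivOp_eq]
    simp [hg, SchwartzMap.fourier_coe, mul_assoc]
  rw [h1, ← SchwartzMap.fourierInv_coe, FourierTransform.fourierInv_fourier_eq,
    SchwartzMap.lineDerivOp_apply_eq_fderiv]

lemma fourierInv_fourier_schwartz (x : V) : 𝓕⁻ (𝓕 (φ : V → ℂ)) x = φ x := by
  rw [← SchwartzMap.fourier_coe, ← SchwartzMap.fourierInv_coe,
    FourierTransform.fourierInv_fourier_eq]

lemma integrable_fourier_schwartz : Integrable (𝓕 (φ : V → ℂ)) := by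
  rw [← SchwartzMap.fourier_coe]; exact (𝓕 φ).integrable

lemma continuous_fourier_schwartz : Continuous (𝓕 (φ : V → ℂ)) := by
  rw [← SchwartzMap.fourier_coe]; exact (𝓕 φ).continuous

lemma integrable_sq_mul_fourier_schwartz :
    Integrable fun ξ => (1 + ‖ξ‖) ^ 2 * ‖𝓕 (φ : V → ℂ) ξ‖ := by
  have h0 := (𝓕 φ).integrable_pow_mul volume 0
  have h1 := (𝓕 φ).integrable_pow_mul volume 1
  have h2 := (𝓕 φ).integrable_pow_mul volume 2
  rw [SchwartzMap.fourier_coe] at h0 h1 h2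
  refine ((h0.add (h1.const_mul 2)).add h2).congr (Eventually.of_forall fun ξ => ?_)
  simp only [Pi.add_apply]; ring

/-- Translates the symbol back into the integro-differential form of the generator, jump by jump. -/
lemma fourierInv_levyKer_mul_fourier (c : V → ℝ) (x y : V) :
    𝓕⁻ (fun ξ => levyKer c ξ y * 𝓕 (φ : V → ℂ) ξ) x
      = φ (x + y) - φ x - c y * fderiv ℝ φ x y := by
  set F := 𝓕 (φ : V → ℂ) with hF
  have hFi : Integrable F := integrable_fourier_schwartz φ
  have hGi : Integrable fun ξ => 2 * (Real.pi : ℂ) * Complex.I * ((inner ℝ ξ y : ℝ) : ℂ) * F ξ := by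
    refine ((integrable_sq_mul_fourier_schwartz φ).const_mul (2 * Real.pi * ‖y‖)).mono' ?_ ?_
    · have := continuous_fourier_schwartz φ
      exact Continuous.aestronglyMeasurable (by fun_prop)
    · refine Eventually.of_forall fun ξ => ?_
      rw [norm_mul, norm_mul, norm_two_pi_I, Complex.norm_real, Real.norm_eq_abs]
      have h1 : |inner ℝ ξ y| ≤ (1 + ‖ξ‖) ^ 2 * ‖y‖ := by
        refine (abs_real_inner_le_norm ξ y).trans ?_
        gcongr
        nlinarith [norm_nonneg ξ]
      calc 2 * Real.pi * |inner ℝ ξ y| * ‖F ξ‖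
          ≤ 2 * Real.pi * ((1 + ‖ξ‖) ^ 2 * ‖y‖) * ‖F ξ‖ := by gcongr
        _ = _ := by ring
  have h1 : φ (x + y) - φ x = 𝓕⁻ (fun ξ => (expI ξ y - 1) * F ξ) x := by
    rw [fourierInv_translate_sub hFi, fourierInv_fourier_schwartz, fourierInv_fourier_schwartz]
  rw [h1, ← fourierInv_inner_mul_fourier, ← hF, ← fourierInv_const_mul, fourierInv_eq_expI,
    fourierInv_eq_expI, fourierInv_eq_expI, ← integral_sub]
  · refine integral_congr_ae (Eventually.of_forall fun ξ => ?_)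
    simp only [levyKer]; push_cast; ring
  · refine integrable_expI_mul ?_ x
    refine ((integrable_expI_mul hFi y).sub hFi).congr (Eventually.of_forall fun ξ => ?_)
    simp only [Pi.sub_apply]; ring
  · exact integrable_expI_mul (hGi.const_mul _) x

/-- Second-order Taylor expansion in `L¹` for small jumps, the triangle inequality for large ones;
the majorant is the one integrable against the Lévy measure. -/
lemma exists_lintegral_fourierInv_levyKer_le :
    ∃ K : ℝ≥0∞, K < ∞ ∧ ∀ (c : V → ℝ) (y : V),
      ∫⁻ x, ‖𝓕⁻ (fun ξ => levyKer c ξ y * 𝓕 (φ : V → ℂ) ξ) x‖ₑ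
        ≤ K * ENNReal.ofReal (levyMaj c y) := by
  set I₀ := ∫⁻ x, ‖φ x‖ₑ with hI₀
  set I₁ := ∫⁻ x, ‖fderiv ℝ φ x‖ₑ with hI₁
  set I₂ := ∫⁻ x, ‖fderiv ℝ (fderiv ℝ φ) x‖ₑ with hI₂
  have h0 : I₀ < ∞ := (φ.integrable (μ := volume)).2
  have h1 : I₁ < ∞ := lintegral_fderiv_lt_top φ
  have h2 : I₂ < ∞ := lintegral_fderiv_fderiv_lt_top φ
  have hm : Continuous (fderiv ℝ φ) := (φ.smooth 1).continuous_fderiv one_ne_zero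
  have hφ : Continuous φ := φ.continuous
  have hlin : ∀ (a : ℝ) (y : V), ∫⁻ x, ‖(a : ℂ) * fderiv ℝ φ x y‖ₑ
      ≤ I₁ * ENNReal.ofReal (|a| * ‖y‖) := by
    intro a y
    calc ∫⁻ x, ‖(a : ℂ) * fderiv ℝ φ x y‖ₑ
        ≤ ∫⁻ x, ‖fderiv ℝ φ x‖ₑ * ENNReal.ofReal (|a| * ‖y‖) := by
          refine lintegral_mono fun x => ?_
          rw [enorm_mul, ENNReal.ofReal_mul (abs_nonneg _), ofReal_norm, ← Real.norm_eq_abs,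
            ofReal_norm, mul_left_comm]
          have : ‖(a : ℂ)‖ₑ = ‖a‖ₑ := by
            rw [← ofReal_norm, ← ofReal_norm, Complex.norm_real]
          rw [this]
          gcongr
          exact (fderiv ℝ φ x).le_opENorm y
      _ = _ := by rw [lintegral_mul_const' _ _ ENNReal.ofReal_ne_top]
  refine ⟨I₂ + 2 * I₀ + I₁, by finiteness, fun c y => ?_⟩
  simp_rw [fourierInv_levyKer_mul_fourier]
  rw [levyMaj, ENNReal.ofReal_add (by positivity) (by positivity), mul_add]
  by_cases hy : ‖y‖ ≤ 1
  · rw [if_pos hy, min_eq_left (by nlinarith [norm_nonneg y])]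
    calc ∫⁻ x, ‖φ (x + y) - φ x - c y * fderiv ℝ φ x y‖ₑ
        ≤ ∫⁻ x, (‖φ (x + y) - φ x - fderiv ℝ φ x y‖ₑ + ‖((1 - c y : ℝ) : ℂ) * fderiv ℝ φ x y‖ₑ) := by
          refine lintegral_mono fun x => ?_
          refine le_trans (le_of_eq ?_) (enorm_add_le _ _)
          congr 1; push_cast; ring
      _ = (∫⁻ x, ‖φ (x + y) - φ x - fderiv ℝ φ x y‖ₑ)
          + ∫⁻ x, ‖((1 - c y : ℝ) : ℂ) * fderiv ℝ φ x y‖ₑ := by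
          refine lintegral_add_left ?_ _
          exact (Continuous.measurable (by fun_prop)).enorm
      _ ≤ I₂ * ENNReal.ofReal (‖y‖ ^ 2) + I₁ * ENNReal.ofReal (|1 - c y| * ‖y‖) := by
          refine add_le_add ?_ (hlin _ _)
          refine (lintegral_translate_sub_fderiv_le φ y).trans_eq ?_
          rw [ENNReal.ofReal_pow (norm_nonneg _), ofReal_norm, mul_comm]
      _ ≤ _ := by
          gcongr
          · rw [add_assoc]; exact le_self_add
          · exact le_add_self
  · rw [if_neg hy, min_eq_right (by nlinarith), zero_sub, abs_neg]
    calc ∫⁻ x, ‖φ (x + y) - φ x - c y * fderiv ℝ φ x y‖ₑ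
        ≤ ∫⁻ x, (‖φ (x + y)‖ₑ + ‖φ x‖ₑ + ‖(c y : ℂ) * fderiv ℝ φ x y‖ₑ) := by
          refine lintegral_mono fun x => (enorm_sub_le).trans ?_
          gcongr
          exact enorm_sub_le
      _ = I₀ + I₀ + ∫⁻ x, ‖(c y : ℂ) * fderiv ℝ φ x y‖ₑ := by
          rw [lintegral_add_left, lintegral_add_left,
            lintegral_add_right_eq_self (fun x => ‖φ x‖ₑ) y]
          · exact (Continuous.measurable (by fun_prop)).enorm
          · exact (Continuous.measurable (by fun_prop)).enorm.add hφ.measurable.enorm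
      _ ≤ 2 * I₀ + I₁ * ENNReal.ofReal (|c y| * ‖y‖) := by
          rw [two_mul]; gcongr; exact hlin _ _
      _ ≤ _ := by
          rw [ENNReal.ofReal_one, mul_one]
          gcongr
          · rw [add_comm I₂, add_assoc]; exact le_self_add
          · exact le_add_self

/-- Minkowski's inequality over the jumps, with the `L¹` bound of each jump controlled by `levyMaj`.
-/
lemma integrable_symb_mul_fourier {c : V → ℝ} (hc : Measurable c) {π : Measure V}
    (h0 : π {0} = 0) (hi : Integrable (levyMaj c) π) :
    Integrable (fun ξ => symb c π ξ * 𝓕 (φ : V → ℂ) ξ) ∧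
      ∫⁻ x, ‖𝓕⁻ (fun ξ => symb c π ξ * 𝓕 (φ : V → ℂ) ξ) x‖ₑ < ∞ := by
  have hp := levyPair_of_integrable hc h0 hi
  have := hp.sigmaFinite
  set F := 𝓕 (φ : V → ℂ) with hF
  have hFc : Continuous F := continuous_fourier_schwartz φ
  have hmk : Measurable fun q : V × V => levyKer c q.2 q.1 := by
    have h1 : Measurable fun q : V × V => expI q.2 q.1 :=
      measurable_expI_comp measurable_snd measurable_fst
    have h2 : Measurable fun q : V × V => c q.1 := hc.comp measurable_fst
    have h3 : Measurable fun q : V × V => (inner ℝ q.2 q.1 : ℝ) :=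
      Continuous.measurable (by fun_prop)
    unfold levyKer
    fun_prop
  have hsm : StronglyMeasurable (Function.uncurry fun y ξ : V => levyKer c ξ y * F ξ) :=
    (hmk.mul (hFc.measurable.comp measurable_snd)).stronglyMeasurable
  have hint : Integrable (Function.uncurry fun y ξ : V => levyKer c ξ y * F ξ)
      (π.prod volume) := by
    have h1 := hi.mul_prod ((integrable_sq_mul_fourier_schwartz φ).const_mul ((2 * Real.pi) ^ 2))
    refine h1.mono' hsm.aestronglyMeasurable (Eventually.of_forall fun q => ?_)
    simp only [Function.uncurry, norm_mul]
    calc ‖levyKer c q.2 q.1‖ * ‖F q.2‖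
        ≤ ((2 * Real.pi) ^ 2 * (1 + ‖q.2‖) ^ 2 * levyMaj c q.1) * ‖F q.2‖ := by
          gcongr; exact norm_levyKer_le _ _ _
      _ = _ := by ring
  have hsy : ∀ ξ, ∫ y, levyKer c ξ y * F ξ ∂π = symb c π ξ * F ξ := fun ξ => by
    rw [integral_mul_const, symb]
  constructor
  · refine hint.integral_prod_right.congr (Eventually.of_forall fun ξ => ?_)
    exact hsy ξ
  · have h1 := lintegral_fourierInv_integral_le hsm hint
    simp only [hsy] at h1
    obtain ⟨K, hK, hKb⟩ := exists_lintegral_fourierInv_levyKer_le φ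
    refine h1.trans_lt ((lintegral_mono fun y => hKb c y).trans_lt ?_)
    rw [lintegral_const_mul' _ _ hK.ne]
    refine ENNReal.mul_lt_top hK ?_
    have := hi.2
    rw [hasFiniteIntegral_iff_ofReal (Eventually.of_forall fun y => levyMaj_nonneg c y)] at this
    exact this

end Schwartz

/-! ### Fractional powers by stable subordination. -/

/-- The density of the Lévy measure of the `δ`-stable subordinator, up to a constant. -/
def stableWeight (δ s : ℝ) : ℝ := if 0 < s then s ^ (-δ - 1) else 0

lemma stableWeight_nonneg (δ s : ℝ) : 0 ≤ stableWeight δ s := by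
  unfold stableWeight; split_ifs with h
  · positivity
  · exact le_rfl

lemma measurable_stableWeight (δ : ℝ) : Measurable (stableWeight δ) :=
  Measurable.ite measurableSet_Ioi (by fun_prop) measurable_const

lemma stableWeight_eq_indicator (δ : ℝ) (g : ℝ → ℝ) :
    (fun s => stableWeight δ s * g s) = (Ioi 0).indicator fun s => s ^ (-δ - 1) * g s := by
  funext s
  by_cases h : 0 < s <;> simp [stableWeight, h, indicator]

lemma integrable_stableWeight_mul_min {δ : ℝ} (h0 : 0 < δ) (h1 : δ < 1) :
    Integrable fun s => stableWeight δ s * min s 1 := by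
  rw [stableWeight_eq_indicator, integrable_indicator_iff measurableSet_Ioi,
    ← Ioc_union_Ioi_eq_Ioi (zero_le_one (α := ℝ))]
  refine IntegrableOn.union ?_ ?_
  · have : IntegrableOn (fun s : ℝ => s ^ (-δ)) (Ioc 0 1) := by
      have := (intervalIntegral.intervalIntegrable_rpow' (a := 0) (b := 1) (r := -δ) (by linarith)).1
      exact this
    refine this.congr_fun (fun s hs => ?_) measurableSet_Ioc
    simp only [min_eq_left hs.2]
    conv_rhs => rw [← Real.rpow_one s, ← Real.rpow_mul hs.1.le, one_mul]
    rw [← Real.rpow_add hs.1]; congr 1; ring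
  · refine (integrableOn_Ioi_rpow_of_lt (a := -δ - 1) (by linarith) one_pos).congr_fun
      (fun s hs => ?_) measurableSet_Ioi
    simp [min_eq_right (le_of_lt (show (1 : ℝ) < s from hs))]

lemma one_sub_exp_neg_le {s a : ℝ} (hs : 0 ≤ s) (ha : 0 ≤ a) :
    1 - Real.exp (-(s * a)) ≤ min s 1 * (1 + a) := by
  have h1 := Real.add_one_le_exp (-(s * a))
  have h2 := Real.exp_pos (-(s * a))
  rcases le_total s 1 with h | h
  · rw [min_eq_left h]; nlinarith
  · rw [min_eq_right h]; nlinarith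

lemma one_sub_exp_neg_nonneg {s a : ℝ} (hs : 0 ≤ s) (ha : 0 ≤ a) :
    0 ≤ 1 - Real.exp (-(s * a)) := by
  have : 0 ≤ s * a := by positivity
  have := Real.exp_le_one_iff.2 (show -(s * a) ≤ 0 by linarith)
  linarith

/-- The normalizing constant of the `δ`-stable subordinator. -/
def stableConst (δ : ℝ) : ℝ := ∫ s, stableWeight δ s * (1 - Real.exp (-s))

lemma integrable_stableWeight_mul_one_sub_exp {δ : ℝ} (h0 : 0 < δ) (h1 : δ < 1) :
    Integrable fun s => stableWeight δ s * (1 - Real.exp (-s)) := by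
  refine ((integrable_stableWeight_mul_min h0 h1).const_mul 2).mono' ?_ ?_
  · exact ((measurable_stableWeight δ).mul (by fun_prop)).aestronglyMeasurable
  · refine Eventually.of_forall fun s => ?_
    rcases le_or_gt s 0 with hs | hs
    · simp [stableWeight, not_lt.2 hs]
    · have h3 := one_sub_exp_neg_le hs.le zero_le_one
      have h4 := one_sub_exp_neg_nonneg hs.le zero_le_one
      rw [mul_one] at h3 h4
      rw [norm_mul, Real.norm_of_nonneg h4, Real.norm_of_nonneg (stableWeight_nonneg δ s)]
      nlinarith [mul_le_mul_of_nonneg_left h3 (stableWeight_nonneg δ s)]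

lemma stableConst_pos {δ : ℝ} (h0 : 0 < δ) (h1 : δ < 1) : 0 < stableConst δ := by
  have hn : ∀ s, 0 ≤ stableWeight δ s * (1 - Real.exp (-s)) := fun s => by
    rcases le_or_gt s 0 with hs | hs
    · simp [stableWeight, not_lt.2 hs]
    · have := one_sub_exp_neg_nonneg hs.le zero_le_one
      rw [mul_one] at this
      exact mul_nonneg (stableWeight_nonneg δ s) this
  rw [stableConst, integral_pos_iff_support_of_nonneg hn
    (integrable_stableWeight_mul_one_sub_exp h0 h1)]
  refine lt_of_lt_of_le ?_ (measure_mono (s := Ioi 0) fun s hs => ?_)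
  · simp
  · have hs' : (0 : ℝ) < s := hs
    have : Real.exp (-s) < 1 := by rw [Real.exp_lt_one_iff]; linarith
    have h2 := Real.rpow_pos_of_pos hs' (-δ - 1)
    simp only [Function.mem_support, stableWeight, if_pos hs']
    exact (mul_pos h2 (by linarith)).ne'

/-- Homogeneity: rescaling `s` by `a` extracts `a ^ δ` from the integral defining `stableConst`. -/
lemma integral_stableWeight_mul {δ a : ℝ} (h0 : 0 < δ) (h1 : δ < 1) (ha : 0 ≤ a) :
    ∫ s, stableWeight δ s * (1 - Real.exp (-(s * a))) = stableConst δ * a ^ δ := by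
  rcases ha.eq_or_lt with rfl | ha
  · simp [Real.zero_rpow h0.ne']
  · have hw : IntegrableOn (fun s : ℝ => s ^ (-δ - 1) * (1 - Real.exp (-s))) (Ioi 0) := by
      have := integrable_stableWeight_mul_one_sub_exp h0 h1
      rwa [stableWeight_eq_indicator, integrable_indicator_iff measurableSet_Ioi] at this
    have h2 := (integral_rpow_mul_comp_div (δ := -δ) (w := fun s => 1 - Real.exp (-s))
      (inv_pos.2 ha) hw).2
    rw [stableConst, stableWeight_eq_indicator, stableWeight_eq_indicator,
      integral_indicator measurableSet_Ioi, integral_indicator measurableSet_Ioi]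
    simp only [div_inv_eq_mul] at h2
    rw [h2, Real.inv_rpow ha.le, Real.rpow_neg ha.le, inv_inv, mul_comm]

section Subordination

variable {a : V → ℝ} {F : V → ℂ} {C : ℝ≥0∞}

/-- For `s ≤ 1`, `1 - e^(-sa)` is the integral of `a e^(-ra)` over `(0, s]`, which gains a factor
`s`; for `s ≥ 1` the two terms are bounded separately. The resulting `min s 1` is integrable against
the stable density. -/
lemma lintegral_fourierInv_one_sub_exp_mul_le (ham : Measurable a) (ha : ∀ ξ, 0 ≤ a ξ)
    (hFm : Measurable F) (hF : Integrable F) (haF : Integrable fun ξ => (a ξ : ℂ) * F ξ)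
    (hS : ∀ s : ℝ, 0 < s → ∀ h : V → ℂ, StronglyMeasurable h → Integrable h →
      ∫⁻ x, ‖𝓕⁻ (fun ξ => (Real.exp (-(s * a ξ)) : ℂ) * h ξ) x‖ₑ ≤ C * ∫⁻ x, ‖𝓕⁻ h x‖ₑ)
    {s : ℝ} (hs : 0 < s) :
    ∫⁻ x, ‖𝓕⁻ (fun ξ => ((1 - Real.exp (-(s * a ξ)) : ℝ) : ℂ) * F ξ) x‖ₑ
      ≤ ENNReal.ofReal (min s 1) * ((1 + C) * (∫⁻ x, ‖𝓕⁻ F x‖ₑ)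
        + C * ∫⁻ x, ‖𝓕⁻ (fun ξ => (a ξ : ℂ) * F ξ) x‖ₑ) := by
  rcases le_total s 1 with h | h
  · rw [min_eq_left h]
    set H : ℝ → V → ℂ := fun r ξ => (Real.exp (-(r * a ξ)) : ℂ) * ((a ξ : ℂ) * F ξ) with hH
    have hHm : Measurable (Function.uncurry H) := by
      have h1 : Measurable fun q : ℝ × V => a q.2 := ham.comp measurable_snd
      have h2 : Measurable fun q : ℝ × V => F q.2 := hFm.comp measurable_snd
      simp only [hH, Function.uncurry_def]
      fun_prop
    have hHi : Integrable (Function.uncurry H) ((volume.restrict (Ioc 0 s)).prod volume) := by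
      have h1 := (integrable_const (1 : ℂ) (μ := volume.restrict (Ioc 0 s))).mul_prod haF
      refine h1.mono hHm.aestronglyMeasurable ?_
      have h2 : ∀ᵐ q ∂((volume.restrict (Ioc 0 s)).prod (volume : Measure V)), q.1 ∈ Ioc 0 s :=
        Measure.quasiMeasurePreserving_fst.ae (ae_restrict_mem measurableSet_Ioc)
      filter_upwards [h2] with q hq
      simp only [Function.uncurry, hH, norm_mul, one_mul]
      refine mul_le_of_le_one_left (by positivity) ?_
      rw [Complex.norm_real, Real.norm_of_nonneg (Real.exp_pos _).le]
      have := mul_nonneg hq.1.le (ha q.2)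
      exact Real.exp_le_one_iff.2 (by linarith)
    have hint : ∀ ξ, ∫ r in Ioc 0 s, H r ξ = ((1 - Real.exp (-(s * a ξ)) : ℝ) : ℂ) * F ξ := by
      intro ξ
      have hd : ∀ r ∈ uIcc (0 : ℝ) s, HasDerivAt (fun r => -Real.exp (-(r * a ξ)))
          (Real.exp (-(r * a ξ)) * a ξ) r := by
        intro r _
        have h5 : HasDerivAt (fun r => -(r * a ξ)) (-(1 * a ξ)) r :=
          ((hasDerivAt_id r).mul_const (a ξ)).fun_neg
        exact h5.exp.fun_neg.congr_deriv (by ring)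
      have h3 := intervalIntegral.integral_eq_sub_of_hasDerivAt hd
        (Continuous.intervalIntegrable (by fun_prop) _ _)
      rw [intervalIntegral.integral_of_le hs.le] at h3
      have h4 : ∀ r, H r ξ = ((Real.exp (-(r * a ξ)) * a ξ : ℝ) : ℂ) * F ξ := by
        intro r; simp only [hH]; push_cast; ring
      simp_rw [h4]
      rw [integral_mul_const, integral_complex_ofReal, h3]
      congr 2; simp; ring
    have h1 := lintegral_fourierInv_integral_le hHm.stronglyMeasurable hHi
    simp only [hint] at h1
    refine h1.trans ?_
    calc ∫⁻ r in Ioc 0 s, (∫⁻ x, ‖𝓕⁻ (H r) x‖ₑ)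
        ≤ ∫⁻ r in Ioc 0 s, C * ∫⁻ x, ‖𝓕⁻ (fun ξ => (a ξ : ℂ) * F ξ) x‖ₑ := by
          refine setLIntegral_mono measurable_const fun r hr => ?_
          refine hS r hr.1 _ ?_ haF
          exact Measurable.stronglyMeasurable (by fun_prop)
      _ = ENNReal.ofReal s * (C * ∫⁻ x, ‖𝓕⁻ (fun ξ => (a ξ : ℂ) * F ξ) x‖ₑ) := by
          rw [lintegral_const, Measure.restrict_apply_univ, Real.volume_Ioc, sub_zero, mul_comm]
      _ ≤ _ := by gcongr; exact le_add_self
  · rw [min_eq_right h, ENNReal.ofReal_one, one_mul]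
    have hEm : Measurable fun ξ => (Real.exp (-(s * a ξ)) : ℂ) * F ξ := by fun_prop
    have hE : Integrable fun ξ => (Real.exp (-(s * a ξ)) : ℂ) * F ξ := by
      refine hF.mono hEm.aestronglyMeasurable (Eventually.of_forall fun ξ => ?_)
      rw [norm_mul]
      refine mul_le_of_le_one_left (by positivity) ?_
      rw [Complex.norm_real, Real.norm_of_nonneg (Real.exp_pos _).le]
      have := mul_nonneg hs.le (ha ξ)
      exact Real.exp_le_one_iff.2 (by linarith)
    have hpt : ∀ x, 𝓕⁻ (fun ξ => ((1 - Real.exp (-(s * a ξ)) : ℝ) : ℂ) * F ξ) x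
        = 𝓕⁻ F x - 𝓕⁻ (fun ξ => (Real.exp (-(s * a ξ)) : ℂ) * F ξ) x := by
      intro x
      rw [fourierInv_eq_expI, fourierInv_eq_expI, fourierInv_eq_expI,
        ← integral_sub (integrable_expI_mul hF x) (integrable_expI_mul hE x)]
      refine integral_congr_ae (Eventually.of_forall fun ξ => ?_)
      simp only; push_cast; ring
    simp_rw [hpt]
    calc ∫⁻ x, ‖𝓕⁻ F x - 𝓕⁻ (fun ξ => (Real.exp (-(s * a ξ)) : ℂ) * F ξ) x‖ₑ
        ≤ ∫⁻ x, (‖𝓕⁻ F x‖ₑ + ‖𝓕⁻ (fun ξ => (Real.exp (-(s * a ξ)) : ℂ) * F ξ) x‖ₑ) :=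
          lintegral_mono fun x => enorm_sub_le
      _ = (∫⁻ x, ‖𝓕⁻ F x‖ₑ) + ∫⁻ x, ‖𝓕⁻ (fun ξ => (Real.exp (-(s * a ξ)) : ℂ) * F ξ) x‖ₑ :=
          lintegral_add_left (continuous_fourierInv hF).measurable.enorm _
      _ ≤ (∫⁻ x, ‖𝓕⁻ F x‖ₑ) + C * ∫⁻ x, ‖𝓕⁻ F x‖ₑ := by
          gcongr
          exact hS s hs F hFm.stronglyMeasurable hF
      _ ≤ _ := by rw [add_mul, one_mul]; exact le_self_add

/-- Fractional powers of a generator map into `L¹` whatever the generator maps into `L¹`. -/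
theorem lintegral_fourierInv_rpow_mul_lt_top {δ : ℝ} (h0 : 0 < δ) (h1 : δ < 1)
    (ham : Measurable a) (ha : ∀ ξ, 0 ≤ a ξ)
    (hFm : Measurable F) (hF : Integrable F) (haF : Integrable fun ξ => (a ξ : ℂ) * F ξ)
    (hC : C < ∞)
    (hS : ∀ s : ℝ, 0 < s → ∀ h : V → ℂ, StronglyMeasurable h → Integrable h →
      ∫⁻ x, ‖𝓕⁻ (fun ξ => (Real.exp (-(s * a ξ)) : ℂ) * h ξ) x‖ₑ ≤ C * ∫⁻ x, ‖𝓕⁻ h x‖ₑ)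
    (hF1 : ∫⁻ x, ‖𝓕⁻ F x‖ₑ < ∞) (haF1 : ∫⁻ x, ‖𝓕⁻ (fun ξ => (a ξ : ℂ) * F ξ) x‖ₑ < ∞) :
    ∫⁻ x, ‖𝓕⁻ (fun ξ => ((a ξ ^ δ : ℝ) : ℂ) * F ξ) x‖ₑ < ∞ := by
  -- Up to the constant `stableConst δ`, the power `a ^ δ` is the average of `1 - e^(-sa)` against
  -- the stable density; Minkowski is applied to that average.
  set H : ℝ → V → ℂ := fun s ξ =>
    (stableWeight δ s : ℂ) * (((1 - Real.exp (-(s * a ξ)) : ℝ) : ℂ) * F ξ) with hH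
  have hHm : Measurable (Function.uncurry H) := by
    have h1 : Measurable fun q : ℝ × V => a q.2 := ham.comp measurable_snd
    have h2 : Measurable fun q : ℝ × V => F q.2 := hFm.comp measurable_snd
    have h3 : Measurable fun q : ℝ × V => stableWeight δ q.1 :=
      (measurable_stableWeight δ).comp measurable_fst
    simp only [hH, Function.uncurry_def]
    fun_prop
  have hHi : Integrable (Function.uncurry H) (volume.prod volume) := by
    have h2 := (integrable_stableWeight_mul_min h0 h1).mul_prod (hF.norm.add haF.norm)
    refine h2.mono' hHm.aestronglyMeasurable (Eventually.of_forall fun q => ?_)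
    simp only [Function.uncurry, hH, norm_mul, Complex.norm_real, Pi.add_apply]
    rw [Real.norm_of_nonneg (stableWeight_nonneg δ q.1), Real.norm_of_nonneg (ha q.2)]
    rcases le_or_gt q.1 0 with hs | hs
    · simp [stableWeight, not_lt.2 hs]
    · rw [Real.norm_of_nonneg (one_sub_exp_neg_nonneg hs.le (ha q.2)), mul_assoc]
      refine mul_le_mul_of_nonneg_left ?_ (stableWeight_nonneg δ q.1)
      calc (1 - Real.exp (-(q.1 * a q.2))) * ‖F q.2‖
          ≤ (min q.1 1 * (1 + a q.2)) * ‖F q.2‖ := by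
            gcongr; exact one_sub_exp_neg_le hs.le (ha q.2)
        _ = _ := by ring
  have hint : ∀ ξ, ∫ s, H s ξ = (stableConst δ : ℂ) * (((a ξ ^ δ : ℝ) : ℂ) * F ξ) := by
    intro ξ
    have h3 : ∀ s, H s ξ = ((stableWeight δ s * (1 - Real.exp (-(s * a ξ))) : ℝ) : ℂ) * F ξ := by
      intro s; simp only [hH]; push_cast; ring
    simp_rw [h3]
    rw [integral_mul_const, integral_complex_ofReal, integral_stableWeight_mul h0 h1 (ha ξ)]
    push_cast; ring
  have h2 := lintegral_fourierInv_integral_le hHm.stronglyMeasurable hHi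
  simp only [hint, fourierInv_const_mul, enorm_mul] at h2
  rw [lintegral_const_mul' _ _ enorm_ne_top] at h2
  have hne : ‖(stableConst δ : ℂ)‖ₑ ≠ 0 := by
    simpa using (stableConst_pos h0 h1).ne'
  refine ENNReal.lt_top_of_mul_ne_top_right (ne_of_lt (h2.trans_lt ?_)) hne
  set D := (1 + C) * (∫⁻ x, ‖𝓕⁻ F x‖ₑ) + C * ∫⁻ x, ‖𝓕⁻ (fun ξ => (a ξ : ℂ) * F ξ) x‖ₑ with hD
  have hDt : D < ∞ := by
    refine ENNReal.add_lt_top.2 ⟨ENNReal.mul_lt_top (by finiteness) hF1, ENNReal.mul_lt_top hC haF1⟩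
  calc ∫⁻ s, (∫⁻ x, ‖𝓕⁻ (H s) x‖ₑ)
      ≤ ∫⁻ s, ENNReal.ofReal (stableWeight δ s * min s 1) * D := by
        refine lintegral_mono fun s => ?_
        simp only [hH, fourierInv_const_mul, enorm_mul]
        rw [lintegral_const_mul' _ _ enorm_ne_top, ENNReal.ofReal_mul (stableWeight_nonneg δ s),
          ← ofReal_norm, Complex.norm_real, Real.norm_of_nonneg (stableWeight_nonneg δ s), mul_assoc]
        rcases le_or_gt s 0 with hs | hs
        · simp [stableWeight, not_lt.2 hs]
        · gcongr
          exact lintegral_fourierInv_one_sub_exp_mul_le ham ha hFm hF haF hS hs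
    _ = (∫⁻ s, ENNReal.ofReal (stableWeight δ s * min s 1)) * D :=
        lintegral_mul_const' _ _ hDt.ne
    _ < ∞ := ENNReal.mul_lt_top ((lintegral_mono fun s => Real.ofReal_le_enorm _).trans_lt
        (integrable_stableWeight_mul_min h0 h1).2) hDt

end Subordination

/-- The inverse Fourier transform of an integrable function lies in every `Lᵖ` once it lies in
`L¹`. -/
lemma memLp_fourierInv {h : V → ℂ} (hh : Integrable h) (hL : ∫⁻ x, ‖𝓕⁻ h x‖ₑ < ∞) {p : ℝ}
    (hp : 1 < p) : MemLp (𝓕⁻ h) (ENNReal.ofReal p) := by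
  have hm := (continuous_fourierInv hh).aestronglyMeasurable (μ := volume)
  have hp0 : 0 < p := by linarith
  refine ⟨hm, ?_⟩
  rw [eLpNorm_lt_top_iff_lintegral_rpow_enorm_lt_top (by simpa using hp0) ENNReal.ofReal_ne_top,
    ENNReal.toReal_ofReal hp0.le]
  set M := ENNReal.ofReal (∫ ξ, ‖h ξ‖) with hM
  calc ∫⁻ x, ‖𝓕⁻ h x‖ₑ ^ p ≤ ∫⁻ x, M ^ (p - 1) * ‖𝓕⁻ h x‖ₑ := by
        refine lintegral_mono fun x => ?_
        have h1 : ‖𝓕⁻ h x‖ₑ ^ p = ‖𝓕⁻ h x‖ₑ ^ (p - 1) * ‖𝓕⁻ h x‖ₑ := by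
          conv_lhs => rw [show p = (p - 1) + 1 by ring]
          rw [ENNReal.rpow_add_of_nonneg _ _ (by linarith) zero_le_one, ENNReal.rpow_one]
        rw [h1]
        refine mul_le_mul_left (ENNReal.rpow_le_rpow ?_ (by linarith)) _
        rw [← ofReal_norm]
        exact ENNReal.ofReal_le_ofReal (norm_fourierInv_le h x)
    _ = M ^ (p - 1) * ∫⁻ x, ‖𝓕⁻ h x‖ₑ := lintegral_const_mul' _ _
        (ENNReal.rpow_ne_top_of_nonneg (by linarith) ENNReal.ofReal_ne_top)
    _ < ∞ := ENNReal.mul_lt_top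
        (ENNReal.rpow_lt_top_of_nonneg (by linarith) ENNReal.ofReal_ne_top) hL

lemma exists_kernelBound_of_decay {μ : Measure V} {Λ : V → ℝ} {A : ℝ}
    (hs : ∀ᵐ y ∂μ, ‖y‖ ≤ 1)
    (h2 : Integrable (fun y => ‖y‖ ^ 2) μ) (hΛ : ∀ ξ, 0 ≤ Λ ξ) (hA0 : 0 ≤ A)
    (hA : ∀ ξ, ∫ y, ‖y‖ * ‖expI ξ y - 1‖ ∂μ ≤ A * (1 + Λ ξ))
    (hfin : ∫⁻ ξ : V, ENNReal.ofReal (‖ξ‖ ^ 4 * (1 + Λ ξ) ^ (Module.finrank ℝ V + 3)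
      * Real.exp (symb (fun _ => 1) μ ξ).re) < ∞) :
    ∃ C : ℝ, 0 < C ∧ ∀ (c : V → ℝ) (π : Measure V), LevyPair c π → μ ≤ π →
      KernelBound C fun ξ => Complex.exp (symb c π ξ) := by
  obtain ⟨h3, h4, h5, h6, h7⟩ := fourierInv_exp_symb_decay hs h2 hΛ hA0 hA hfin
  exact exists_kernelBound h2 h3 h4 (contDiff_symb_one hs h2 0).continuous h5 h6 h7

/-! ### Symmetrization: the real part as a Lévy exponent. -/

/-- The symmetrization of a measure under `y ↦ -y`. -/
def symmetrize (π : Measure V) : Measure V :=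
  (2⁻¹ : ℝ≥0∞) • (π + π.map fun y => -y)

section Symmetrize

variable {π μ : Measure V} {c : V → ℝ}

lemma symmetrize_mono (h : μ ≤ π) : symmetrize μ ≤ symmetrize π := by
  unfold symmetrize
  gcongr
  exact measurable_neg

lemma symmetrize_apply_of_neg {s : Set V} (hs : MeasurableSet s) (hn : (fun y => -y) ⁻¹' s = s) :
    symmetrize π s = π s := by
  simp only [symmetrize, Measure.smul_apply, Measure.add_apply, smul_eq_mul]
  rw [Measure.map_apply measurable_neg hs, hn, ← two_mul, ← mul_assoc,
    ENNReal.inv_mul_cancel two_ne_zero ENNReal.ofNat_ne_top, one_mul]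

lemma integrable_symmetrize {E : Type*} [NormedAddCommGroup E] {f : V → E} (h1 : Integrable f π)
    (h2 : Integrable (fun y => f (-y)) π) : Integrable f (symmetrize π) := by
  refine Integrable.smul_measure (h1.add_measure ?_) (by simp)
  exact ((MeasurableEquiv.neg V).measurableEmbedding.integrable_map_iff).2 h2

lemma integral_symmetrize {E : Type*} [NormedAddCommGroup E] [NormedSpace ℝ E] {f : V → E}
    (h1 : Integrable f π) (h2 : Integrable (fun y => f (-y)) π) :
    ∫ y, f y ∂symmetrize π = (2⁻¹ : ℝ) • (∫ y, f y ∂π + ∫ y, f (-y) ∂π) := by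
  have h3 : Integrable f (π.map fun y => -y) :=
    ((MeasurableEquiv.neg V).measurableEmbedding.integrable_map_iff).2 h2
  rw [symmetrize, integral_smul_measure, integral_add_measure h1 h3]
  congr 2
  · simp
  · exact (MeasurableEquiv.neg V).measurableEmbedding.integral_map f

lemma levyKer_neg (hc : ∀ y, c (-y) = c y) (ξ y : V) :
    levyKer c ξ (-y) = starRingEnd ℂ (levyKer c ξ y) := by
  simp only [levyKer, expI_neg_right, hc, inner_neg_right, map_sub, map_mul, Complex.conj_ofReal,
    Complex.conj_I, map_one, map_ofNat]
  push_cast; ring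

lemma integrable_levyKer_neg (hc : ∀ y, c (-y) = c y) {ξ : V} (h : Integrable (levyKer c ξ) π) :
    Integrable (fun y => levyKer c ξ (-y)) π := by
  simp_rw [levyKer_neg hc]
  exact (Complex.conjCLE.toContinuousLinearMap).integrable_comp h

/-- With an even cut-off, reflecting the measure conjugates the exponent. Hence the real part is
again a Lévy exponent, and the kernel bounds cover the case `δ < 1`. -/
lemma symb_symmetrize (hc : ∀ y, c (-y) = c y) {ξ : V} (h : Integrable (levyKer c ξ) π) :
    symb c (symmetrize π) ξ = ((symb c π ξ).re : ℂ) := by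
  rw [symb, integral_symmetrize h (integrable_levyKer_neg hc h)]
  simp_rw [levyKer_neg hc]
  rw [integral_conj, ← symb, Complex.add_conj, Complex.real_smul]
  push_cast; ring

lemma LevyPair.symmetrize (h : LevyPair c π) (hc : ∀ y, c (-y) = c y) :
    LevyPair c (symmetrize π) where
  zero_null := by
    rw [symmetrize_apply_of_neg (measurableSet_singleton _) (by ext; simp)]
    exact h.zero_null
  finite_off_zero := by
    intro ε hε
    rw [symmetrize_apply_of_neg (measurableSet_lt measurable_const measurable_norm)
      (by ext; simp)]
    exact h.finite_off_zero ε hε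
  integrable := fun ξ => integrable_symmetrize (h.integrable ξ)
    (integrable_levyKer_neg hc (h.integrable ξ))
  continuous_symb := by
    have : symb c (LevySmooth.symmetrize π) = fun ξ => ((symb c π ξ).re : ℂ) :=
      funext fun ξ => symb_symmetrize hc (h.integrable ξ)
    rw [this]
    have := h.continuous_symb
    fun_prop

/-- Uniform kernel bounds for the real parts of Lévy exponents with even cut-off. -/
lemma exists_kernelBound_re_of_decay {Λ : V → ℝ} {A : ℝ}
    (hs : ∀ᵐ y ∂μ, ‖y‖ ≤ 1)
    (h2 : Integrable (fun y => ‖y‖ ^ 2) μ) (hΛ : ∀ ξ, 0 ≤ Λ ξ) (hA0 : 0 ≤ A)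
    (hA : ∀ ξ, ∫ y, ‖y‖ * ‖expI ξ y - 1‖ ∂μ ≤ A * (1 + Λ ξ))
    (hfin : ∫⁻ ξ : V, ENNReal.ofReal (‖ξ‖ ^ 4 * (1 + Λ ξ) ^ (Module.finrank ℝ V + 3)
      * Real.exp (symb (fun _ => 1) μ ξ).re) < ∞) :
    ∃ C : ℝ, 0 < C ∧ ∀ (c : V → ℝ) (π : Measure V), LevyPair c π → μ ≤ π → (∀ y, c (-y) = c y) →
      KernelBound C fun ξ => Complex.exp ((symb c π ξ).re : ℂ) := by
  have hi : ∀ ξ, Integrable (fun y => ‖y‖ * ‖expI ξ y - 1‖) μ := by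
    intro ξ
    refine (h2.const_mul (2 * Real.pi * ‖ξ‖)).mono'
      (Continuous.aestronglyMeasurable (by fun_prop)) (Eventually.of_forall fun y => ?_)
    rw [Real.norm_of_nonneg (by positivity)]
    calc ‖y‖ * ‖expI ξ y - 1‖ ≤ ‖y‖ * (2 * Real.pi * (‖ξ‖ * ‖y‖)) := by
          gcongr; exact norm_expI_sub_one_le ξ y
      _ = _ := by ring
  -- The gradient bound involves an even function of `y`, so it passes to the symmetrized measure
  -- with the same constant.
  have hev : ∀ ξ y : V, ‖-y‖ * ‖expI ξ (-y) - 1‖ = ‖y‖ * ‖expI ξ y - 1‖ := by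
    intro ξ y
    have : expI ξ (-y) - 1 = starRingEnd ℂ (expI ξ y - 1) := by
      rw [expI_neg_right, map_sub, map_one]
    rw [norm_neg, this, RCLike.norm_conj]
  have hs' : ∀ᵐ y ∂symmetrize μ, ‖y‖ ≤ 1 := by
    have h3 := symmetrize_apply_of_neg (π := μ) (s := {y : V | ¬‖y‖ ≤ 1})
      (measurableSet_le measurable_norm measurable_const).compl (by ext; simp)
    rw [ae_iff, h3]
    exact hs
  have h2' : Integrable (fun y => ‖y‖ ^ 2) (symmetrize μ) :=
    integrable_symmetrize h2 (by simpa using h2)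
  have hA' : ∀ ξ, ∫ y, ‖y‖ * ‖expI ξ y - 1‖ ∂symmetrize μ ≤ A * (1 + Λ ξ) := by
    intro ξ
    rw [integral_symmetrize (hi ξ) (by simpa only [hev] using hi ξ)]
    simp only [hev]
    rw [← two_mul, smul_eq_mul, inv_mul_cancel_left₀ two_ne_zero]
    exact hA ξ
  have hre : ∀ ξ, (symb (fun _ => 1) (symmetrize μ) ξ).re = (symb (fun _ => 1) μ ξ).re := by
    intro ξ
    rw [symb_symmetrize (fun _ => rfl) (integrable_levyKer_one h2 ξ), Complex.ofReal_re]
  obtain ⟨C, hC, hK⟩ := exists_kernelBound_of_decay hs' h2' hΛ hA0 hA'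
    (by simp only [hre]; exact hfin)
  refine ⟨C, hC, fun c π hp hle hc => ?_⟩
  have := hK c (symmetrize π) (hp.symmetrize hc) (symmetrize_mono hle)
  simp only [symb_symmetrize hc (hp.integrable _)] at this
  exact this

end Symmetrize

/-! ### Multipliers on Schwartz functions and their increments. -/

section Semigroup

variable {κ l : ℝ → ℝ} {ψ : V → ℂ} {C : ℝ}

/-- Every time is `κ R` for some `R`, and dilating a kernel preserves its `L¹` norm, so the bound is
uniform in `s`. -/
lemma lintegral_fourierInv_exp_mul_le (hκ : IsScaling κ l)
    (hK : ∀ R : ℝ, 0 < R → KernelBound C fun η : V => Complex.exp (κ R * ψ (R⁻¹ • η)))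
    {s : ℝ} (hs : 0 < s) {h : V → ℂ} (hm : StronglyMeasurable h) (hh : Integrable h) :
    ∫⁻ x, ‖𝓕⁻ (fun ξ => Complex.exp (s * ψ ξ) * h ξ) x‖ₑ
      ≤ ENNReal.ofReal C * ∫⁻ x, ‖𝓕⁻ h x‖ₑ := by
  obtain ⟨R, hR, rfl⟩ := hκ.exists_eq hs
  have hb := hK R hR
  have h1 := lintegral_fourierInv_fourier_smul_mul_le
    (continuous_fourierInv hb.integrable_symbol).stronglyMeasurable hm hb.integrable hh R
  rw [hb.fourier_eq] at h1
  simp only [inv_smul_smul₀ hR.ne'] at h1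
  refine h1.trans ?_
  gcongr
  exact hb.lintegral_le

end Semigroup

lemma integrableOn_rpow_mul_exp_neg {δ r : ℝ} (hδ : 0 < δ) (hr : 0 < r) :
    IntegrableOn (fun t : ℝ => t ^ (δ - 1) * Real.exp (-(r * t))) (Ioi 0) := by
  have := integrableOn_rpow_mul_exp_neg_mul_rpow (s := δ - 1) (p := 1) (by linarith) one_pos hr
  simpa using this

/-- The multiplier `ψ` for `δ = 1` and `-(-Re ψ)^δ` for `δ ≠ 1`. -/
def powMultiplier (ψ : V → ℂ) (δ : ℝ) (ξ : V) : ℂ :=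
  if δ = 1 then ψ ξ else ((-((-(ψ ξ).re) ^ δ) : ℝ) : ℂ)

section Multiplier

variable {κ l : ℝ → ℝ} {c : V → ℝ} {π : Measure V} {C δ p : ℝ}

/-- For `δ < 1` the multiplier is `-a ^ δ` with `a = -Re ψ`. Minus `a` is the symbol of the
symmetrized measure, so the generator estimate applies to it, and subordination gives the fractional
power. -/
lemma integrable_powMultiplier_mul_fourier (hκ : IsScaling κ l) (hc : Measurable c)
    (h0 : π {0} = 0) (hi : Integrable (levyMaj c) π) (hev : ∀ y, c (-y) = c y)
    (hK : ∀ R : ℝ, 0 < R →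
      KernelBound C fun η : V => Complex.exp (κ R * ((symb c π (R⁻¹ • η)).re : ℂ)))
    (hδ0 : 0 < δ) (hδ1 : δ ≤ 1) (φ : 𝓢(V, ℂ)) :
    Integrable (fun ξ => powMultiplier (symb c π) δ ξ * 𝓕 (φ : V → ℂ) ξ) ∧
      ∫⁻ x, ‖𝓕⁻ (fun ξ => powMultiplier (symb c π) δ ξ * 𝓕 (φ : V → ℂ) ξ) x‖ₑ < ∞ := by
  rcases eq_or_lt_of_le hδ1 with rfl | hδ
  · simpa [powMultiplier] using integrable_symb_mul_fourier φ hc h0 hi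
  have hp := levyPair_of_integrable hc h0 hi
  have hψ := hp.continuous_symb
  set a : V → ℝ := fun ξ => -(symb c π ξ).re with ha
  have ha0 : ∀ ξ, 0 ≤ a ξ := by
    intro ξ
    simp only [ha]
    rw [symb_re (hp.integrable ξ), neg_neg]
    exact integral_nonneg fun y => by simpa using Real.cos_le_one _
  have ham : Continuous a := by fun_prop
  set F := 𝓕 (φ : V → ℂ) with hF
  have hFc : Continuous F := continuous_fourier_schwartz φ
  have hFi : Integrable F := integrable_fourier_schwartz φ
  have hiS : Integrable (levyMaj c) (symmetrize π) := by
    refine integrable_symmetrize hi ?_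
    have h1 : (fun y => levyMaj c (-y)) = levyMaj c := by
      funext y; simp only [levyMaj, norm_neg, hev]
    rwa [h1]
  have hsy := integrable_symb_mul_fourier φ hc (hp.symmetrize hev).zero_null hiS
  simp only [symb_symmetrize hev (hp.integrable _)] at hsy
  have haeq : ∀ ξ, (((symb c π ξ).re : ℝ) : ℂ) * F ξ = (-1 : ℂ) * ((a ξ : ℂ) * F ξ) := by
    intro ξ; simp only [ha]; push_cast; ring
  simp only [← hF, haeq, fourierInv_const_mul, enorm_mul, enorm_neg, enorm_one, one_mul] at hsy
  have haF : Integrable fun ξ => (a ξ : ℂ) * F ξ := by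
    refine hsy.1.neg.congr (Eventually.of_forall fun ξ => ?_)
    simp only [Pi.neg_apply]; ring
  have hM : ∀ ξ, powMultiplier (symb c π) δ ξ * F ξ = (-1 : ℂ) * (((a ξ ^ δ : ℝ) : ℂ) * F ξ) := by
    intro ξ
    rw [powMultiplier, if_neg hδ.ne]; push_cast; ring
  simp only [hM, fourierInv_const_mul, enorm_mul, enorm_neg, enorm_one, one_mul]
  constructor
  · refine Integrable.const_mul ?_ _
    refine (hFi.norm.add haF.norm).mono' ?_ (Eventually.of_forall fun ξ => ?_)
    · have h1 : Continuous fun ξ => a ξ ^ δ := ham.rpow_const fun _ => Or.inr hδ0.le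
      exact Continuous.aestronglyMeasurable (by fun_prop)
    · simp only [Pi.add_apply, norm_mul, Complex.norm_real]
      rw [Real.norm_of_nonneg (ha0 ξ), Real.norm_of_nonneg (Real.rpow_nonneg (ha0 ξ) δ)]
      have h1 : a ξ ^ δ ≤ 1 + a ξ := by
        rcases le_total (a ξ) 1 with h | h
        · linarith [Real.rpow_le_one (ha0 ξ) h hδ0.le, ha0 ξ]
        · have := Real.rpow_le_rpow_of_exponent_le h hδ1
          rw [Real.rpow_one] at this
          linarith
      calc a ξ ^ δ * ‖F ξ‖ ≤ (1 + a ξ) * ‖F ξ‖ := by gcongr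
        _ = _ := by ring
  · refine lintegral_fourierInv_rpow_mul_lt_top hδ0 hδ ham.measurable ha0 hFc.measurable hFi haF
      (ENNReal.ofReal_lt_top (r := C)) ?_ ?_ hsy.2
    · intro s hs h hm hh
      have := lintegral_fourierInv_exp_mul_le
        (ψ := fun ξ => ((symb c π ξ).re : ℂ)) hκ hK hs hm hh
      refine le_trans (le_of_eq ?_) this
      congr 1; funext x
      refine congrArg (fun u : V → ℂ => ‖𝓕⁻ u x‖ₑ) (funext fun ξ => ?_)
      simp only [ha]; push_cast; ring_nf
    · simp only [hF, fourierInv_fourier_schwartz]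
      exact (φ.integrable (μ := volume)).2

/-- The case `δ = 1` keeps the full symbol and needs the sector bound `hB` for absolute convergence.
For `δ < 1` the real semigroup is used, and the absolute time integral equals `Γ(δ)` at every
nonzero frequency. -/
theorem exists_norm_increment_schwartz_le [Nontrivial V] (hκ : IsScaling κ l) (hc : Measurable c)
    (h0 : π {0} = 0) (hi : Integrable (levyMaj c) π) (hev : ∀ y, c (-y) = c y) (hC : 0 < C)
    (hK : ∀ R : ℝ, 0 < R → KernelBound C fun η : V => Complex.exp (κ R * symb c π (R⁻¹ • η)))
    {C₁ : ℝ} (hC₁ : 0 < C₁)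
    (hK' : ∀ R : ℝ, 0 < R →
      KernelBound C₁ fun η : V => Complex.exp (κ R * ((symb c π (R⁻¹ • η)).re : ℂ)))
    {B : ℝ} (hre : ∀ ξ, ξ ≠ 0 → (symb c π ξ).re < 0)
    (hB : ∀ ξ, ξ ≠ 0 → ‖symb c π ξ‖ ≤ B * -(symb c π ξ).re)
    (hδ0 : 0 < δ) (hδ1 : δ ≤ 1) (hp : 1 < p)
    (hγ0 : IntegrableOn
      (fun t : ℝ => t ^ (δ - 1) * gam l t ^ (-(Module.finrank ℝ V : ℝ) / p)) (Ioc 0 1))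
    (hγ1 : IntegrableOn
      (fun t : ℝ => t ^ (δ - 1) * gam l t ^ (-1 - (Module.finrank ℝ V : ℝ) / p)) (Ioi 1)) :
    ∃ C' : ℝ, 0 ≤ C' ∧ ∀ φ : 𝓢(V, ℂ), ∀ z : V, z ≠ 0 → ∀ x : V,
        ‖φ (x + z) - φ x‖ ≤ C' * κ ‖z‖ ^ δ * ‖z‖ ^ (-(Module.finrank ℝ V : ℝ) / p)
          * (eLpNorm (𝓕⁻ fun ξ => powMultiplier (symb c π) δ ξ * 𝓕 (φ : V → ℂ) ξ)
              (ENNReal.ofReal p)).toReal := by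
  have hpair := levyPair_of_integrable hc h0 hi
  have hψ := hpair.continuous_symb
  have hM : Measurable (powMultiplier (symb c π) δ) := by
    unfold powMultiplier
    refine Measurable.ite (by simp) hψ.measurable ?_
    have := hψ.measurable
    fun_prop
  have hae : ∀ᵐ ξ : V, ξ ≠ 0 := Measure.ae_ne volume 0
  have key : ∃ C' : ℝ, 0 ≤ C' ∧ ∀ F : V → ℂ, Measurable F → Integrable F →
      Integrable (fun ξ => powMultiplier (symb c π) δ ξ * F ξ) →
      MemLp (𝓕⁻ fun ξ => powMultiplier (symb c π) δ ξ * F ξ) (ENNReal.ofReal p) →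
      ∀ z : V, z ≠ 0 → ∀ x : V,
        ‖𝓕⁻ F (x + z) - 𝓕⁻ F x‖ ≤ C' * κ ‖z‖ ^ δ * ‖z‖ ^ (-(Module.finrank ℝ V : ℝ) / p)
          * (eLpNorm (𝓕⁻ fun ξ => powMultiplier (symb c π) δ ξ * F ξ)
            (ENNReal.ofReal p)).toReal := by
    rcases eq_or_lt_of_le hδ1 with rfl | hδ
    -- `c = -1` is the value of the integral of `ψ e^(tψ)` over `t > 0`; its absolute version is
    -- `|ψ| / (-Re ψ) ≤ B`.
    · refine exists_norm_increment_le hκ hψ.measurable hM hC hK hp (c := -1) (B := B) (by norm_num)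
        ?_ ?_ ?_ hγ0 hγ1
      · filter_upwards [hae] with ξ hξ
        simp only [powMultiplier, if_true, sub_self, Real.rpow_zero, Complex.ofReal_one, one_mul]
        rw [integral_mul_const]
        have h1 := integral_exp_mul_complex_Ioi (hre ξ hξ) 0
        have h2 : symb c π ξ ≠ 0 := fun h => by simpa [h] using hre ξ hξ
        simp_rw [mul_comm (symb c π ξ)] at h1
        rw [h1]
        simp [h2]
      · filter_upwards [hae] with ξ hξ
        refine Integrable.mul_const ?_ _
        refine (integrableOn_rpow_mul_exp_neg one_pos (neg_pos.2 (hre ξ hξ))).congr_fun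
          (fun t _ => ?_) measurableSet_Ioi
        simp only; congr 2; ring
      · filter_upwards [hae] with ξ hξ
        have h1 := Real.integral_rpow_mul_exp_neg_mul_Ioi one_pos (neg_pos.2 (hre ξ hξ))
        rw [integral_mul_const]
        have h2 : ∀ t : ℝ, t * (symb c π ξ).re = -(-(symb c π ξ).re * t) := fun t => by ring
        simp_rw [h2]
        rw [h1]
        simp only [powMultiplier, if_true, Real.rpow_one, Real.Gamma_one, mul_one]
        rw [one_div_mul_eq_div, div_le_iff₀ (neg_pos.2 (hre ξ hξ))]
        exact hB ξ hξ
    · have hΓ : 0 < Real.Gamma δ := Real.Gamma_pos_of_pos hδ0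
      have hcancel : ∀ r : ℝ, 0 < r → (1 / r) ^ δ * Real.Gamma δ * r ^ δ = Real.Gamma δ := by
        intro r hr
        rw [one_div, Real.inv_rpow hr.le]
        have := (Real.rpow_pos_of_pos hr δ).ne'
        field_simp
      -- `c = -Γ(δ)` is the Gamma integral of `t^(δ-1) e^(-tr)` multiplied by `-r ^ δ`, with `r =
      -- -Re ψ`.
      refine exists_norm_increment_le hκ (ψ := fun ξ => ((symb c π ξ).re : ℂ)) ?_ hM hC₁ hK' hp
        (c := -(Real.Gamma δ : ℂ)) (B := Real.Gamma δ) (by simpa using hΓ.ne') ?_ ?_ ?_ hγ0 hγ1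
      · have := hψ.measurable
        fun_prop
      · filter_upwards [hae] with ξ hξ
        have hr := neg_pos.2 (hre ξ hξ)
        have h1 := Real.integral_rpow_mul_exp_neg_mul_Ioi hδ0 hr
        have h2 : ∀ t : ℝ, ((t ^ (δ - 1) : ℝ) : ℂ) * Complex.exp (t * ((symb c π ξ).re : ℂ))
            = ((t ^ (δ - 1) * Real.exp (-(-(symb c π ξ).re * t)) : ℝ) : ℂ) := by
          intro t; push_cast; congr 2; ring
        simp_rw [h2]
        rw [integral_mul_const, integral_complex_ofReal, h1, powMultiplier, if_neg hδ.ne,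
          ← Complex.ofReal_mul, mul_neg, hcancel _ hr, Complex.ofReal_neg]
      · filter_upwards [hae] with ξ hξ
        refine Integrable.mul_const ?_ _
        refine (integrableOn_rpow_mul_exp_neg hδ0 (neg_pos.2 (hre ξ hξ))).congr_fun
          (fun t _ => ?_) measurableSet_Ioi
        simp only [Complex.ofReal_re]; congr 2; ring
      · filter_upwards [hae] with ξ hξ
        have hr := neg_pos.2 (hre ξ hξ)
        have h1 := Real.integral_rpow_mul_exp_neg_mul_Ioi hδ0 hr
        rw [integral_mul_const]
        have h2 : ∀ t : ℝ, t * ((symb c π ξ).re : ℂ).re = -(-(symb c π ξ).re * t) := fun t => by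
          simp only [Complex.ofReal_re]; ring
        simp_rw [h2]
        rw [h1, powMultiplier, if_neg hδ.ne, Complex.norm_real, norm_neg,
          Real.norm_of_nonneg (Real.rpow_nonneg hr.le δ), hcancel _ hr]
  obtain ⟨C', hC', hb⟩ := key
  refine ⟨C', hC', fun φ z hz x => ?_⟩
  have h1 := integrable_powMultiplier_mul_fourier hκ hc h0 hi hev hK' hδ0 hδ1 φ
  have h2 := hb (𝓕 (φ : V → ℂ)) (continuous_fourier_schwartz φ).measurable
    (integrable_fourier_schwartz φ) h1.1 (memLp_fourierInv h1.1 h1.2 hp) z hz x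
  rwa [fourierInv_fourier_schwartz, fourierInv_fourier_schwartz] at h2

end Multiplier

/-! ### Rescaled measures and the lower bound on the real part. -/

section Rescaling

variable {π μ : Measure V} {c : V → ℝ}

lemma measurableEmbedding_smul_inv {R : ℝ} (hR : 0 < R) :
    MeasurableEmbedding fun y : V => R⁻¹ • y :=
  (Homeomorph.smulOfNeZero R⁻¹ (inv_ne_zero hR.ne')).measurableEmbedding

lemma levyKer_smul_inv {R : ℝ} (hR : 0 < R) (η y : V) :
    levyKer (fun z => c (R • z)) η (R⁻¹ • y) = levyKer c (R⁻¹ • η) y := by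
  simp only [levyKer, smul_inv_smul₀ hR.ne', expI_smul_left, real_inner_smul_left,
    real_inner_smul_right]

/-- Rescaling jumps is dual to rescaling frequencies. The cut-off moves to `c (R • ·)`, which is why
the kernel bounds are stated for arbitrary cut-offs. -/
lemma symb_map_smul {R k : ℝ} (hR : 0 < R) (hk : 0 ≤ k) (η : V) :
    symb (fun z => c (R • z)) (ENNReal.ofReal k • π.map fun y => R⁻¹ • y) η
      = k * symb c π (R⁻¹ • η) := by
  rw [symb, integral_smul_measure, (measurableEmbedding_smul_inv hR).integral_map]
  simp_rw [levyKer_smul_inv hR]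
  rw [ENNReal.toReal_ofReal hk, Complex.real_smul, symb]

lemma LevyPair.map_smul (h : LevyPair c π) {R k : ℝ} (hR : 0 < R) (hk : 0 ≤ k) :
    LevyPair (fun z => c (R • z)) (ENNReal.ofReal k • π.map fun y => R⁻¹ • y) where
  zero_null := by
    have h1 : (fun y : V => R⁻¹ • y) ⁻¹' {0} = {0} := by
      ext y; simp [hR.ne']
    simp only [Measure.smul_apply, (measurableEmbedding_smul_inv hR).map_apply, h1, h.zero_null,
      smul_zero]
  finite_off_zero := by
    intro ε hε
    have h1 : (fun y : V => R⁻¹ • y) ⁻¹' {y | ε < ‖y‖} = {y | ε * R < ‖y‖} := by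
      ext y
      simp only [mem_preimage, mem_ofPred_eq, norm_smul, norm_inv, Real.norm_of_nonneg hR.le]
      rw [inv_mul_eq_div, lt_div_iff₀ hR]
    simp only [Measure.smul_apply, (measurableEmbedding_smul_inv hR).map_apply, h1]
    exact ENNReal.mul_lt_top ENNReal.ofReal_lt_top (h.finite_off_zero _ (by positivity))
  integrable := by
    intro ξ
    refine Integrable.smul_measure ?_ ENNReal.ofReal_ne_top
    rw [(measurableEmbedding_smul_inv hR).integrable_map_iff]
    refine (h.integrable (R⁻¹ • ξ)).congr (Eventually.of_forall fun y => ?_)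
    exact (levyKer_smul_inv hR ξ y).symm
  continuous_symb := by
    have h1 : symb (fun z => c (R • z)) (ENNReal.ofReal k • π.map fun y => R⁻¹ • y)
        = fun η => k * symb c π (R⁻¹ • η) := funext fun η => symb_map_smul hR hk η
    rw [h1]
    have := h.continuous_symb
    fun_prop

lemma symb_congr_cutoff {c' : V → ℝ} {ξ : V} (h : Integrable (levyKer c ξ) π)
    (hi : Integrable (fun y => (c' y - c y) • y) π) (h0 : ∫ y, (c' y - c y) • y ∂π = 0) :
    symb c' π ξ = symb c π ξ := by
  have h1 : Integrable (fun y => ((inner ℝ ξ ((c' y - c y) • y) : ℝ) : ℂ)) π :=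
    (hi.const_inner (𝕜 := ℝ) ξ).ofReal
  have h2 : ∀ y, levyKer c' ξ y = levyKer c ξ y
      - 2 * (Real.pi : ℂ) * Complex.I * ((inner ℝ ξ ((c' y - c y) • y) : ℝ) : ℂ) := by
    intro y
    rw [real_inner_smul_right]
    simp only [levyKer]; push_cast; ring
  rw [symb]
  simp_rw [h2]
  rw [integral_sub h (h1.const_mul _), integral_const_mul, integral_complex_ofReal,
    integral_inner hi, h0]
  simp [symb]

/-- With `‖η‖ = 1/2` and `‖y‖ ≤ 1` the argument of the cosine stays in `[-π, π]`, where `cos x ≤ 1 -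
2x²/π²`; nondegeneracy is then applied to the unit vector `2 • η`. -/
lemma le_neg_symb_one_re (hs : ∀ᵐ y ∂μ, ‖y‖ ≤ 1) (h2 : Integrable (fun y => ‖y‖ ^ 2) μ) {c₁ : ℝ}
    (hnd : ∀ ξ : V, ‖ξ‖ = 1 → c₁ ≤ ∫ y, |inner ℝ ξ y| ^ 2 ∂μ) {η : V} (hη : ‖η‖ = 1 / 2) :
    2 * c₁ ≤ -(symb (fun _ => 1) μ η).re := by
  have hi := integrable_levyKer_one h2 η
  rw [symb_re hi, neg_neg]
  have h3 := hnd ((2 : ℝ) • η) (by rw [norm_smul, hη]; norm_num)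
  calc 2 * c₁ ≤ 2 * ∫ y, |inner ℝ ((2 : ℝ) • η) y| ^ 2 ∂μ := by gcongr
    _ = ∫ y, 8 * |inner ℝ η y| ^ 2 ∂μ := by
        rw [← integral_const_mul]
        refine integral_congr_ae (Eventually.of_forall fun y => ?_)
        simp only [real_inner_smul_left, abs_mul, abs_two]; ring
    _ ≤ ∫ y, (1 - Real.cos (2 * Real.pi * inner ℝ η y)) ∂μ := by
        refine integral_mono_ae ?_ (integrable_one_sub_cos hi) ?_
        · refine (h2.const_mul (8 * ‖η‖ ^ 2)).mono'
            (Continuous.aestronglyMeasurable (by fun_prop)) (Eventually.of_forall fun y => ?_)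
          rw [Real.norm_of_nonneg (by positivity), mul_assoc, ← mul_pow]
          gcongr
          exact abs_real_inner_le_norm η y
        · filter_upwards [hs] with y hy
          have h4 : |inner ℝ η y| ≤ 1 / 2 := (abs_real_inner_le_norm η y).trans (by
            rw [hη]; nlinarith [norm_nonneg y])
          have hpi := Real.pi_pos
          have h5 := Real.cos_le_one_sub_mul_cos_sq (x := 2 * Real.pi * inner ℝ η y) (by
            rw [abs_mul, abs_of_pos (by positivity)]; nlinarith)
          have h6 : 2 / Real.pi ^ 2 * (2 * Real.pi * inner ℝ η y) ^ 2 = 8 * |inner ℝ η y| ^ 2 := by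
            rw [sq_abs]; field_simp; ring
          linarith

end Rescaling

/-! ### The cut-off `χ_σ` and the upper bound on the symbol. -/

section Cutoff

variable {d : ℕ} {σ : ℝ} {π : Measure (Rd d)}

lemma chi_of_lt (h : σ < 1) (y : Rd d) : chi σ y = 0 := by simp [chi, h]

lemma chi_of_gt (h : 1 < σ) (y : Rd d) : chi σ y = 1 := by simp [chi, h.not_gt, h.ne']

lemma chi_one (y : Rd d) : chi 1 y = if ‖y‖ ≤ 1 then 1 else 0 := by simp [chi]

lemma chi_eq_one (h : 1 ≤ σ) {y : Rd d} (hy : ‖y‖ ≤ 1) : chi σ y = 1 := by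
  simp [chi, h.not_gt, hy]

lemma chi_neg (σ : ℝ) (y : Rd d) : chi σ (-y) = chi σ y := by simp [chi]

lemma measurable_chi (σ : ℝ) : Measurable (chi (d := d) σ) := by
  unfold chi
  refine Measurable.ite (by simp) measurable_const (Measurable.ite (by simp) ?_ measurable_const)
  exact Measurable.ite (measurableSet_le measurable_norm measurable_const) measurable_const
    measurable_const

lemma integrable_of_lintegral_ofReal {α : Type*} [MeasurableSpace α] {μ : Measure α} {f : α → ℝ}
    (hm : Measurable f) (h0 : ∀ a, 0 ≤ f a) (h : ∫⁻ a, ENNReal.ofReal (f a) ∂μ < ∞) :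
    Integrable f μ :=
  ⟨hm.aestronglyMeasurable,
    (hasFiniteIntegral_iff_ofReal (Eventually.of_forall h0)).2 h⟩

/-- For `σ < 1` the definition of the order gives some `α < 1` with `‖y‖ ^ α`, hence `‖y‖`,
integrable near `0`; for `σ = 1` the mismatch term vanishes; for `σ > 1` it is the first moment at
infinity. -/
lemma ClassA.integrable_levyMaj (hπ : ClassA σ π) : Integrable (levyMaj (chi σ)) π := by
  have h1 : Integrable (fun y : Rd d => min (‖y‖ ^ 2) 1) π :=
    integrable_of_lintegral_ofReal (by fun_prop) (fun y => by positivity) hπ.levy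
  refine h1.add ?_
  rcases lt_trichotomy σ 1 with h | rfl | h
  · obtain ⟨α, ⟨-, hα⟩, hα1⟩ := (isGLB_lt_iff hπ.order).1 h
    have h2 : IntegrableOn (fun y : Rd d => ‖y‖ ^ α) (Metric.closedBall 0 1) π :=
      integrable_of_lintegral_ofReal (by fun_prop) (fun y => by positivity) hα
    have h3 : IntegrableOn (fun y : Rd d => ‖y‖) (Metric.closedBall 0 1) π := by
      refine h2.mono' (by fun_prop) ?_
      refine (ae_restrict_iff' Metric.isClosed_closedBall.measurableSet).2
        (Eventually.of_forall fun y hy => ?_)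
      rw [mem_closedBall_zero_iff] at hy
      rw [norm_norm]
      rcases (norm_nonneg y).eq_or_lt with h0 | h0
      · rw [← h0]; positivity
      · have := Real.rpow_le_rpow_of_exponent_ge h0 hy hα1.le
        rwa [Real.rpow_one] at this
    rw [← integrable_indicator_iff Metric.isClosed_closedBall.measurableSet] at h3
    refine h3.congr (Eventually.of_forall fun y => ?_)
    by_cases hy : ‖y‖ ≤ 1 <;> simp [chi_of_lt h, indicator, hy]
  · simp [chi_one]
  · have h2 : IntegrableOn (fun y : Rd d => ‖y‖) (Metric.closedBall 0 1)ᶜ π :=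
      integrable_of_lintegral_ofReal (by fun_prop) (fun y => by positivity) (hπ.moment h)
    rw [← integrable_indicator_iff Metric.isClosed_closedBall.measurableSet.compl] at h2
    refine h2.congr (Eventually.of_forall fun y => ?_)
    by_cases hy : ‖y‖ ≤ 1 <;> simp [chi_of_gt h, indicator, hy]

lemma ClassA.levyPair (hπ : ClassA σ π) : LevyPair (chi σ) π :=
  levyPair_of_integrable (measurable_chi σ) hπ.zero_null hπ.integrable_levyMaj

lemma measurableSet_annulus (R R' : ℝ) : MeasurableSet (annulus d R R') :=
  (measurableSet_lt measurable_const measurable_norm).inter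
    (measurableSet_le measurable_norm measurable_const)

lemma ClassA.integrableOn_annulus (hπ : ClassA σ π) {R R' : ℝ} (hR : 0 < R) :
    IntegrableOn (fun y : Rd d => y) (annulus d R R') π := by
  have hf : π (annulus d R R') < ∞ :=
    (measure_mono fun y hy => hy.1).trans_lt (hπ.levyPair.finite_off_zero R hR)
  refine Measure.integrableOn_of_bounded hf.ne measurable_id.aestronglyMeasurable (M := R') ?_
  exact (ae_restrict_iff' (measurableSet_annulus R R')).2 (Eventually.of_forall fun y hy => hy.2)

/-- Only `σ = 1` has content: the two cut-offs differ on an annulus, where centering makes the mean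
of `y` vanish. -/
lemma ClassA.symb_chi_smul (hπ : ClassA σ π) {R : ℝ} (hR : 0 < R) (ξ : Rd d) :
    symb (fun y => chi σ (R⁻¹ • y)) π ξ = symb (chi σ) π ξ := by
  rcases lt_trichotomy σ 1 with h | rfl | h
  · congr 1; funext y; rw [chi_of_lt h, chi_of_lt h]
  · have hn : ∀ y : Rd d, ‖R⁻¹ • y‖ ≤ 1 ↔ ‖y‖ ≤ R := by
      intro y
      rw [norm_smul, norm_inv, Real.norm_of_nonneg hR.le, inv_mul_le_iff₀ hR, mul_one]
    rcases lt_trichotomy R 1 with h | rfl | h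
    · have h1 : (fun y : Rd d => (chi 1 (R⁻¹ • y) - chi 1 y) • y)
          = (annulus d R 1).indicator fun y => -y := by
        funext y
        simp only [chi_one, hn, annulus, indicator, mem_ofPred_eq]
        by_cases h2 : ‖y‖ ≤ R
        · simp [h2, h2.trans h.le]
        · by_cases h3 : ‖y‖ ≤ 1 <;> simp [h2, h3, not_le.1 h2]
      refine symb_congr_cutoff (hπ.levyPair.integrable ξ) ?_ ?_
      · rw [h1, integrable_indicator_iff (measurableSet_annulus _ _)]
        exact (hπ.integrableOn_annulus hR).neg
      · rw [h1, integral_indicator (measurableSet_annulus _ _), integral_neg,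
          hπ.centered rfl R 1 hR h, neg_zero]
    · simp
    · have h1 : (fun y : Rd d => (chi 1 (R⁻¹ • y) - chi 1 y) • y)
          = (annulus d 1 R).indicator fun y => y := by
        funext y
        simp only [chi_one, hn, annulus, indicator, mem_ofPred_eq]
        by_cases h2 : ‖y‖ ≤ 1
        · simp [h2, h2.trans h.le]
        · by_cases h3 : ‖y‖ ≤ R <;> simp [h2, h3, not_le.1 h2]
      refine symb_congr_cutoff (hπ.levyPair.integrable ξ) ?_ ?_
      · rw [h1, integrable_indicator_iff (measurableSet_annulus _ _)]
        exact hπ.integrableOn_annulus one_pos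
      · rw [h1, integral_indicator (measurableSet_annulus _ _), hπ.centered rfl 1 R one_pos h]
  · congr 1; funext y; rw [chi_of_gt h, chi_of_gt h]

/-- The integrand is at most quadratic, linear or bounded according to compensation and jump size,
and the admissible exponents lie on the right side of these orders. The constant comes from `(2π ·
1/2)² = π² ≤ 16`. -/
lemma norm_levyKer_chi_le {α₁ α₂ : ℝ} (hα : AdmissibleExponents σ α₁ α₂) {η : Rd d}
    (hη : ‖η‖ = 1 / 2) (z : Rd d) :
    ‖levyKer (chi σ) η z‖ ≤ 16 * if ‖z‖ ≤ 1 then ‖z‖ ^ α₁ else ‖z‖ ^ α₂ := by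
  have hpi0 := Real.pi_pos
  have hpi := Real.pi_lt_four
  have hz := norm_nonneg z
  have hlin : ‖expI η z - 1‖ ≤ 4 * ‖z‖ := by
    refine (norm_expI_sub_one_le η z).trans ?_
    rw [hη]; nlinarith
  have hquad : ‖levyKer (fun _ => 1) η z‖ ≤ 16 * ‖z‖ ^ 2 := by
    refine (norm_levyKer_one_le η z).trans ?_
    rw [hη]
    have : (2 * Real.pi) ^ 2 * (1 / 2) ^ 2 ≤ 16 := by nlinarith
    gcongr
  have htwo := norm_expI_sub_one_le_two η z
  have hquad' : ∀ α : ℝ, 0 ≤ α → α ≤ 2 → ‖z‖ ≤ 1 → ‖levyKer (fun _ => 1) η z‖ ≤ 16 * ‖z‖ ^ α := by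
    intro α h0 h1 h2
    refine hquad.trans ?_
    gcongr
    rw [← Real.rpow_natCast]
    exact Real.rpow_le_rpow_of_exponent_ge' hz h2 h0 (by exact_mod_cast h1)
  have hone : ∀ α : ℝ, 0 ≤ α → ¬‖z‖ ≤ 1 → ‖expI η z - 1‖ ≤ 16 * ‖z‖ ^ α := by
    intro α h0 h1
    have := Real.one_le_rpow (not_le.1 h1).le h0
    linarith
  have hz0 : ∀ {c : Rd d → ℝ}, c z = 0 → levyKer c η z = expI η z - 1 := by
    intro c h; simp [levyKer, h]
  have hz1 : ∀ {c : Rd d → ℝ}, c z = 1 → levyKer c η z = levyKer (fun _ => 1) η z := by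
    intro c h; simp [levyKer, h]
  rcases lt_trichotomy σ 1 with h | rfl | h
  · obtain ⟨h1, h2⟩ := hα.1 h
    rw [hz0 (chi_of_lt h z)]
    split_ifs with hz1
    · have h3 := Real.rpow_le_rpow_of_exponent_ge' hz hz1 h1.1.le h1.2
      rw [Real.rpow_one] at h3
      linarith
    · exact hone _ h2.1.le hz1
  · obtain ⟨h1, h2⟩ := hα.2.2 rfl
    split_ifs with hz'
    · rw [hz1 (chi_eq_one le_rfl hz')]
      exact hquad' _ (by linarith [h1.1]) h1.2 hz'
    · rw [hz0 (by rw [chi_one, if_neg hz'])]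
      exact hone _ h2.1 hz'
  · obtain ⟨h1, h2⟩ := hα.2.1 h
    rw [hz1 (chi_of_gt h z)]
    split_ifs with hz'
    · exact hquad' _ (by linarith [h1.1]) h1.2 hz'
    · have h3 : ‖z‖ ≤ ‖z‖ ^ α₂ := by
        have := Real.rpow_le_rpow_of_exponent_le (not_le.1 hz').le h2.1.le
        rwa [Real.rpow_one] at this
      have h4 : ‖levyKer (fun _ => 1) η z‖ ≤ 2 + 4 * ‖z‖ := by
        unfold levyKer
        refine (norm_sub_le _ _).trans (add_le_add htwo ?_)
        rw [norm_mul, norm_two_pi_I, one_mul, Complex.norm_real, Real.norm_eq_abs]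
        have h5 := abs_real_inner_le_norm η z
        rw [hη] at h5
        calc 2 * Real.pi * |inner ℝ η z| ≤ 2 * Real.pi * (1 / 2 * ‖z‖) := by gcongr
          _ ≤ 4 * ‖z‖ := by nlinarith
      linarith [not_le.1 hz']

/-- At the scale dual to `ξ`, `κ R * ψ ξ` is the exponent of the rescaled measure at a vector of
length `1/2`, and the moments in assumption B dominate its integrand. -/
lemma ClassA.norm_symb_le (hπ : ClassA σ π) {κ : ℝ → ℝ} {α₁ α₂ N0 : ℝ}
    (hα : AdmissibleExponents σ α₁ α₂) (hN0 : 0 ≤ N0) {R : ℝ} (hR : 0 < R) (hκ : 0 ≤ κ R)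
    (hB : ∫⁻ z in Metric.closedBall 0 1, ENNReal.ofReal (‖z‖ ^ α₁) ∂(rescaled κ π R)
      + ∫⁻ z in (Metric.closedBall 0 1)ᶜ, ENNReal.ofReal (‖z‖ ^ α₂) ∂(rescaled κ π R)
      ≤ ENNReal.ofReal N0) {ξ : Rd d} (hξ : ‖R • ξ‖ = 1 / 2) :
    κ R * ‖symb (chi σ) π ξ‖ ≤ 16 * N0 := by
  have h1 := symb_map_smul (π := π) (c := fun y => chi σ (R⁻¹ • y)) hR hκ (R • ξ)
  simp only [inv_smul_smul₀ hR.ne'] at h1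
  rw [hπ.symb_chi_smul hR] at h1
  have h2 : κ R * ‖symb (chi σ) π ξ‖ = ‖symb (fun z => chi σ z) (rescaled κ π R) (R • ξ)‖ := by
    rw [rescaled, h1, norm_mul, Complex.norm_real, Real.norm_of_nonneg hκ]
  rw [h2, ← ENNReal.ofReal_le_ofReal_iff (by positivity), ofReal_norm, symb]
  refine (enorm_integral_le_lintegral_enorm _).trans ?_
  have hms : MeasurableSet (Metric.closedBall (0 : Rd d) 1) :=
    Metric.isClosed_closedBall.measurableSet
  rw [← lintegral_add_compl _ hms, ENNReal.ofReal_mul (by norm_num)]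
  refine le_trans ?_ (mul_le_mul_right hB _)
  rw [mul_add, ← lintegral_const_mul' _ _ ENNReal.ofReal_ne_top,
    ← lintegral_const_mul' _ _ ENNReal.ofReal_ne_top]
  refine add_le_add (setLIntegral_mono' hms fun z hz => ?_)
    (setLIntegral_mono' hms.compl fun z hz => ?_)
  · rw [mem_closedBall_zero_iff] at hz
    have h3 := norm_levyKer_chi_le hα hξ z
    rw [if_pos hz] at h3
    rw [← ofReal_norm, ← ENNReal.ofReal_mul (by norm_num)]
    exact ENNReal.ofReal_le_ofReal h3
  · rw [mem_compl_iff, mem_closedBall_zero_iff] at hz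
    have h3 := norm_levyKer_chi_le hα hξ z
    rw [if_neg hz] at h3
    rw [← ofReal_norm, ← ENNReal.ofReal_mul (by norm_num)]
    exact ENNReal.ofReal_le_ofReal h3

end Cutoff

/-! ### The auxiliary measure and the consequences of D and B. -/

section Auxiliary

variable {d : ℕ} {σ n0 c1 : ℝ} {π μ0 : Measure (Rd d)}

namespace AssumptionA0

lemma ae_norm_le (h : AssumptionA0 σ n0 c1 μ0) : ∀ᵐ y ∂μ0, ‖y‖ ≤ 1 := by
  rw [← h.support]
  filter_upwards [ae_restrict_mem Metric.isClosed_closedBall.measurableSet] with y hy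
  exact mem_closedBall_zero_iff.1 hy

lemma integrable_sq (h : AssumptionA0 σ n0 c1 μ0) : Integrable (fun y => ‖y‖ ^ 2) μ0 :=
  integrable_of_lintegral_ofReal (by fun_prop) (fun y => by positivity)
    ((le_self_add.trans h.bound).trans_lt ENNReal.ofReal_lt_top)

lemma le_integral_inner_sq (h : AssumptionA0 σ n0 c1 μ0) (ξ : Rd d) (hξ : ‖ξ‖ = 1) :
    c1 ≤ ∫ y, |inner ℝ ξ y| ^ 2 ∂μ0 := by
  have h1 := h.nondegenerate ξ hξ
  rw [h.support] at h1
  have hi : Integrable (fun y => |inner ℝ ξ y| ^ 2) μ0 := by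
    refine h.integrable_sq.mono' (Continuous.aestronglyMeasurable (by fun_prop))
      (Eventually.of_forall fun y => ?_)
    rw [Real.norm_of_nonneg (by positivity)]
    gcongr
    simpa [hξ] using abs_real_inner_le_norm ξ y
  rw [← ofReal_integral_eq_lintegral_ofReal hi (Eventually.of_forall fun y => by positivity)] at h1
  exact (ENNReal.ofReal_le_ofReal_iff (integral_nonneg fun y => by positivity)).1 h1

lemma symb_one_re (h : AssumptionA0 σ n0 c1 μ0) (ξ : Rd d) :
    (symb (fun _ => 1) μ0 ξ).re = -psi0 μ0 ξ := by
  rw [symb_re (integrable_levyKer_one h.integrable_sq ξ), psi0, h.support]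

lemma lam_nonneg (σ : ℝ) (μ0 : Measure (Rd d)) (ξ : Rd d) : 0 ≤ lam σ μ0 ξ := by
  refine integral_nonneg fun y => ?_
  have : 0 ≤ chi σ y := by unfold chi; split_ifs <;> norm_num
  simp only [Pi.zero_apply]
  positivity

lemma lintegral_lt_top (h : AssumptionA0 σ n0 c1 μ0) :
    ∫⁻ ξ : Rd d, ENNReal.ofReal (‖ξ‖ ^ 4 * (1 + lam σ μ0 ξ) ^ (Module.finrank ℝ (Rd d) + 3)
      * Real.exp (symb (fun _ => 1) μ0 ξ).re) < ∞ := by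
  simp only [h.symb_one_re, finrank_euclideanSpace_fin]
  exact (le_add_self.trans h.bound).trans_lt ENNReal.ofReal_lt_top

/-- For `σ ≥ 1`, `lam` is itself comparable to an upper bound of this integral. For `σ < 1` the
cut-off makes `lam` vanish, and a finite first moment must replace it. -/
lemma exists_integral_norm_mul_le (h : AssumptionA0 σ n0 c1 μ0)
    (h1 : σ < 1 → Integrable (fun y => ‖y‖) μ0) :
    ∃ A : ℝ, 0 ≤ A ∧ ∀ ξ, ∫ y, ‖y‖ * ‖expI ξ y - 1‖ ∂μ0 ≤ A * (1 + lam σ μ0 ξ) := by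
  have hpi := Real.pi_gt_three
  rcases lt_or_ge σ 1 with hσ | hσ
  · refine ⟨2 * ∫ y, ‖y‖ ∂μ0, by positivity, fun ξ => ?_⟩
    have h2 : ∫ y, ‖y‖ * ‖expI ξ y - 1‖ ∂μ0 ≤ ∫ y, 2 * ‖y‖ ∂μ0 := by
      refine integral_mono_of_nonneg (Eventually.of_forall fun y => by positivity)
        ((h1 hσ).const_mul 2) (Eventually.of_forall fun y => ?_)
      have := norm_expI_sub_one_le_two ξ y
      simp only
      nlinarith [norm_nonneg y]
    rw [integral_const_mul] at h2
    refine h2.trans (le_mul_of_one_le_right (by positivity) ?_)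
    linarith [lam_nonneg σ μ0 ξ]
  · refine ⟨2 * Real.pi, by positivity, fun ξ => ?_⟩
    have hi : Integrable (fun y => ‖y‖ * min (‖ξ‖ * ‖y‖) 1) μ0 := by
      refine (h.integrable_sq.const_mul ‖ξ‖).mono'
        (Continuous.aestronglyMeasurable (by fun_prop)) (Eventually.of_forall fun y => ?_)
      rw [Real.norm_of_nonneg (by positivity)]
      calc ‖y‖ * min (‖ξ‖ * ‖y‖) 1 ≤ ‖y‖ * (‖ξ‖ * ‖y‖) := by gcongr; exact min_le_left _ _
        _ = _ := by ring
    have hlam : lam σ μ0 ξ = ∫ y, ‖y‖ * min (‖ξ‖ * ‖y‖) 1 ∂μ0 := by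
      rw [lam, h.support]
      refine integral_congr_ae ?_
      filter_upwards [h.ae_norm_le] with y hy
      rw [chi_eq_one hσ hy, one_mul]
    have h2 : ∫ y, ‖y‖ * ‖expI ξ y - 1‖ ∂μ0
        ≤ ∫ y, 2 * Real.pi * (‖y‖ * min (‖ξ‖ * ‖y‖) 1) ∂μ0 := by
      refine integral_mono_of_nonneg (Eventually.of_forall fun y => by positivity)
        (hi.const_mul _) (Eventually.of_forall fun y => ?_)
      have h3 : ‖expI ξ y - 1‖ ≤ 2 * Real.pi * min (‖ξ‖ * ‖y‖) 1 := by
        rcases le_total (‖ξ‖ * ‖y‖) 1 with h4 | h4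
        · rw [min_eq_left h4]; exact norm_expI_sub_one_le ξ y
        · rw [min_eq_right h4]; linarith [norm_expI_sub_one_le_two ξ y]
      calc ‖y‖ * ‖expI ξ y - 1‖ ≤ ‖y‖ * (2 * Real.pi * min (‖ξ‖ * ‖y‖) 1) := by gcongr
        _ = _ := by ring
    rw [integral_const_mul, ← hlam] at h2
    nlinarith

end AssumptionA0

/-- Assumption A₀ gives only a second moment. For `σ < 1` the first moment comes from `μ0 ≤ π̃_1`
and assumption B at `R = 1`, where `α₁ ≤ 1`. -/
lemma integrable_norm_of_assumptionB (hσ : σ < 1) {κ : ℝ → ℝ} (hB : AssumptionB σ κ π)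
    (hA : AssumptionA0 σ n0 c1 μ0) (hle : μ0 ≤ rescaled κ π 1) :
    Integrable (fun y => ‖y‖) μ0 := by
  obtain ⟨α₁, α₂, N0, hα, -, hN⟩ := hB
  obtain ⟨h1, -⟩ := hα.1 hσ
  refine integrable_of_lintegral_ofReal (by fun_prop) (fun y => by positivity) ?_
  rw [← hA.support]
  calc ∫⁻ y in Metric.closedBall 0 1, ENNReal.ofReal ‖y‖ ∂μ0
      ≤ ∫⁻ y in Metric.closedBall 0 1, ENNReal.ofReal ‖y‖ ∂(rescaled κ π 1) :=
        lintegral_mono' (Measure.restrict_mono le_rfl hle) le_rfl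
    _ ≤ ∫⁻ y in Metric.closedBall 0 1, ENNReal.ofReal (‖y‖ ^ α₁) ∂(rescaled κ π 1) := by
        refine setLIntegral_mono' Metric.isClosed_closedBall.measurableSet fun y hy => ?_
        rw [mem_closedBall_zero_iff] at hy
        have := Real.rpow_le_rpow_of_exponent_ge' (norm_nonneg y) hy h1.1.le h1.2
        rw [Real.rpow_one] at this
        exact ENNReal.ofReal_le_ofReal this
    _ < ∞ := (le_self_add.trans (hN 1 one_pos)).trans_lt ENNReal.ofReal_lt_top

variable {κ l : ℝ → ℝ}

/-- Uniform kernel bounds for the rescaled semigroups generated by `symbol σ π` and by its real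
part. -/
lemma exists_kernelBound_symb (hπ : ClassA σ π) (hκ : IsScaling κ l) (hD : AssumptionD σ κ π)
    (hB : AssumptionB σ κ π) :
    (∃ C : ℝ, 0 < C ∧ ∀ R : ℝ, 0 < R →
      KernelBound C fun η : Rd d => Complex.exp (κ R * symb (chi σ) π (R⁻¹ • η))) ∧
    (∃ C : ℝ, 0 < C ∧ ∀ R : ℝ, 0 < R →
      KernelBound C fun η : Rd d => Complex.exp (κ R * ((symb (chi σ) π (R⁻¹ • η)).re : ℂ))) := by
  obtain ⟨μ0, n0, c1, hA, hle, -⟩ := hD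
  rw [hA.support] at hle
  obtain ⟨A, hA0, hAb⟩ := hA.exists_integral_norm_mul_le
    fun hσ => integrable_norm_of_assumptionB hσ hB hA (hle 1 one_pos)
  have hpair : ∀ R : ℝ, 0 < R → LevyPair (fun z => chi σ (R • z)) (rescaled κ π R) :=
    fun R hR => hπ.levyPair.map_smul hR (hκ.pos R hR).le
  have hsy : ∀ R : ℝ, 0 < R → ∀ η, symb (fun z => chi σ (R • z)) (rescaled κ π R) η
      = κ R * symb (chi σ) π (R⁻¹ • η) :=
    fun R hR η => symb_map_smul hR (hκ.pos R hR).le η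
  have hlam := AssumptionA0.lam_nonneg σ μ0
  constructor
  · obtain ⟨C, hC, hK⟩ := exists_kernelBound_of_decay hA.ae_norm_le hA.integrable_sq hlam hA0 hAb
      hA.lintegral_lt_top
    refine ⟨C, hC, fun R hR => ?_⟩
    have := hK _ _ (hpair R hR) (hle R hR)
    simp only [hsy R hR] at this
    exact this
  · obtain ⟨C, hC, hK⟩ := exists_kernelBound_re_of_decay hA.ae_norm_le hA.integrable_sq hlam hA0
      hAb hA.lintegral_lt_top
    refine ⟨C, hC, fun R hR => ?_⟩
    have := hK _ _ (hpair R hR) (hle R hR) fun y => by rw [smul_neg, chi_neg]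
    simp only [hsy R hR, Complex.re_ofReal_mul, Complex.ofReal_mul] at this
    exact this

/-- The symbol is controlled by its real part, which is negative off the origin. -/
lemma exists_norm_symb_le_re (hπ : ClassA σ π) (hκ : IsScaling κ l) (hD : AssumptionD σ κ π)
    (hB : AssumptionB σ κ π) :
    (∀ ξ, ξ ≠ 0 → (symb (chi σ) π ξ).re < 0) ∧
      ∃ B : ℝ, ∀ ξ, ξ ≠ 0 → ‖symb (chi σ) π ξ‖ ≤ B * -(symb (chi σ) π ξ).re := by
  obtain ⟨μ0, n0, c1, hA, hle, -⟩ := hD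
  rw [hA.support] at hle
  obtain ⟨α₁, α₂, N0, hα, hN0, hN⟩ := hB
  have hc1 := hA.c1_pos
  -- At `R = 1 / (2‖ξ‖)` assumption D bounds `κ R * (-Re ψ)` below and assumption B bounds `κ R *
  -- |ψ|` above; the common factor cancels, leaving `16 N0 / (2 c1)`.
  have key : ∀ ξ : Rd d, ξ ≠ 0 → ∃ k : ℝ, 0 < k ∧ 2 * c1 ≤ k * -(symb (chi σ) π ξ).re ∧
      k * ‖symb (chi σ) π ξ‖ ≤ 16 * N0 := by
    intro ξ hξ
    have hn : 0 < ‖ξ‖ := norm_pos_iff.2 hξ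
    set R : ℝ := 1 / (2 * ‖ξ‖) with hRdef
    have hR : 0 < R := by positivity
    have hRξ : ‖R • ξ‖ = 1 / 2 := by
      rw [norm_smul, Real.norm_of_nonneg hR.le, hRdef]; field_simp
    refine ⟨κ R, hκ.pos R hR, ?_, hπ.norm_symb_le hα hN0.le hR (hκ.pos R hR).le (hN R hR) hRξ⟩
    have h1 := le_neg_symb_one_re hA.ae_norm_le hA.integrable_sq hA.le_integral_inner_sq hRξ
    have h2 := symb_re_le (hle R hR)
      ((hπ.levyPair.map_smul hR (hκ.pos R hR).le).integrable (R • ξ))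
      (integrable_levyKer_one hA.integrable_sq (R • ξ))
    rw [rescaled, symb_map_smul hR (hκ.pos R hR).le, inv_smul_smul₀ hR.ne', Complex.re_ofReal_mul] at h2
    linarith
  refine ⟨fun ξ hξ => ?_, 8 * N0 / c1, fun ξ hξ => ?_⟩
  · obtain ⟨k, hk, h1, -⟩ := key ξ hξ
    have h2 : 0 < -(symb (chi σ) π ξ).re := pos_of_mul_pos_right (by linarith) hk.le
    linarith
  · obtain ⟨k, hk, h1, h2⟩ := key ξ hξ
    refine le_of_mul_le_mul_left ?_ hk
    calc k * ‖symb (chi σ) π ξ‖ ≤ 8 * N0 / c1 * (2 * c1) := by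
          refine h2.trans_eq ?_; field_simp; ring
      _ ≤ 8 * N0 / c1 * (k * -(symb (chi σ) π ξ).re) := by gcongr
      _ = _ := by ring

end Auxiliary

/-! ### From increments to the supremum. -/

section Sup

variable [Nontrivial V] {κ l : ℝ → ℝ} {δ p : ℝ}

lemma IsScaling.le_mul (hκ : IsScaling κ l) {r s : ℝ} (hr : 0 < r) (hrs : r ≤ s) :
    κ r ≤ l s * κ 1 := by
  have h1 := hκ.scaling r 1 hr one_pos
  rw [mul_one] at h1
  have h2 := hκ.factor_mono (show r ∈ Ioi (0 : ℝ) from hr) (show s ∈ Ioi (0 : ℝ) from hr.trans_le hrs)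
    hrs
  exact h1.trans (mul_le_mul_of_nonneg_right h2 (hκ.pos 1 one_pos).le)

/-- The scaling inequality keeps `κ` bounded near `0`, and the exponent `m / p` is smaller than the
dimension `m` because `p > 1`. -/
lemma integrableOn_scaling_rpow (hκ : IsScaling κ l) (hδ : 0 < δ) (hp : 1 < p) :
    IntegrableOn (fun z : V => κ ‖z‖ ^ δ * ‖z‖ ^ (-(Module.finrank ℝ V : ℝ) / p))
      (Metric.closedBall 0 1) := by
  have hm : 0 < Module.finrank ℝ V := Module.finrank_pos
  have hm' : (0 : ℝ) < Module.finrank ℝ V := by exact_mod_cast hm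
  have hae : ∀ᵐ z : V, z ≠ 0 := Measure.ae_ne volume 0
  have hmeas : AEStronglyMeasurable
      (fun z : V => κ ‖z‖ ^ δ * ‖z‖ ^ (-(Module.finrank ℝ V : ℝ) / p)) volume := by
    have h1 : ContinuousOn
        (fun z : V => κ ‖z‖ ^ δ * ‖z‖ ^ (-(Module.finrank ℝ V : ℝ) / p)) {0}ᶜ := by
      have h2 : ContinuousOn (fun z : V => κ ‖z‖) {0}ᶜ :=
        hκ.cont.comp continuous_norm.continuousOn fun z hz => norm_pos_iff.2 hz
      refine (h2.rpow_const fun z _ => Or.inr hδ.le).mul ?_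
      exact continuous_norm.continuousOn.rpow_const fun z hz => Or.inl (norm_ne_zero_iff.2 hz)
    have h3 := h1.aestronglyMeasurable (μ := volume) (measurableSet_singleton (0 : V)).compl
    rwa [Measure.restrict_eq_self_of_ae_mem] at h3
    exact hae
  refine IntegrableOn.mono_set ?_ (Metric.closedBall_subset_ball (show (1 : ℝ) < 2 by norm_num))
  refine integrableOn_ball_of_norm_le_rpow (C := (l 2 * κ 1) ^ δ)
    (α := (Module.finrank ℝ V : ℝ) / p) hm ?_ ?_ hmeas
  · rw [div_lt_iff₀ (by linarith)]; nlinarith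
  · filter_upwards [ae_restrict_of_ae hae, ae_restrict_mem Metric.isOpen_ball.measurableSet]
      with z hz hz2
    rw [mem_ball_zero_iff] at hz2
    have hz' := norm_pos_iff.2 hz
    have h1 := (hκ.pos _ hz').le
    rw [Real.norm_of_nonneg (by positivity), neg_div]
    gcongr
    exact hκ.le_mul hz' hz2.le

lemma setIntegral_scaling_rpow_pos (hκ : IsScaling κ l) (hδ : 0 < δ) (hp : 1 < p) :
    0 < ∫ z in Metric.closedBall (0 : V) 1,
      κ ‖z‖ ^ δ * ‖z‖ ^ (-(Module.finrank ℝ V : ℝ) / p) := by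
  have hpos : ∀ z : V, z ≠ 0 → 0 < κ ‖z‖ ^ δ * ‖z‖ ^ (-(Module.finrank ℝ V : ℝ) / p) := by
    intro z hz
    have hz' := norm_pos_iff.2 hz
    exact mul_pos (Real.rpow_pos_of_pos (hκ.pos _ hz') _) (Real.rpow_pos_of_pos hz' _)
  have hae : ∀ᵐ z : V, z ≠ 0 := Measure.ae_ne volume 0
  rw [setIntegral_pos_iff_support_of_nonneg_ae ?_ (integrableOn_scaling_rpow hκ hδ hp)]
  · refine lt_of_lt_of_le (Metric.measure_closedBall_pos volume (0 : V) one_pos) ?_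
    refine measure_mono_ae ?_
    filter_upwards [hae] with z hz hz1
    exact ⟨(hpos z hz).ne', hz1⟩
  · filter_upwards [ae_restrict_of_ae hae] with z hz
    exact (hpos z hz).le

lemma exists_one_le_volume_annulus :
    ∃ r : ℝ, 1 ≤ r ∧ 1 ≤ volume {z : V | 1 ≤ ‖z‖ ∧ ‖z‖ ≤ r} := by
  have := NormedSpace.noncompactSpace ℝ V
  have hU : (⋃ n : ℕ, {z : V | 1 ≤ ‖z‖ ∧ ‖z‖ ≤ n}) = (Metric.ball 0 1)ᶜ := by
    ext z
    simp only [mem_iUnion, mem_ofPred_eq, mem_compl_iff, mem_ball_zero_iff, not_lt]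
    exact ⟨fun ⟨_, h⟩ => h.1, fun h => (exists_nat_ge ‖z‖).imp fun n hn => ⟨h, hn⟩⟩
  have hinf : volume (Metric.ball (0 : V) 1)ᶜ = ∞ := by
    by_contra h
    have h1 := measure_univ_of_isAddLeftInvariant (volume : Measure V)
    rw [← union_compl_self (Metric.ball (0 : V) 1)] at h1
    have h2 := measure_union_le (μ := volume) (Metric.ball (0 : V) 1) (Metric.ball (0 : V) 1)ᶜ
    rw [h1] at h2
    exact absurd h2 (not_le.2 (ENNReal.add_lt_top.2 ⟨measure_ball_lt_top, lt_top_iff_ne_top.2 h⟩))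
  have hmono : Monotone fun n : ℕ => {z : V | 1 ≤ ‖z‖ ∧ ‖z‖ ≤ n} :=
    fun m n hmn z hz => ⟨hz.1, hz.2.trans (by exact_mod_cast hmn)⟩
  have ht := tendsto_measure_iUnion_atTop (μ := (volume : Measure V)) hmono
  rw [hU, hinf] at ht
  obtain ⟨n, hn, hn1⟩ := ((ht.eventually_const_lt (show (1 : ℝ≥0∞) < ∞ by simp)).and
    (eventually_ge_atTop 1)).exists
  exact ⟨n, by exact_mod_cast hn1, hn.le⟩

/-- A bound on the increments over a fixed annulus and on the `Lᵖ` norm bounds the supremum. -/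
lemma exists_norm_le_of_increment (hκ : IsScaling κ l) (hδ : 0 < δ) (hp : 1 < p) :
    ∃ K : ℝ, 0 ≤ K ∧ ∀ (g : V → ℂ) (D : ℝ), 0 ≤ D → MemLp g (ENNReal.ofReal p) →
      (∀ z : V, z ≠ 0 → ∀ x : V, ‖g (x + z) - g x‖
        ≤ D * (κ ‖z‖ ^ δ * ‖z‖ ^ (-(Module.finrank ℝ V : ℝ) / p))) →
      ∀ x, ‖g x‖ ≤ (eLpNorm g (ENNReal.ofReal p)).toReal + K * D := by
  obtain ⟨r, hr, hvol⟩ := exists_one_le_volume_annulus (V := V)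
  have hp0 : 0 < p := by linarith
  have hlk : 0 ≤ l r * κ 1 := (hκ.pos 1 one_pos).le.trans (hκ.le_mul one_pos hr)
  refine ⟨(l r * κ 1) ^ δ, by positivity, fun g D hD hg hinc x => ?_⟩
  by_contra hcon
  rw [not_le] at hcon
  set N := eLpNorm g (ENNReal.ofReal p) with hN
  set t := ‖g x‖ - (l r * κ 1) ^ δ * D with ht
  have htN : N.toReal < t := by rw [ht]; linarith
  -- If the bound fails at `x`, then `|g| ≥ t > ‖g‖_p` on a translate of the annulus. Its measure is
  -- at least one, which contradicts Chebyshev and explains the coefficient `1` of the norm.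
  have hsub : {z : V | 1 ≤ ‖z‖ ∧ ‖z‖ ≤ r} ⊆ (fun z => x + z) ⁻¹' {y | ENNReal.ofReal t ≤ ‖g y‖ₑ} := by
    rintro z ⟨hz1, hz2⟩
    have hz0 : 0 < ‖z‖ := by linarith
    have h1 := hinc z (norm_pos_iff.1 hz0) x
    have h2 : κ ‖z‖ ^ δ * ‖z‖ ^ (-(Module.finrank ℝ V : ℝ) / p) ≤ (l r * κ 1) ^ δ * 1 := by
      have := (hκ.pos _ hz0).le
      gcongr
      · exact hκ.le_mul hz0 hz2
      · refine Real.rpow_le_one_of_one_le_of_nonpos hz1 ?_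
        rw [neg_div]
        have : 0 ≤ (Module.finrank ℝ V : ℝ) / p := by positivity
        linarith
    have h3 : ‖g x‖ ≤ ‖g (x + z)‖ + ‖g (x + z) - g x‖ := by
      have := norm_sub_le (g (x + z)) (g (x + z) - g x)
      simpa using this
    have h4 := mul_le_mul_of_nonneg_left h2 hD
    simp only [mem_preimage, mem_ofPred_eq]
    rw [← ofReal_norm]
    refine ENNReal.ofReal_le_ofReal ?_
    rw [ht]; linarith
  have h5 : 1 ≤ volume {y | ENNReal.ofReal t ≤ ‖g y‖ₑ} := by
    rw [← measure_preimage_add volume x]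
    exact hvol.trans (measure_mono hsub)
  have h6 := mul_meas_ge_le_pow_eLpNorm' volume (p := ENNReal.ofReal p) (by simpa using hp0)
    ENNReal.ofReal_ne_top hg.1 (ENNReal.ofReal t)
  rw [ENNReal.toReal_ofReal hp0.le, ← hN] at h6
  have h7 : ENNReal.ofReal t ^ p ≤ N ^ p := (le_mul_of_one_le_right' h5).trans h6
  have h8 : ENNReal.ofReal t ≤ N := (ENNReal.rpow_le_rpow_iff hp0).1 h7
  have h9 := (ENNReal.ofReal_le_iff_le_toReal hg.2.ne).1 h8
  linarith

end Sup

section Schwartz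

variable {d : ℕ}

/-- A real Schwartz function viewed as a complex one. -/
def complexify (f : 𝓢(Rd d, ℝ)) : 𝓢(Rd d, ℂ) :=
  SchwartzMap.postcompCLM (𝕜 := ℝ) Complex.ofRealCLM f

lemma coe_complexify (f : 𝓢(Rd d, ℝ)) : (complexify f : Rd d → ℂ) = fun x => (f x : ℂ) := rfl

lemma opL_eq (σ : ℝ) (π : Measure (Rd d)) (δ : ℝ) (f : 𝓢(Rd d, ℝ)) :
    opL σ π δ f = 𝓕⁻ fun ξ => powMultiplier (symb (chi σ) π) δ ξ * 𝓕 (complexify f : Rd d → ℂ) ξ :=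
  rfl

lemma norm_complexify_sub (f : 𝓢(Rd d, ℝ)) (x y : Rd d) :
    ‖complexify f x - complexify f y‖ = |f x - f y| := by
  rw [coe_complexify, ← Complex.ofReal_sub, Complex.norm_real, Real.norm_eq_abs]

end Schwartz

end LevySmooth

end

/-! ### Assembly for the symbol of `π`. -/

theorem mainTheorem6 (d : ℕ) (hd : 0 < d) (σ : ℝ)
    (π : Measure (LevySmooth.Rd d)) (hπ : LevySmooth.ClassA σ π)
    (κ l : ℝ → ℝ) (hκ : LevySmooth.IsScaling κ l)
    (hD : LevySmooth.AssumptionD σ κ π) (hB : LevySmooth.AssumptionB σ κ π)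
    (δ p : ℝ) (hδ0 : 0 < δ) (hδ1 : δ ≤ 1) (hp : 1 < p)
    (hγ0 : IntegrableOn
      (fun t : ℝ => t ^ (δ - 1) * LevySmooth.gam l t ^ (-(d : ℝ) / p)) (Ioc 0 1) volume)
    (hγ1 : IntegrableOn
      (fun t : ℝ => t ^ (δ - 1) * LevySmooth.gam l t ^ (-1 - (d : ℝ) / p)) (Ioi 1) volume) :
    (∀ f : 𝓢(LevySmooth.Rd d, ℝ),
      MemLp (LevySmooth.opL σ π δ f) (ENNReal.ofReal p) volume) ∧
    (∃ C : ℝ, ∀ (f : 𝓢(LevySmooth.Rd d, ℝ)) (z : LevySmooth.Rd d), z ≠ 0 →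
      ∀ x : LevySmooth.Rd d,
        |f (x + z) - f x| ≤
          C * κ ‖z‖ ^ δ * ‖z‖ ^ (-(d : ℝ) / p)
            * LevySmooth.normLp p (LevySmooth.opL σ π δ f)) ∧
    IntegrableOn (fun z : LevySmooth.Rd d => κ ‖z‖ ^ δ * ‖z‖ ^ (-(d : ℝ) / p))
      (Metric.closedBall 0 1) volume ∧
    (∃ C : ℝ, ∀ (f : 𝓢(LevySmooth.Rd d, ℝ)) (x : LevySmooth.Rd d),
        |f x| ≤
          LevySmooth.normLp p (fun y => (f y : ℂ))
          + C * LevySmooth.normLp p (LevySmooth.opL σ π δ f)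
            * ∫ z in Metric.closedBall (0 : LevySmooth.Rd d) 1,
                κ ‖z‖ ^ δ * ‖z‖ ^ (-(d : ℝ) / p)) := by
  have hfin : Module.finrank ℝ (LevySmooth.Rd d) = d := finrank_euclideanSpace_fin
  have : Nontrivial (LevySmooth.Rd d) :=
    Module.nontrivial_of_finrank_pos (R := ℝ) (by rw [hfin]; exact hd)
  obtain ⟨⟨C₁, hC₁, hK⟩, C₂, hC₂, hK'⟩ := LevySmooth.exists_kernelBound_symb hπ hκ hD hB
  obtain ⟨hre, B, hBd⟩ := LevySmooth.exists_norm_symb_le_re hπ hκ hD hB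
  have hp0 : 0 < p := by linarith
  have hmem : ∀ f : 𝓢(LevySmooth.Rd d, ℝ),
      MemLp (LevySmooth.opL σ π δ f) (ENNReal.ofReal p) volume := by
    intro f
    have h1 := LevySmooth.integrable_powMultiplier_mul_fourier hκ (LevySmooth.measurable_chi σ)
      hπ.zero_null hπ.integrable_levyMaj (LevySmooth.chi_neg σ) hK' hδ0 hδ1
      (LevySmooth.complexify f)
    exact LevySmooth.memLp_fourierInv h1.1 h1.2 hp
  obtain ⟨C, hC, hinc⟩ := LevySmooth.exists_norm_increment_schwartz_le hκ
    (LevySmooth.measurable_chi σ) hπ.zero_null hπ.integrable_levyMaj (LevySmooth.chi_neg σ)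
    hC₁ hK hC₂ hK' hre hBd hδ0 hδ1 hp (by rw [hfin]; exact hγ0) (by rw [hfin]; exact hγ1)
  obtain ⟨K, hK0, hsup⟩ := LevySmooth.exists_norm_le_of_increment (V := LevySmooth.Rd d) hκ hδ0 hp
  have hint := LevySmooth.integrableOn_scaling_rpow (V := LevySmooth.Rd d) hκ hδ0 hp
  have hpos := LevySmooth.setIntegral_scaling_rpow_pos (V := LevySmooth.Rd d) hκ hδ0 hp
  simp only [hfin] at hinc hsup hint hpos
  refine ⟨hmem, ⟨C, fun f z hz x => ?_⟩, hint, ?_⟩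
  · rw [← LevySmooth.norm_complexify_sub]
    exact hinc (LevySmooth.complexify f) z hz x
  · set I := ∫ z in Metric.closedBall (0 : LevySmooth.Rd d) 1,
      κ ‖z‖ ^ δ * ‖z‖ ^ (-(d : ℝ) / p) with hI
    -- The integral `I` is a fixed positive number, so dividing the constant by it gives the stated
    -- form.
    refine ⟨K * C / I, fun f x => ?_⟩
    have hN : 0 ≤ LevySmooth.normLp p (LevySmooth.opL σ π δ f) := ENNReal.toReal_nonneg
    have h1 := hsup (LevySmooth.complexify f) (C * LevySmooth.normLp p (LevySmooth.opL σ π δ f))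
      (by positivity) ((LevySmooth.complexify f).memLp _ _) (fun z hz x => by
        refine (hinc (LevySmooth.complexify f) z hz x).trans_eq ?_
        rw [LevySmooth.normLp, LevySmooth.opL_eq]
        ring) x
    have h2 : ‖LevySmooth.complexify f x‖ = |f x| := by
      rw [LevySmooth.coe_complexify, Complex.norm_real, Real.norm_eq_abs]
    rw [h2] at h1
    refine h1.trans_eq ?_
    have h3 : K * C / I * LevySmooth.normLp p (LevySmooth.opL σ π δ f) * I
        = K * (C * LevySmooth.normLp p (LevySmooth.opL σ π δ f)) := by
      field_simp
    rw [h3]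
    rfl
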